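/- A polygonal curve of complexity $m\ge 1$ in $\mathbb{R}^d$ is a sequence of $m$ vertices in $\mathbb{R}^d$. A traversal of curves $\langle p_1,\dots,p_a\rangle$ and $\langle q_1,\dots,q_b\rangle$ is a sequence of index pairs that begins with $(1,1)$, ends with $(a,b)$, and in which $(i,j)$ is followed only by $(i+1,j)$, $(i,j+1)$ or $(i+1,j+1)$. The discrete Fréchet distance $d_{DF}$ of the two curves is the minimum over all traversals $T$ of $\max_{(i,j)\in T}\|p_i-q_j\|_2$. Given curves $P_1,\dots,P_n$ and $\delta\ge 0$, a (not necessarily ordered) middle curve at distance $\delta$ is a curve $M$, each of whose vertices is a vertex of some $P_j$, with $d_{DF}(M,P_j)\le\delta$ for all $j$. For $\ell\ge 1$, the Parameterized Middle Curve optimization problem asks for a middle curve of complexity at most $\ell$ that minimizes $\delta$; let $\delta_{\mathrm{opt}}$ be the minimum. Theorem. There is a deterministic real RAM algorithm that, for every $d$, every $\varepsilon>0$, every $n\ge1$ and $\ell\ge 1$, and all curves $P_1,\dots,P_n$ in $\mathbb{R}^d$ of complexity at most $m$, on input $(d,n,\ell,\varepsilon,P_1,\dots,P_n)$ outputs a curve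 of complexity at most $\ell$ that is a middle curve of $P_1,\dots,P_n$ at distance $(2+\varepsilon)\,\delta_{\mathrm{opt}}$, that is, a $(2+\varepsilon)$-approximation of the Parameterized Middle Curve optimization problem under the discrete Fréchet distance. Its running time is $$O\Big(\big((c\ell)^{\ell}+\log(\ell+n)\big)\,\ell\, m\, n\Big),\qquad c=\Big(\frac{4\sqrt d}{\varepsilon}+1\Big)^{d},$$ where the constant hidden in the $O$-notation depends only on the dimension $d$ (not on $\varepsilon$, $n$, $m$, $\ell$ or the curves). The real RAM performs arithmetic ($+,-,\times$) and comparisons on natural numbers, $+,-,\times,/,\sqrt{\ }$ and comparisons on real numbers, the conversion of a natural number to a real number, and indexed memory access, each in unit time; it has no rounding operation from real numbers to integers. -/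

import Mathlib

noncomputable section

namespace MiddleCurve

/-! ### Polygonal curves, discrete Fréchet distance, middle curves -/

/-- A polygonal curve in `ℝ^d`, given by its finite nonempty sequence of vertices;
the number of vertices is its complexity. -/
structure Curve (d : ℕ) where
  complexity : ℕ
  complexity_pos : 0 < complexity
  vertex : Fin complexity → EuclideanSpace ℝ (Fin d)

variable {d : ℕ}

/-- The index of the first vertex. -/
def Curve.first (P : Curve d) : Fin P.complexity := ⟨0, P.complexity_pos⟩

/-- The index of the last vertex. -/
def Curve.last (P : Curve d) : Fin P.complexity :=
  ⟨P.complexity - 1, Nat.sub_lt P.complexity_pos Nat.one_pos⟩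

/-- The pair `a = (i, j)` may be followed by `b` only if `b` is one of
`(i + 1, j)`, `(i, j + 1)`, `(i + 1, j + 1)`. -/
def TraversalStep {p q : ℕ} (a b : Fin p × Fin q) : Prop :=
  ((b.1 : ℕ) = a.1 + 1 ∧ (b.2 : ℕ) = a.2) ∨
  ((b.1 : ℕ) = a.1 ∧ (b.2 : ℕ) = a.2 + 1) ∨
  ((b.1 : ℕ) = a.1 + 1 ∧ (b.2 : ℕ) = a.2 + 1)

/-- A traversal of two curves: a sequence of pairs of vertex indices that begins with the two
first vertices, ends with the two last vertices, and advances by `TraversalStep`. -/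
def IsTraversal (P Q : Curve d) (T : List (Fin P.complexity × Fin Q.complexity)) : Prop :=
  T.head? = some (P.first, Q.first) ∧
  T.getLast? = some (P.last, Q.last) ∧
  T.IsChain TraversalStep

/-- The largest Euclidean distance between the pairs of vertices of a traversal. -/
def traversalCost (P Q : Curve d) (T : List (Fin P.complexity × Fin Q.complexity)) : ℝ :=
  sSup {r : ℝ | ∃ a ∈ T, r = dist (P.vertex a.1) (Q.vertex a.2)}

/-- The discrete Fréchet distance: the least cost of a traversal. -/
def discreteFrechet (P Q : Curve d) : ℝ :=
  sInf {r : ℝ | ∃ T, IsTraversal P Q T ∧ r = traversalCost P Q T}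

/-- `M` is an (unordered) middle curve at distance `δ` to the curves `P i`: every vertex of `M` is
a vertex of one of the `P i`, and `M` has discrete Fréchet distance at most `δ` to every `P i`. -/
def IsMiddleCurve {n : ℕ} (P : Fin n → Curve d) (δ : ℝ) (M : Curve d) : Prop :=
  (∀ j, ∃ i k, M.vertex j = (P i).vertex k) ∧ ∀ i, discreteFrechet M (P i) ≤ δ

/-- The optimal value of the parameterized middle curve optimization problem: the least `δ` such
that there is a middle curve at distance `δ` of complexity at most `l`. -/
def optimalDistance {n : ℕ} (P : Fin n → Curve d) (l : ℕ) : ℝ :=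
  sInf {δ : ℝ | ∃ M : Curve d, M.complexity ≤ l ∧ IsMiddleCurve P δ M}

/-- `M` is an `α`-approximate solution of the parameterized middle curve optimization problem. -/
def IsApproxMiddleCurve {n : ℕ} (α : ℝ) (P : Fin n → Curve d) (l : ℕ) (M : Curve d) : Prop :=
  M.complexity ≤ l ∧ IsMiddleCurve P (α * optimalDistance P l) M

/-! ### A real random access machine

Programs of a real RAM, presented with structured control flow. The storage consists of
natural-number variables (used for counting and addressing), real variables, and arrays of both
sorts; a program mentions only finitely many variables and arrays, which are named by fixed
numbers. Every instruction and every test costs one time step. There is no rounding operation from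
reals to integers, and the only constants are natural numbers. -/

/-- The storage of the machine. -/
structure Store where
  natVar : ℕ → ℕ
  realVar : ℕ → ℝ
  natArr : ℕ → ℕ → ℕ
  realArr : ℕ → ℕ → ℝ

/-- Basic instructions; `x y z` name variables, `a` names an array. -/
inductive Instr where
  | natConst (x k : ℕ)
  | natAdd (x y z : ℕ)
  | natSub (x y z : ℕ)
  | natMul (x y z : ℕ)
  | natLoad (x a y : ℕ)
  | natStore (a y x : ℕ)
  | realOfNat (x y : ℕ)
  | realAdd (x y z : ℕ)
  | realSub (x y z : ℕ)
  | realMul (x y z : ℕ)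
  | realDiv (x y z : ℕ)
  | realSqrt (x y : ℕ)
  | realLoad (x a y : ℕ)
  | realStore (a y x : ℕ)

/-- Assignment to a natural-number variable. -/
def Store.setNat (s : Store) (x v : ℕ) : Store :=
  { s with natVar := Function.update s.natVar x v }

/-- Assignment to a real variable. -/
def Store.setReal (s : Store) (x : ℕ) (v : ℝ) : Store :=
  { s with realVar := Function.update s.realVar x v }

/-- Assignment to cell `i` of the natural-number array `a`. -/
def Store.setNatArr (s : Store) (a i v : ℕ) : Store :=
  { s with natArr := Function.update s.natArr a (Function.update (s.natArr a) i v) }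

/-- Assignment to cell `i` of the real array `a`. -/
def Store.setRealArr (s : Store) (a i : ℕ) (v : ℝ) : Store :=
  { s with realArr := Function.update s.realArr a (Function.update (s.realArr a) i v) }

/-- The effect of an instruction. Subtraction of natural numbers is truncated, division by zero
gives zero, and the square root of a negative number is zero. -/
def Instr.apply : Instr → Store → Store
  | natConst x k, s => s.setNat x k
  | natAdd x y z, s => s.setNat x (s.natVar y + s.natVar z)
  | natSub x y z, s => s.setNat x (s.natVar y - s.natVar z)
  | natMul x y z, s => s.setNat x (s.natVar y * s.natVar z)
  | natLoad x a y, s => s.setNat x (s.natArr a (s.natVar y))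
  | natStore a y x, s => s.setNatArr a (s.natVar y) (s.natVar x)
  | realOfNat x y, s => s.setReal x (s.natVar y : ℝ)
  | realAdd x y z, s => s.setReal x (s.realVar y + s.realVar z)
  | realSub x y z, s => s.setReal x (s.realVar y - s.realVar z)
  | realMul x y z, s => s.setReal x (s.realVar y * s.realVar z)
  | realDiv x y z, s => s.setReal x (s.realVar y / s.realVar z)
  | realSqrt x y, s => s.setReal x (Real.sqrt (s.realVar y))
  | realLoad x a y, s => s.setReal x (s.realArr a (s.natVar y))
  | realStore a y x, s => s.setRealArr a (s.natVar y) (s.realVar x)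

/-- Tests: comparisons of two variables of the same sort. -/
inductive Test where
  | natLt (x y : ℕ)
  | realLt (x y : ℕ)

/-- The outcome of a test. -/
def Test.Holds : Test → Store → Prop
  | natLt x y, s => s.natVar x < s.natVar y
  | realLt x y, s => s.realVar x < s.realVar y

/-- Programs. -/
inductive Prog where
  | skip
  | instr (i : Instr)
  | seq (p q : Prog)
  | cond (b : Test) (p q : Prog)
  | loop (b : Test) (p : Prog)

/-- `Exec p s s' t`: started in store `s`, the program `p` halts in store `s'` after exactly `t`
time steps. The program `loop b p` repeats `p` as long as `b` holds. -/
inductive Exec : Prog → Store → Store → ℕ → Prop where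
  | skip (s : Store) : Exec .skip s s 1
  | instr (i : Instr) (s : Store) : Exec (.instr i) s (i.apply s) 1
  | seq {p q : Prog} {s₁ s₂ s₃ : Store} {t₁ t₂ : ℕ} :
      Exec p s₁ s₂ t₁ → Exec q s₂ s₃ t₂ → Exec (.seq p q) s₁ s₃ (t₁ + t₂)
  | condTrue {b : Test} {p q : Prog} {s s' : Store} {t : ℕ} :
      b.Holds s → Exec p s s' t → Exec (.cond b p q) s s' (t + 1)
  | condFalse {b : Test} {p q : Prog} {s s' : Store} {t : ℕ} :
      ¬ b.Holds s → Exec q s s' t → Exec (.cond b p q) s s' (t + 1)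
  | loopTrue {b : Test} {p : Prog} {s₁ s₂ s₃ : Store} {t₁ t₂ : ℕ} :
      b.Holds s₁ → Exec p s₁ s₂ t₁ → Exec (.loop b p) s₂ s₃ t₂ →
      Exec (.loop b p) s₁ s₃ (t₁ + t₂ + 1)
  | loopFalse {b : Test} {p : Prog} {s : Store} :
      ¬ b.Holds s → Exec (.loop b p) s s 1

/-! ### Input and output -/

/-- The coordinates of the vertices of a curve, vertex after vertex. -/
def Curve.coords (P : Curve d) : List ℝ :=
  (List.ofFn P.vertex).flatMap fun p => List.ofFn fun k => p k

/-- The initial store for the input curves `P i`, the parameter `l` and the precision `ε`.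
The variables hold `d`, `n`, `l` and `ε`, the natural-number array `0` holds the complexities of the
curves, and the real array `0` holds the coordinates of all vertices, curve after curve. Everything
else is zero. -/
def initialStore {n : ℕ} (P : Fin n → Curve d) (l : ℕ) (ε : ℝ) : Store where
  natVar x := [d, n, l].getD x 0
  realVar x := [ε].getD x 0
  natArr a x := if a = 0 then (List.ofFn fun i => (P i).complexity).getD x 0 else 0
  realArr a x := if a = 0 then ((List.ofFn P).flatMap Curve.coords).getD x 0 else 0

/-- The store `s` presents the curve `M` as output: its complexity is in the natural-number
variable `0`, and its coordinates, vertex after vertex, are in the real array `1`. -/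
def Outputs (s : Store) (M : Curve d) : Prop :=
  s.natVar 0 = M.complexity ∧
    ∀ (j : Fin M.complexity) (k : Fin d), s.realArr 1 ((j : ℕ) * d + (k : ℕ)) = M.vertex j k

end MiddleCurve

end

/-! ### Overview

The algorithm computes a 2-approximation, whatever `ε` is. It clusters the first curve in one pass
into at most `l` consecutive groups, which gives a middle curve of cost at most 10 times the
optimum. Around each of its vertices it selects a net of the input vertices, of size bounded in
terms of `d`, and it evaluates by dynamic programming all sequences of at most `l` net points that
belong to these vertices in order. There are only singly exponentially many such sequences, and
for a fixed base this is `O(l ^ l)`. -/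

noncomputable section

namespace MiddleCurve

/-! ### The discrete Fréchet distance by dynamic programming -/

/-! The precision can be ignored: a 2-approximation is in particular a (2 + ε)-approximation. Since
c = (4√d/ε + 1)^d ≥ 1, the time bound dominates ℓ^ℓ · ℓmn, and `pow_le_pow_self` shows that B^ℓ ≤
B^B ℓ^ℓ. So a running time of B^ℓ · ℓmn is enough, for any base B depending only on d, and the
logarithmic term is not needed.

Let δ be attained by some middle curve M of complexity at most ℓ. A discrete Fréchet distance is at
most δ exactly when a monotone lattice path runs through cells of distance at most δ
(`discreteFrechet_le_iff`). Matching the first input curve to M in this way shows, by the pigeonhole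
principle, that among ℓ + 1 centres taken in order along this curve two consecutive ones are within
2δ (`exists_consecutive_dist_le`). The clustering keeps centres with consecutive gaps above a
threshold r. When there are ℓ + 1 of them, r becomes twice the least gap and the centres are thinned
out (`StreamInv.overflow`). Hence always r ≤ 4δ, and the cluster radius is at most 2r ≤ 8δ. By two
triangle inequalities the centres form a middle curve of cost D ≤ 10δ (`StreamInv.cost_le`). This
holds for every such δ, so no value of δ has to be guessed.

If D ≤ 2δ, the centres already suffice. Otherwise put η = D/10 ≤ δ and ρ = 90η = 9D ≥ 9δ. Each
vertex of M lies within 9δ of a centre, and these centres occur in order. A greedy η-net of the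
input vertices in the ρ-ball around that centre has a point within δ of the vertex, and replacing
all vertices of M by such points yields cost at most 2δ (`StreamInv.exists_net_sequence`). As ρ/η is
fixed, every net has at most γ = γ(d) points (`exists_packing_bound`).

An ordered sequence of net points consists of at most ℓ moves to the next centre and at most ℓ
choices of a net point, so it is encoded by a word of length 2ℓ over at most γ + 1 digits
(`exists_word`). Trying all words is singly exponential in ℓ. The program itself does not know γ,
which enters only the analysis; it uses the largest net size found, so one program serves all
dimensions. -/

/-- The cells `(i, j)` that can be reached from `(0, 0)` by traversal steps through cells
satisfying `w`. -/
inductive Reach (w : ℕ → ℕ → Prop) : ℕ → ℕ → Prop where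
  | base : w 0 0 → Reach w 0 0
  | fst {i j : ℕ} : Reach w i j → w (i + 1) j → Reach w (i + 1) j
  | snd {i j : ℕ} : Reach w i j → w i (j + 1) → Reach w i (j + 1)
  | both {i j : ℕ} : Reach w i j → w (i + 1) (j + 1) → Reach w (i + 1) (j + 1)

theorem Reach.holds {w : ℕ → ℕ → Prop} {i j : ℕ} (h : Reach w i j) : w i j := by
  cases h <;> assumption

theorem Reach.mono {w w' : ℕ → ℕ → Prop} {i j : ℕ} (h : Reach w i j)
    (hw : ∀ a b, a ≤ i → b ≤ j → w a b → w' a b) : Reach w' i j := by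
  induction h with
  | base h => exact .base (hw _ _ le_rfl le_rfl h)
  | fst _ h ih => exact .fst (ih fun a b ha hb => hw a b (by omega) hb) (hw _ _ le_rfl le_rfl h)
  | snd _ h ih => exact .snd (ih fun a b ha hb => hw a b ha (by omega)) (hw _ _ le_rfl le_rfl h)
  | both _ h ih =>
    exact .both (ih fun a b ha hb => hw a b (by omega) (by omega)) (hw _ _ le_rfl le_rfl h)

theorem Reach.swap {w : ℕ → ℕ → Prop} {i j : ℕ} (h : Reach w i j) :
    Reach (fun a b => w b a) j i := by
  induction h with
  | base h => exact .base h
  | fst _ h ih => exact .snd ih h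
  | snd _ h ih => exact .fst ih h
  | both _ h ih => exact .both ih h

/-- Traversals compose, which gives the triangle inequality for the discrete Fréchet distance at the
level of thresholds. The induction on the sum of the three indices peels off last steps; when both
paths have just advanced the shared middle index, both are shortened at once. -/
theorem Reach.comp {w₁ w₂ w₃ : ℕ → ℕ → Prop}
    (hw : ∀ a b c, w₁ a b → w₂ b c → w₃ a c) :
    ∀ {i j k : ℕ}, Reach w₁ i j → Reach w₂ j k → Reach w₃ i k := by
  suffices H : ∀ s i j k : ℕ, i + j + k = s → Reach w₁ i j → Reach w₂ j k → Reach w₃ i k from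
    fun {i j k} h₁ h₂ => H _ i j k rfl h₁ h₂
  intro s
  induction s using Nat.strong_induction_on with
  | _ s ih =>
    intro i j k hs h₁ h₂
    have hik := hw _ _ _ h₁.holds h₂.holds
    cases h₁ with
    | base _ =>
      cases h₂ with
      | base _ => exact .base hik
      | snd h₂ _ => exact .snd (ih _ (by omega) 0 0 _ rfl (.base ‹_›) h₂) hik
    | fst h₁ _ => exact .fst (ih _ (by omega) _ _ _ rfl h₁ h₂) hik
    | @snd i j h₁ h₁w =>
      cases h₂ with
      | fst h₂ _ => exact ih _ (by omega) _ _ _ rfl h₁ h₂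
      | snd h₂ _ => exact .snd (ih _ (by omega) _ _ _ rfl (.snd h₁ h₁w) h₂) hik
      | both h₂ _ => exact .snd (ih _ (by omega) _ _ _ rfl h₁ h₂) hik
    | @both i j h₁ h₁w =>
      cases h₂ with
      | fst h₂ _ => exact .fst (ih _ (by omega) _ _ _ rfl h₁ h₂) hik
      | snd h₂ _ => exact .snd (ih _ (by omega) _ _ _ rfl (.both h₁ h₁w) h₂) hik
      | both h₂ _ => exact .both (ih _ (by omega) _ _ _ rfl h₁ h₂) hik

/-- Along reachable cells, the first index can be chosen as a monotone function of the second. -/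
theorem Reach.exists_monotone {w : ℕ → ℕ → Prop} {i j : ℕ} (h : Reach w i j) :
    ∃ f : ℕ → ℕ, Monotone f ∧ (∀ b, f b ≤ i) ∧ ∀ b ≤ j, w (f b) b := by
  induction h with
  | base h => exact ⟨fun _ => 0, monotone_const, by simp, by simpa using h⟩
  | fst _ _ ih =>
    obtain ⟨f, hf, hi, hw⟩ := ih
    exact ⟨f, hf, fun b => (hi b).trans (Nat.le_succ _), hw⟩
  | @snd i j _ h ih =>
    obtain ⟨f, hf, hi, hw⟩ := ih
    -- A new column receives the row in which the path enters it. Later columns get the same value,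
    -- so that the function is monotone on all of `ℕ`.
    refine ⟨fun b => if b ≤ j then f b else i, ?_, ?_, ?_⟩
    · intro a b hab
      have := hf hab
      have := hi a
      dsimp only
      split_ifs <;> omega
    · intro b
      have := hi b
      dsimp only
      split_ifs <;> omega
    · intro b hb
      by_cases hbj : b ≤ j
      · simpa [hbj] using hw b hbj
      · obtain rfl : b = j + 1 := by omega
        simpa using h
  | @both i j _ h ih =>
    obtain ⟨f, hf, hi, hw⟩ := ih
    refine ⟨fun b => if b ≤ j then f b else i + 1, ?_, ?_, ?_⟩
    · intro a b hab
      have := hf hab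
      have := hi a
      dsimp only
      split_ifs <;> omega
    · intro b
      have := hi b
      dsimp only
      split_ifs <;> omega
    · intro b hb
      by_cases hbj : b ≤ j
      · simpa [hbj] using hw b hbj
      · obtain rfl : b = j + 1 := by omega
        simpa using h

/-- The bottleneck cost of reaching `(i, j)` from `(0, 0)` by traversal steps. -/
def bottleneck (w : ℕ → ℕ → ℝ) : ℕ → ℕ → ℝ
  | 0, 0 => w 0 0
  | i + 1, 0 => max (bottleneck w i 0) (w (i + 1) 0)
  | 0, j + 1 => max (bottleneck w 0 j) (w 0 (j + 1))
  | i + 1, j + 1 =>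
    max (min (min (bottleneck w i (j + 1)) (bottleneck w (i + 1) j)) (bottleneck w i j))
      (w (i + 1) (j + 1))
termination_by i j => i + j

/-- A min-max over paths is at most `δ` exactly when some path uses only weights at most `δ`. Costs
are compared through such paths from here on, not through the recursion. -/
theorem bottleneck_le_iff {w : ℕ → ℕ → ℝ} {δ : ℝ} :
    ∀ {i j : ℕ}, bottleneck w i j ≤ δ ↔ Reach (fun a b => w a b ≤ δ) i j := by
  suffices H : ∀ s i j : ℕ, i + j = s →
      (bottleneck w i j ≤ δ ↔ Reach (fun a b => w a b ≤ δ) i j) from fun {i j} => H _ i j rfl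
  intro s
  induction s using Nat.strong_induction_on with
  | _ s ih =>
    intro i j hs
    match i, j with
    | 0, 0 =>
      rw [bottleneck]
      exact ⟨fun h => Reach.base (w := fun a b => w a b ≤ δ) h, fun h => h.holds⟩
    | i + 1, 0 =>
      rw [bottleneck, max_le_iff, ih (i + 0) (by omega) i 0 rfl]
      refine ⟨fun h => .fst h.1 h.2, fun h => ⟨?_, h.holds⟩⟩
      cases h with
      | fst h _ => exact h
    | 0, j + 1 =>
      rw [bottleneck, max_le_iff, ih (0 + j) (by omega) 0 j rfl]
      refine ⟨fun h => .snd h.1 h.2, fun h => ⟨?_, h.holds⟩⟩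
      cases h with
      | snd h _ => exact h
    | i + 1, j + 1 =>
      rw [bottleneck, max_le_iff, min_le_iff, min_le_iff, ih (i + (j + 1)) (by omega) i _ rfl,
        ih (i + 1 + j) (by omega) _ j rfl, ih (i + j) (by omega) i j rfl]
      refine ⟨fun h => ?_, fun h => ⟨?_, h.holds⟩⟩
      · rcases h with ⟨(h | h) | h, hw⟩
        exacts [.fst h hw, .snd h hw, .both h hw]
      · cases h with
        | fst h _ => exact .inl (.inl h)
        | snd h _ => exact .inl (.inr h)
        | both h _ => exact .inr h

/-! ### Traversals of curves as lattice paths -/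

variable {d : ℕ}

/-- The vertices of a curve, indexed by natural numbers; zero out of range. -/
def Curve.nth (P : Curve d) (i : ℕ) : EuclideanSpace ℝ (Fin d) :=
  if h : i < P.complexity then P.vertex ⟨i, h⟩ else 0

theorem Curve.nth_coe (P : Curve d) (i : Fin P.complexity) : P.nth i = P.vertex i := by
  simp [Curve.nth]

theorem Curve.nth_of_lt (P : Curve d) {i : ℕ} (h : i < P.complexity) :
    P.nth i = P.vertex ⟨i, h⟩ := by
  simp [Curve.nth, h]

theorem reach_getLast {p q : ℕ} {w : ℕ → ℕ → Prop} (T : List (Fin p × Fin q)) :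
    ∀ x : Fin p × Fin q, Reach w x.1 x.2 → (x :: T).IsChain TraversalStep →
      (∀ a ∈ T, w a.1 a.2) → ∀ y, (x :: T).getLast? = some y → Reach w y.1 y.2 := by
  induction T with
  | nil =>
    intro x hx _ _ y hy
    simp only [List.getLast?_singleton, Option.some.injEq] at hy
    exact hy ▸ hx
  | cons z T ih =>
    intro x hx hc hw y hy
    rw [List.isChain_cons_cons] at hc
    refine ih z ?_ hc.2 (fun a ha => hw a (List.mem_cons_of_mem _ ha)) y (by simpa using hy)
    have hz := hw z (by simp)
    rcases hc.1 with ⟨h1, h2⟩ | ⟨h1, h2⟩ | ⟨h1, h2⟩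
    · rw [h1, h2] at hz ⊢
      exact .fst hx hz
    · rw [h1, h2] at hz ⊢
      exact .snd hx hz
    · rw [h1, h2] at hz ⊢
      exact .both hx hz

theorem reach_of_isTraversal {P Q : Curve d} {w : ℕ → ℕ → Prop}
    {T : List (Fin P.complexity × Fin Q.complexity)} (hT : IsTraversal P Q T)
    (hw : ∀ a ∈ T, w a.1 a.2) : Reach w (P.complexity - 1) (Q.complexity - 1) := by
  obtain ⟨hh, hl, hc⟩ := hT
  cases T with
  | nil => simp at hh
  | cons x T =>
    simp only [List.head?_cons, Option.some.injEq] at hh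
    subst hh
    exact reach_getLast T _ (.base (hw _ List.mem_cons_self)) hc
      (fun a ha => hw a (List.mem_cons_of_mem _ ha)) _ hl

theorem exists_list_of_reach {p q : ℕ} (hp : 0 < p) (hq : 0 < q) {w : ℕ → ℕ → Prop} {i j : ℕ}
    (h : Reach w i j) (hi : i < p) (hj : j < q) :
    ∃ T : List (Fin p × Fin q), T.head? = some (⟨0, hp⟩, ⟨0, hq⟩) ∧
      T.getLast? = some (⟨i, hi⟩, ⟨j, hj⟩) ∧ T.IsChain TraversalStep ∧ ∀ a ∈ T, w a.1 a.2 := by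
  -- One argument for appending a pair covers the three kinds of step.
  have extend : ∀ {i' j' i j : ℕ} (hi' : i' < p) (hj' : j' < q) (hi : i < p) (hj : j < q),
      (∃ T : List (Fin p × Fin q), T.head? = some (⟨0, hp⟩, ⟨0, hq⟩) ∧
        T.getLast? = some (⟨i', hi'⟩, ⟨j', hj'⟩) ∧ T.IsChain TraversalStep ∧
        ∀ a ∈ T, w a.1 a.2) →
      w i j → TraversalStep (⟨i', hi'⟩, ⟨j', hj'⟩) ((⟨i, hi⟩, ⟨j, hj⟩) : Fin p × Fin q) →
      ∃ T : List (Fin p × Fin q), T.head? = some (⟨0, hp⟩, ⟨0, hq⟩) ∧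
        T.getLast? = some (⟨i, hi⟩, ⟨j, hj⟩) ∧ T.IsChain TraversalStep ∧ ∀ a ∈ T, w a.1 a.2 := by
    rintro i' j' i j hi' hj' hi hj ⟨T, hh, hl, hc, hw⟩ hij hs
    refine ⟨T ++ [(⟨i, hi⟩, ⟨j, hj⟩)], ?_, by simp, ?_, ?_⟩
    · rw [List.head?_append, hh]
      rfl
    · refine List.isChain_append.2 ⟨hc, by simp, ?_⟩
      intro x hx y hy
      rw [hl] at hx
      simp only [List.head?_cons, Option.mem_def, Option.some.injEq] at hx hy
      rw [← hx, ← hy]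
      exact hs
    · intro a ha
      rcases List.mem_append.1 ha with ha | ha
      · exact hw a ha
      · rw [List.mem_singleton] at ha
        rw [ha]
        exact hij
  induction h with
  | base h =>
    refine ⟨[(⟨0, hp⟩, ⟨0, hq⟩)], by simp, by simp, by simp, ?_⟩
    intro a ha
    rw [List.mem_singleton] at ha
    rw [ha]
    exact h
  | fst _ h ih => exact extend (by omega) hj hi hj (ih (by omega) hj) h (.inl ⟨rfl, rfl⟩)
  | snd _ h ih => exact extend hi (by omega) hi hj (ih hi (by omega)) h (.inr (.inl ⟨rfl, rfl⟩))
  | both _ h ih =>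
    exact extend (by omega) (by omega) hi hj (ih (by omega) (by omega)) h (.inr (.inr ⟨rfl, rfl⟩))

theorem bddAbove_traversal (P Q : Curve d) (T : List (Fin P.complexity × Fin Q.complexity)) :
    BddAbove {r : ℝ | ∃ a ∈ T, r = dist (P.vertex a.1) (Q.vertex a.2)} := by
  have : {r : ℝ | ∃ a ∈ T, r = dist (P.vertex a.1) (Q.vertex a.2)} =
      (fun a : Fin P.complexity × Fin Q.complexity => dist (P.vertex a.1) (Q.vertex a.2)) ''
        {a | a ∈ T} := by
    ext r
    simp [eq_comm]
  rw [this]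
  exact (Set.toFinite _).bddAbove

/-- The discrete Fréchet distance is the value computed by dynamic programming. -/
theorem discreteFrechet_eq (P Q : Curve d) :
    discreteFrechet P Q = bottleneck (fun i j => dist (P.nth i) (Q.nth j))
      (P.complexity - 1) (Q.complexity - 1) := by
  have hp := P.complexity_pos
  have hq := Q.complexity_pos
  -- With the threshold equal to the bottleneck value itself, reachability of the last cell provides
  -- an optimal traversal.
  obtain ⟨T, hh, hl, hc, hw⟩ := exists_list_of_reach hp hq (bottleneck_le_iff.1 (le_refl
    (bottleneck (fun i j => dist (P.nth i) (Q.nth j)) (P.complexity - 1) (Q.complexity - 1))))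
    (by omega) (by omega)
  have hT : IsTraversal P Q T := ⟨hh, hl, hc⟩
  apply le_antisymm
  · have hle : discreteFrechet P Q ≤ traversalCost P Q T := by
      refine csInf_le ⟨0, ?_⟩ ⟨T, hT, rfl⟩
      rintro r ⟨T, -, rfl⟩
      refine Real.sSup_nonneg ?_
      rintro r ⟨a, -, rfl⟩
      exact dist_nonneg
    · refine hle.trans (csSup_le ?_ ?_)
      · cases T with
        | nil => simp at hh
        | cons x T => exact ⟨_, x, List.mem_cons_self, rfl⟩
      · rintro r ⟨a, ha, rfl⟩
        simpa only [Curve.nth_coe] using hw a ha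
  · refine le_csInf ⟨_, T, hT, rfl⟩ ?_
    rintro r ⟨T, hT, rfl⟩
    rw [bottleneck_le_iff]
    refine reach_of_isTraversal hT fun a ha => ?_
    simp only [Curve.nth_coe]
    exact le_csSup (bddAbove_traversal P Q T) ⟨a, ha, rfl⟩

theorem discreteFrechet_le_iff {P Q : Curve d} {δ : ℝ} :
    discreteFrechet P Q ≤ δ ↔ Reach (fun i j => dist (P.nth i) (Q.nth j) ≤ δ)
      (P.complexity - 1) (Q.complexity - 1) := by
  rw [discreteFrechet_eq, bottleneck_le_iff]

/-! ### Numbering the input vertices -/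

section Input

variable {d n : ℕ} (P : Fin n → Curve d)

/-- The complexities of the input curves. -/
def sizes : List ℕ := List.ofFn fun i => (P i).complexity

/-- All input vertices, curve after curve. -/
def points : List (EuclideanSpace ℝ (Fin d)) :=
  (List.ofFn P).flatMap fun Q => List.ofFn Q.vertex

/-- The input vertex with number `x`. -/
def pt (x : ℕ) : EuclideanSpace ℝ (Fin d) := (points P).getD x 0

/-- The complexity of the input curve with number `i`. -/
def size (i : ℕ) : ℕ := (sizes P).getD i 0

/-- The number of the first vertex of the input curve with number `i`. -/
def start (i : ℕ) : ℕ := ((sizes P).take i).sum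

/-- The number of input vertices. -/
def total : ℕ := start P n

/-- The address computation for data stored block after block. It is applied to the vertices grouped
by curve and to the coordinates grouped by vertex. -/
theorem getElem?_flatMap_sum {α β : Type*} (f : α → List β) (L : List α) :
    ∀ (i : ℕ) (hi : i < L.length) (j : ℕ), j < (f L[i]).length →
      (L.flatMap f)[((L.map fun a => (f a).length).take i).sum + j]? = (f L[i])[j]? := by
  induction L with
  | nil => intro i hi; simp at hi
  | cons a L ih =>
    intro i hi j hj
    cases i with
    | zero =>
      simp only [List.getElem_cons_zero] at hj
      simp [List.getElem?_append, hj]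
    | succ i =>
      simp only [List.getElem_cons_succ] at hj
      have := ih i (by simpa using hi) j hj
      simp only [List.flatMap_cons, List.map_cons, List.take_succ_cons, List.sum_cons,
        List.getElem_cons_succ]
      rw [List.getElem?_append_right (by omega), ← this]
      congr 1
      omega

theorem map_ofFn_complexity : (List.ofFn P).map Curve.complexity = sizes P := by
  simp [sizes, List.map_ofFn, Function.comp_def]

theorem length_sizes : (sizes P).length = n := by simp [sizes]

theorem size_coe (i : Fin n) : size P i = (P i).complexity := by
  simp [size, sizes, List.getD_eq_getElem?_getD]

theorem start_zero : start P 0 = 0 := by simp [start]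

theorem start_succ {i : ℕ} (hi : i < n) : start P (i + 1) = start P i + size P i := by
  have h : i < (sizes P).length := by rwa [length_sizes]
  rw [start, start, List.sum_take_succ _ _ h, size, List.getD_eq_getElem _ _ h]

theorem start_mono {i j : ℕ} (hij : i ≤ j) (hj : j ≤ n) : start P i ≤ start P j := by
  induction j, hij using Nat.le_induction with
  | base => exact le_rfl
  | succ j hij ih =>
    rw [start_succ P (by omega)]
    exact (ih (by omega)).trans (Nat.le_add_right _ _)

theorem start_add_lt {i j : ℕ} (hi : i < n) (hj : j < size P i) : start P i + j < total P := by
  have := start_mono P (show i + 1 ≤ n from hi) le_rfl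
  rw [start_succ P hi] at this
  unfold total
  omega

theorem pt_start_add (i : Fin n) {j : ℕ} (hj : j < (P i).complexity) :
    pt P (start P i + j) = (P i).nth j := by
  have := getElem?_flatMap_sum (fun Q : Curve d => List.ofFn Q.vertex) (List.ofFn P) i
    (by simp) j (by simpa using hj)
  simp only [List.length_ofFn] at this
  rw [show (fun a : Curve d => a.complexity) = Curve.complexity from rfl,
    map_ofFn_complexity] at this
  have e : (List.ofFn P)[(i : ℕ)]'(by simp) = P i := by simp
  rw [e] at this
  rw [pt, points, List.getD_eq_getElem?_getD, start, this]
  simp [Curve.nth, hj]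

theorem length_points : (points P).length = total P := by
  rw [points, List.length_flatMap, total, start, List.take_of_length_le (by rw [length_sizes]),
    ← map_ofFn_complexity]
  simp [Function.comp_def]

theorem exists_vertex_of_lt_total {x : ℕ} (hx : x < total P) :
    ∃ i k, pt P x = (P i).vertex k := by
  have hx' : x < (points P).length := by rwa [length_points]
  have hm : pt P x ∈ points P := by
    rw [pt, List.getD_eq_getElem _ _ hx']
    exact List.getElem_mem _
  rw [points, List.mem_flatMap] at hm
  obtain ⟨Q, hQ, hm⟩ := hm
  rw [List.mem_ofFn] at hQ hm
  obtain ⟨i, rfl⟩ := hQ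
  obtain ⟨k, hk⟩ := hm
  exact ⟨i, k, hk.symm⟩

theorem vertex_eq_pt (i : Fin n) (k : Fin (P i).complexity) :
    ∃ x < total P, (P i).vertex k = pt P x := by
  refine ⟨start P i + k, start_add_lt P i.2 (by rw [size_coe]; exact k.2), ?_⟩
  rw [pt_start_add P i k.2, Curve.nth_coe]

theorem getD_coords {x : ℕ} (hx : x < total P) (k : Fin d) :
    ((List.ofFn P).flatMap Curve.coords).getD (x * d + k) 0 = pt P x k := by
  have hx' : x < (points P).length := by rwa [length_points]
  have hc : (List.ofFn P).flatMap Curve.coords =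
      (points P).flatMap fun p => List.ofFn fun k => p k := by
    rw [points, List.flatMap_assoc]
    rfl
  have h1 := getElem?_flatMap_sum (fun p : EuclideanSpace ℝ (Fin d) => List.ofFn fun k => p k)
    (points P) x hx' k (by simp)
  simp only [List.length_ofFn, List.map_const', List.take_replicate, List.sum_replicate,
    smul_eq_mul, Nat.min_eq_left hx'.le] at h1
  rw [hc, List.getD_eq_getElem?_getD, h1, pt, List.getD_eq_getElem _ _ hx']
  simp

/-! ### Candidate curves given by vertex numbers -/

/-- The curve whose vertices have the numbers `c 0, …, c (a - 1)`. -/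
def indexedCurve (c : ℕ → ℕ) (a : ℕ) (ha : 0 < a) : Curve d := ⟨a, ha, fun j => pt P (c j)⟩

/-- The discrete Fréchet distance of a candidate to the input curve with number `i`. -/
def pairCost (c : ℕ → ℕ) (a i : ℕ) : ℝ :=
  bottleneck (fun u j => dist (pt P (c u)) (pt P (start P i + j))) (a - 1) (size P i - 1)

/-- The largest discrete Fréchet distance of a candidate to the first `i` input curves. -/
def costUpto (c : ℕ → ℕ) (a : ℕ) : ℕ → ℝ
  | 0 => 0
  | i + 1 => max (costUpto c a i) (pairCost P c a i)

/-- The largest discrete Fréchet distance of a candidate to an input curve. -/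
def cost (c : ℕ → ℕ) (a : ℕ) : ℝ := costUpto P c a n

/-- The running maximum starts at `0`, which is the origin of the condition `0 ≤ δ`. -/
theorem costUpto_le_iff {c : ℕ → ℕ} {a i : ℕ} {δ : ℝ} :
    costUpto P c a i ≤ δ ↔ 0 ≤ δ ∧ ∀ j < i, pairCost P c a j ≤ δ := by
  induction i with
  | zero => simp [costUpto]
  | succ i ih =>
    rw [costUpto, max_le_iff, ih]
    constructor
    · rintro ⟨⟨h0, h1⟩, h2⟩
      refine ⟨h0, fun j hj => ?_⟩
      rcases Nat.lt_succ_iff_lt_or_eq.1 hj with h | rfl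
      exacts [h1 j h, h2]
    · rintro ⟨h0, h1⟩
      exact ⟨⟨h0, fun j hj => h1 j (by omega)⟩, h1 i (by omega)⟩

theorem cost_nonneg (c : ℕ → ℕ) (a : ℕ) : 0 ≤ cost P c a :=
  ((costUpto_le_iff P).1 (le_refl (cost P c a))).1

theorem cost_le_iff {c : ℕ → ℕ} {a : ℕ} {δ : ℝ} :
    cost P c a ≤ δ ↔ 0 ≤ δ ∧ ∀ i : Fin n,
      Reach (fun u j => dist (pt P (c u)) ((P i).nth j) ≤ δ) (a - 1) ((P i).complexity - 1) := by
  rw [cost, costUpto_le_iff]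
  refine and_congr_right fun _ => ?_
  have key : ∀ i : Fin n, pairCost P c a i ≤ δ ↔
      Reach (fun u j => dist (pt P (c u)) ((P i).nth j) ≤ δ) (a - 1)
        ((P i).complexity - 1) := by
    intro i
    have := (P i).complexity_pos
    rw [pairCost, bottleneck_le_iff, size_coe]
    -- Beyond the last vertex of a curve, `pt` runs on into the next curve whereas `nth` is zero;
    -- the weights agree only inside the table, and `Reach.mono` asks for no more.
    refine ⟨fun h => h.mono fun u j _ hj h => ?_, fun h => h.mono fun u j _ hj h => ?_⟩
    · rwa [pt_start_add P i (by omega)] at h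
    · rwa [pt_start_add P i (by omega)]
  exact ⟨fun h i => (key i).1 (h i i.2), fun h i hi => (key ⟨i, hi⟩).2 (h ⟨i, hi⟩)⟩

theorem cost_congr {c c' : ℕ → ℕ} {a : ℕ} (ha : 0 < a) (h : ∀ u < a, c u = c' u) :
    cost P c a = cost P c' a := by
  have key : ∀ c c' : ℕ → ℕ, (∀ u < a, c u = c' u) → cost P c a ≤ cost P c' a := by
    intro c c' h
    rw [cost_le_iff]
    refine ⟨cost_nonneg P _ _, fun i => ?_⟩
    refine (((cost_le_iff P).1 (le_refl (cost P c' a))).2 i).mono fun u j hu _ hw => ?_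
    rwa [h u (by omega)]
  exact le_antisymm (key _ _ h) (key _ _ fun u hu => (h u hu).symm)

theorem discreteFrechet_indexedCurve_le_iff {c : ℕ → ℕ} {a : ℕ} (ha : 0 < a) {δ : ℝ} (i : Fin n) :
    discreteFrechet (indexedCurve P c a ha) (P i) ≤ δ ↔
      Reach (fun u j => dist (pt P (c u)) ((P i).nth j) ≤ δ) (a - 1)
        ((P i).complexity - 1) := by
  rw [discreteFrechet_le_iff]
  have key : ∀ u ≤ a - 1, (indexedCurve P c a ha).nth u = pt P (c u) := fun u hu => by
    rw [Curve.nth_of_lt _ (show u < a by omega)]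
    rfl
  refine ⟨fun h => h.mono fun u j hu _ h => ?_, fun h => h.mono fun u j hu _ h => ?_⟩
  · rwa [← key u hu]
  · rwa [key u hu]

/-- `δ` is attained by a middle curve of complexity at most `l`. -/
def Feasible (l : ℕ) (δ : ℝ) : Prop := ∃ M : Curve d, M.complexity ≤ l ∧ IsMiddleCurve P δ M

theorem isMiddleCurve_indexedCurve {c : ℕ → ℕ} {a : ℕ} (ha : 0 < a)
    (hc : ∀ u < a, c u < total P) {δ : ℝ} (h : cost P c a ≤ δ) :
    IsMiddleCurve P δ (indexedCurve P c a ha) :=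
  ⟨fun j => exists_vertex_of_lt_total P (hc j j.2), fun i =>
    (discreteFrechet_indexedCurve_le_iff P ha i).2 (((cost_le_iff P).1 h).2 i)⟩

theorem Feasible.nonneg {l : ℕ} {δ : ℝ} (hn : 0 < n) (h : Feasible P l δ) : 0 ≤ δ := by
  obtain ⟨M, -, -, h⟩ := h
  exact dist_nonneg.trans (discreteFrechet_le_iff.1 (h ⟨0, hn⟩)).holds

/-- The optimum is defined as an infimum. A bound against every feasible `δ` passes to it, so that
it need not be attained; the candidate itself shows that the set of feasible values is nonempty. -/
theorem isApproxMiddleCurve_indexedCurve {l : ℕ} {α : ℝ} (hn : 0 < n) {c : ℕ → ℕ} {a : ℕ}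
    (ha : 0 < a) (hal : a ≤ l) (hc : ∀ u < a, c u < total P) (hα : 2 ≤ α)
    (h : ∀ δ, Feasible P l δ → cost P c a ≤ 2 * δ) :
    IsApproxMiddleCurve α P l (indexedCurve P c a ha) := by
  refine ⟨hal, isMiddleCurve_indexedCurve P ha hc ?_⟩
  have hne : {δ : ℝ | Feasible P l δ}.Nonempty :=
    ⟨_, _, hal, isMiddleCurve_indexedCurve P ha hc le_rfl⟩
  have h0 : 0 ≤ optimalDistance P l := le_csInf hne fun δ hδ => Feasible.nonneg P hn hδ
  have h2 : cost P c a / 2 ≤ optimalDistance P l :=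
    le_csInf hne fun δ hδ => by linarith [h δ hδ]
  nlinarith

end Input

/-! ### Grouping a sequence into consecutive clusters -/

section Clusters

variable {X : Type*} [PseudoMetricSpace X]

/-- The first `j` terms of the sequence `p ∘ q` are grouped into `k` consecutive clusters. The
cluster with number `u` contains the term `S u`, and has radius at most `R` around it. -/
def Clusters (p : ℕ → X) (q : ℕ → ℕ) (j k : ℕ) (S : ℕ → ℕ) (R : ℝ) : Prop :=
  ∃ f h : ℕ → ℕ, (∀ a b, a ≤ b → b < j → f a ≤ f b) ∧
    (∀ u < k, h u < j ∧ S u = q (h u) ∧ f (h u) = u) ∧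
    ∀ i < j, f i < k ∧ dist (p (q i)) (p (S (f i))) ≤ R

/-- Consecutive terms of `p ∘ S` are more than `r` apart. -/
def Separated (p : ℕ → X) (S : ℕ → ℕ) (k : ℕ) (r : ℝ) : Prop :=
  ∀ u, u + 1 < k → r < dist (p (S u)) (p (S (u + 1)))

variable {p : ℕ → X} {q S : ℕ → ℕ} {j k : ℕ} {r R : ℝ}

theorem Clusters.single (h : S 0 = q 0) (hR : 0 ≤ R) : Clusters p q 1 1 S R := by
  refine ⟨fun _ => 0, fun _ => 0, fun _ _ _ _ => le_rfl, fun u hu => ?_, fun i hi => ?_⟩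
  · obtain rfl : u = 0 := by omega
    exact ⟨Nat.one_pos, h, rfl⟩
  · obtain rfl : i = 0 := by omega
    simpa [h] using hR

theorem Clusters.mono {R' : ℝ} (h : Clusters p q j k S R) (hR : R ≤ R') :
    Clusters p q j k S R' := by
  obtain ⟨f, g, h1, h2, h3⟩ := h
  exact ⟨f, g, h1, h2, fun i hi => ⟨(h3 i hi).1, (h3 i hi).2.trans hR⟩⟩

theorem Clusters.push (h : Clusters p q j k S R) (hR : 0 ≤ R) :
    Clusters p q (j + 1) (k + 1) (Function.update S k (q j)) R := by
  obtain ⟨f, g, h1, h2, h3⟩ := h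
  refine ⟨Function.update f j k, Function.update g k j, fun a b hab hb => ?_, fun u hu => ?_,
    fun i hi => ?_⟩
  · rcases eq_or_ne b j with rfl | hbj
    · rcases eq_or_ne a b with rfl | haj
      · exact le_rfl
      · rw [Function.update_self, Function.update_of_ne haj]
        exact (h3 a (by omega)).1.le
    · rw [Function.update_of_ne hbj, Function.update_of_ne (by omega)]
      exact h1 a b hab (by omega)
  · rcases eq_or_ne u k with rfl | huk
    · simp
    · have := h2 u (by omega)
      rw [Function.update_of_ne huk, Function.update_of_ne huk, Function.update_of_ne (by omega)]
      exact ⟨by omega, this.2.1, this.2.2⟩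
  · rcases eq_or_ne i j with rfl | hij
    · simpa using hR
    · have := h3 i (by omega)
      rw [Function.update_of_ne hij, Function.update_of_ne (by omega)]
      exact ⟨by omega, this.2⟩

theorem Clusters.join (h : Clusters p q j k S R) (hk : 0 < k)
    (hd : dist (p (S (k - 1))) (p (q j)) ≤ R) : Clusters p q (j + 1) k S R := by
  obtain ⟨f, g, h1, h2, h3⟩ := h
  refine ⟨Function.update f j (k - 1), g, fun a b hab hb => ?_, fun u hu => ?_, fun i hi => ?_⟩
  · rcases eq_or_ne b j with rfl | hbj
    · rcases eq_or_ne a b with rfl | haj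
      · exact le_rfl
      · rw [Function.update_self, Function.update_of_ne haj]
        have := (h3 a (by omega)).1
        omega
    · rw [Function.update_of_ne hbj, Function.update_of_ne (by omega)]
      exact h1 a b hab (by omega)
  · have := h2 u (by omega)
    rw [Function.update_of_ne (by omega)]
    exact ⟨by omega, this.2.1, this.2.2⟩
  · rcases eq_or_ne i j with rfl | hij
    · rw [Function.update_self, dist_comm]
      exact ⟨by omega, hd⟩
    · rw [Function.update_of_ne hij]
      exact h3 i (by omega)

/-- Clustering the representatives again clusters the original sequence: monotone assignments
compose, and the radii add by the triangle inequality. -/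
theorem Clusters.comp {K : ℕ} {S' : ℕ → ℕ} {R' : ℝ} (h : Clusters p q j K S R)
    (h' : Clusters p S K k S' R') : Clusters p q j k S' (R + R') := by
  obtain ⟨f, g, h1, h2, h3⟩ := h
  obtain ⟨f', g', h1', h2', h3'⟩ := h'
  refine ⟨fun i => f' (f i), fun u => g (g' u), fun a b hab hb => ?_, fun u hu => ?_,
    fun i hi => ?_⟩
  · exact h1' _ _ (h1 a b hab hb) (h3 b hb).1
  · have := h2' u hu
    have h4 := h2 _ this.1
    exact ⟨h4.1, by rw [this.2.1, h4.2.1], by simp only [h4.2.2, this.2.2]⟩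
  · have := h3 i hi
    have h4 := h3' _ this.1
    exact ⟨h4.1, (dist_triangle _ _ _).trans (add_le_add this.2 h4.2)⟩

theorem Clusters.pos (h : Clusters p q j k S R) (hj : 0 < j) : 0 < k := by
  obtain ⟨f, g, h1, h2, h3⟩ := h
  exact lt_of_le_of_lt (Nat.zero_le _) (h3 0 hj).1

theorem Clusters.strictMono (h : Clusters p id j k S R) {u v : ℕ} (huv : u < v) (hv : v < k) :
    S u < S v := by
  obtain ⟨f, g, h1, h2, h3⟩ := h
  have hu := h2 u (by omega)
  have hv := h2 v hv
  simp only [id] at hu hv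
  rw [hu.2.1, hv.2.1]
  by_contra hlt
  have := h1 _ _ (not_lt.1 hlt) hu.1
  omega

theorem Clusters.lt (h : Clusters p id j k S R) {u : ℕ} (hu : u < k) : S u < j := by
  obtain ⟨f, g, h1, h2, h3⟩ := h
  have := h2 u hu
  rw [this.2.1]
  exact this.1

theorem Separated.push (h : Separated p S k r) (x : ℕ)
    (hx : 0 < k → r < dist (p (S (k - 1))) (p x)) :
    Separated p (Function.update S k x) (k + 1) r := by
  intro u hu
  rw [Function.update_of_ne (by omega)]
  rcases eq_or_ne (u + 1) k with rfl | huk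
  · simpa using hx (by omega)
  · rw [Function.update_of_ne huk]
    exact h u (by omega)

/-- A sequence within `δ` of a sequence of at most `l` points has two consecutive terms at distance
at most `2 δ` among any `l + 1` terms. -/
theorem exists_consecutive_dist_le {m l : ℕ} {δ : ℝ} {v : ℕ → X} {f : ℕ → ℕ} (hf : Monotone f)
    (hl : ∀ i, f i < l) (hd : ∀ i < m, dist (v (f i)) (p i) ≤ δ)
    (h : Clusters p id j (l + 1) S R) (hj : j ≤ m) :
    ∃ u < l, dist (p (S u)) (p (S (u + 1))) ≤ 2 * δ := by
  by_contra! hcon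
  -- Two centres matched to the same point are within `2 * δ` of each other. If all gaps are larger,
  -- the match moves on strictly at each centre and leaves the range of `l` points.
  have key : ∀ u ≤ l, u ≤ f (S u) := by
    intro u
    induction u with
    | zero => simp
    | succ u ih =>
      intro hu
      have h1 : f (S u) ≤ f (S (u + 1)) :=
        hf (h.strictMono (Nat.lt_succ_self u) (by omega)).le
      have h2 : f (S u) ≠ f (S (u + 1)) := by
        intro he
        have h3 := hd (S u) ((h.lt (by omega)).trans_le hj)
        have h4 := hd (S (u + 1)) ((h.lt (by omega)).trans_le hj)
        rw [← he] at h4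
        have h5 := dist_triangle_left (p (S u)) (p (S (u + 1))) (v (f (S u)))
        linarith [hcon u (by omega)]
      have := ih (by omega)
      omega
  have := key l le_rfl
  have := hl (S l)
  omega

/-- Each cluster contains its own representative, so the monotone assignment starts at `0`, skips no
cluster and ends at `k - 1`. Its graph is therefore a traversal. -/
theorem Clusters.reach (h : Clusters p id j k S R) (hj : 0 < j) :
    Reach (fun u i => dist (p (S u)) (p i) ≤ R) (k - 1) (j - 1) := by
  have hk := h.pos hj
  obtain ⟨f, g, h1, h2, h3⟩ := h
  simp only [id] at h2 h3
  have h0 : f 0 = 0 := by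
    have h4 := h2 0 hk
    have := h1 0 (g 0) (Nat.zero_le _) h4.1
    omega
  have hstep : ∀ i, i + 1 < j → f (i + 1) ≤ f i + 1 := by
    intro i hi
    by_contra! hcon
    have h4 := h2 (f i + 1) (by have := (h3 (i + 1) hi).1; omega)
    rcases le_or_gt (g (f i + 1)) i with h5 | h5
    · have := h1 _ _ h5 (by omega)
      omega
    · have := h1 _ _ (show i + 1 ≤ g (f i + 1) from h5) h4.1
      omega
  have hlast : f (j - 1) = k - 1 := by
    have h4 := h2 (k - 1) (by omega)
    have := h1 (g (k - 1)) (j - 1) (by omega) (by omega)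
    have := (h3 (j - 1) (by omega)).1
    omega
  have key : ∀ i < j, Reach (fun u i => dist (p (S u)) (p i) ≤ R) (f i) i := by
    intro i
    induction i with
    | zero =>
      intro hi
      rw [h0]
      refine .base ?_
      have := (h3 0 hi).2
      rwa [h0, dist_comm] at this
    | succ i ih =>
      intro hi
      have h4 := (h3 (i + 1) hi).2
      rw [dist_comm] at h4
      have h5 := h1 i (i + 1) (by omega) hi
      have h6 := hstep i hi
      rcases (show f (i + 1) = f i ∨ f (i + 1) = f i + 1 by omega) with h7 | h7
      · rw [h7] at h4 ⊢
        exact .snd (ih (by omega)) h4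
      · rw [h7] at h4 ⊢
        exact .both (ih (by omega)) h4
  rw [← hlast]
  exact key _ (by omega)

end Clusters

/-! ### One-pass clustering of the first input curve -/

section Stream

/-- The positions of the representatives increase strictly, which forces `k ≤ j`; in case of
equality each position is its own index. So a thinning that removes nothing leaves the sequence
unchanged. -/
theorem Clusters.card_le {X : Type*} [PseudoMetricSpace X] {p : ℕ → X} {q S : ℕ → ℕ} {j k : ℕ}
    {R : ℝ} (h : Clusters p q j k S R) : k ≤ j ∧ (k = j → ∀ u < k, S u = q u) := by
  obtain ⟨f, g, h1, h2, h3⟩ := h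
  have hg : ∀ u v, u < v → v < k → g u < g v := by
    intro u v huv hv
    have h4 := h2 u (by omega)
    have h5 := h2 v hv
    by_contra hlt
    have := h1 _ _ (not_lt.1 hlt) h4.1
    omega
  have hle : ∀ u < k, u ≤ g u := by
    intro u
    induction u with
    | zero => simp
    | succ u ih =>
      intro hu
      have := hg u (u + 1) (by omega) hu
      have := ih (by omega)
      omega
  have hge : ∀ v, ∀ u, u + v + 1 = k → g u + v < j := by
    intro v
    induction v with
    | zero => exact fun u hu => (h2 u (by omega)).1
    | succ v ih =>
      intro u hu
      have := hg u (u + 1) (by omega) (by omega)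
      have := ih (u + 1) (by omega)
      omega
  refine ⟨?_, fun hkj u hu => ?_⟩
  · by_contra hcon
    have := hle (k - 1) (by omega)
    have := (h2 (k - 1) (by omega)).1
    omega
  · have h4 := hle u hu
    have h5 := hge (k - 1 - u) u (by omega)
    rw [(h2 u hu).2.1, show g u = u by omega]

variable {d n : ℕ} (P : Fin n → Curve d)

theorem pt_first (hn : 0 < n) {i : ℕ} (hi : i < size P 0) : pt P i = (P ⟨0, hn⟩).nth i := by
  have h := pt_start_add P ⟨0, hn⟩ (j := i) (by rwa [← size_coe])
  rwa [show start P ((⟨0, hn⟩ : Fin n) : ℕ) = 0 from start_zero P, zero_add] at h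

/-- Supplies the monotone matching required by the pigeonhole lemma `exists_consecutive_dist_le`. -/
theorem Feasible.exists_monotone {l : ℕ} {δ : ℝ} (hn : 0 < n) (h : Feasible P l δ) :
    ∃ (v : ℕ → EuclideanSpace ℝ (Fin d)) (f : ℕ → ℕ), Monotone f ∧ (∀ i, f i < l) ∧
      ∀ i < size P 0, dist (v (f i)) (pt P i) ≤ δ := by
  obtain ⟨M, hM, -, h⟩ := h
  obtain ⟨f, hf, hl, hd⟩ := (discreteFrechet_le_iff.1 (h ⟨0, hn⟩)).exists_monotone
  refine ⟨M.nth, f, hf, fun i => ?_, fun i hi => ?_⟩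
  · have := hl i
    have := M.complexity_pos
    omega
  · rw [pt_first P hn hi]
    rw [show (0 : ℕ) = ((⟨0, hn⟩ : Fin n) : ℕ) from rfl, size_coe] at hi
    exact hd i (by omega)

/-- The state of the one-pass clustering after `j` vertices: `k` representatives `S` and the
separation `r`. -/
structure StreamInv (l j k : ℕ) (S : ℕ → ℕ) (r : ℝ) : Prop where
  clusters : Clusters (pt P) id j k S (2 * r)
  separated : Separated (pt P) S k r
  nonneg : 0 ≤ r
  le_opt : ∀ δ, Feasible P l δ → r ≤ 4 * δ
  card_le : k ≤ l

variable {P} {l j k : ℕ} {S S' : ℕ → ℕ} {r t : ℝ}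

theorem streamInv_one (hn : 0 < n) (hl : 1 ≤ l) (hS : S 0 = 0) : StreamInv P l 1 1 S 0 where
  clusters := .single (by simpa using hS) (by simp)
  separated := fun u hu => by omega
  nonneg := le_rfl
  le_opt := fun δ hδ => by linarith [hδ.nonneg P hn]
  card_le := hl

theorem StreamInv.join (h : StreamInv P l j k S r) (hj : 0 < j)
    (hd : dist (pt P (S (k - 1))) (pt P j) ≤ r) : StreamInv P l (j + 1) k S r where
  clusters := h.clusters.join (h.clusters.pos hj) (by simp only [id]; linarith [h.nonneg])
  separated := h.separated
  nonneg := h.nonneg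
  le_opt := h.le_opt
  card_le := h.card_le

theorem StreamInv.push (h : StreamInv P l j k S r) (hk : k < l)
    (hd : r < dist (pt P (S (k - 1))) (pt P j)) :
    StreamInv P l (j + 1) (k + 1) (Function.update S k j) r where
  clusters := h.clusters.push (by linarith [h.nonneg])
  separated := h.separated.push _ fun _ => hd
  nonneg := h.nonneg
  le_opt := h.le_opt
  card_le := hk

/-- If there are too many representatives, the separation is doubled. -/
theorem StreamInv.overflow (hn : 0 < n) (hjm : j < size P 0) (h : StreamInv P l j l S r)
    (hd : r < dist (pt P (S (l - 1))) (pt P j))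
    (ht : ∀ u < l, t ≤ dist (pt P (Function.update S l j u)) (pt P (Function.update S l j (u + 1))))
    (ht' : ∃ u < l, t = dist (pt P (Function.update S l j u))
      (pt P (Function.update S l j (u + 1))))
    (hc : Clusters (pt P) (Function.update S l j) (l + 1) k S' (2 * t))
    (hs : Separated (pt P) S' k (2 * t)) : StreamInv P l (j + 1) k S' (2 * t) := by
  have hsep := h.separated.push j fun _ => hd
  have hcl : Clusters (pt P) id (j + 1) (l + 1) (Function.update S l j) (2 * r) :=
    h.clusters.push (by linarith [h.nonneg])
  obtain ⟨u, hu, htu⟩ := ht'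
  -- Every gap exceeds `r`, including the new last one. Strictness makes `t` positive, even when `r`
  -- is zero.
  have hrt : r < t := htu ▸ hsep u (by omega)
  have hr := h.nonneg
  -- The radii add up to `2 * r + 2 * t`, which is at most `4 * t`, twice the new separation.
  refine ⟨(hcl.comp hc).mono (by linarith), hs, by linarith, fun δ hδ => ?_, ?_⟩
  -- Some gap is at most `2 * δ`, hence so is the least gap `t`, and the new separation is at most
  -- `4 * δ`.
  · obtain ⟨v, f, hf, hl, hd⟩ := hδ.exists_monotone P hn
    obtain ⟨u, hu, hle⟩ := exists_consecutive_dist_le hf hl hd hcl hjm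
    linarith [ht u hu]
  · have h1 := hc.card_le
    by_contra hk
    -- If nothing had been removed, the least gap `t` would still be present, but all gaps now
    -- exceed `2 * t`.
    have hk' : k = l + 1 := by omega
    have h2 := hs u (by omega)
    rw [h1.2 hk' u (by omega), h1.2 hk' (u + 1) (by omega), ← htu] at h2
    linarith

/-- The representatives form a constant-factor approximation. -/
theorem StreamInv.cost_le (hn : 0 < n) (h : StreamInv P l (size P 0) k S r) {δ : ℝ}
    (hδ : Feasible P l δ) : cost P S k ≤ 10 * δ := by
  have h0 := hδ.nonneg P hn
  have hr := h.le_opt δ hδ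
  obtain ⟨M, hM, -, hd⟩ := hδ
  have hpos : 0 < size P 0 := by
    rw [show (0 : ℕ) = ((⟨0, hn⟩ : Fin n) : ℕ) from rfl, size_coe]
    exact (P ⟨0, hn⟩).complexity_pos
  rw [cost_le_iff]
  refine ⟨by linarith, fun i => ?_⟩
  have h1 : Reach (fun u j => dist (pt P (S u)) ((P ⟨0, hn⟩).nth j) ≤ 8 * δ) (k - 1)
      ((P ⟨0, hn⟩).complexity - 1) := by
    have h3 := h.clusters.reach hpos
    have hsz : size P 0 = (P ⟨0, hn⟩).complexity := size_coe P ⟨0, hn⟩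
    rw [← hsz]
    refine h3.mono fun a b _ hb hw => ?_
    rw [← pt_first P hn (by omega)]
    linarith
  have h2 := (discreteFrechet_le_iff.1 (hd ⟨0, hn⟩)).swap
  have h3 := discreteFrechet_le_iff.1 (hd i)
  -- From the representatives to the first curve `8 * δ`, from there to the middle curve `δ`, and
  -- from there to the given curve another `δ`.
  refine Reach.comp (w₁ := fun u j => dist (pt P (S u)) (M.nth j) ≤ 9 * δ) ?_
    (Reach.comp ?_ h1 h2) h3
  · intro a b c h4 h5
    linarith [dist_triangle (pt P (S a)) (M.nth b) ((P i).nth c)]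
  · intro a b c h4 h5
    rw [dist_comm] at h5
    linarith [dist_triangle (pt P (S a)) ((P ⟨0, hn⟩).nth b) (M.nth c)]

/-- If every input vertex near a representative is close to one of its net points, then some
sequence of net points, belonging to representatives in order, is a good middle curve. -/
theorem StreamInv.exists_net_sequence (hn : 0 < n) (h : StreamInv P l (size P 0) k S r) {δ : ℝ}
    (hδ : Feasible P l δ) {sz A : ℕ → ℕ} {N : ℕ} {ρ η : ℝ}
    (hnet : ∀ c < k, ∀ x < total P, dist (pt P (S c)) (pt P x) ≤ ρ →
      ∃ g < sz c, dist (pt P (A (c * N + g))) (pt P x) ≤ η) (hρ : 9 * δ ≤ ρ) (hη : η ≤ δ) :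
    ∃ (a : ℕ) (f g : ℕ → ℕ), 0 < a ∧ a ≤ l ∧ Monotone f ∧
      (∀ u < a, f u < k ∧ g u < sz (f u)) ∧
      ∀ c : ℕ → ℕ, (∀ u < a, c u = A (f u * N + g u)) → cost P c a ≤ 2 * δ := by
  have hr := h.le_opt δ hδ
  have h0 := hδ.nonneg P hn
  obtain ⟨M, hM, hv, hd⟩ := hδ
  have hMpos := M.complexity_pos
  have hsz : size P 0 = (P ⟨0, hn⟩).complexity := size_coe P ⟨0, hn⟩
  have hPpos := (P ⟨0, hn⟩).complexity_pos
  -- Vertex `u` of the optimal curve is matched to vertex `e u` of the first curve, hence to the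
  -- cluster `f (e u)`. Monotonicity of `e` and `f` puts these clusters in order.
  obtain ⟨e, he, hem, hed⟩ := (discreteFrechet_le_iff.1 (hd ⟨0, hn⟩)).swap.exists_monotone
  obtain ⟨f, _, hf, -, hfd⟩ := h.clusters
  have hx : ∀ u, ∃ x, u < M.complexity → x < total P ∧ M.nth u = pt P x := by
    intro u
    by_cases hu : u < M.complexity
    · obtain ⟨i, m, hm⟩ := hv ⟨u, hu⟩
      obtain ⟨x, hx, hx'⟩ := vertex_eq_pt P i m
      exact ⟨x, fun _ => ⟨hx, by rw [M.nth_of_lt hu, hm, hx']⟩⟩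
    · exact ⟨0, fun h => absurd h hu⟩
  choose x hx using hx
  have hlt : ∀ u, e u < size P 0 := fun u => by
    have := hem u
    omega
  have hg : ∀ u, ∃ g, u < M.complexity →
      g < sz (f (e u)) ∧ dist (pt P (A (f (e u) * N + g))) (pt P (x u)) ≤ η := by
    intro u
    by_cases hu : u < M.complexity
    · have h1 := hed u (by omega)
      rw [← pt_first P hn (hlt u), (hx u hu).2] at h1
      have h2 := hfd (e u) (hlt u)
      simp only [id] at h2
      -- The vertex is within `δ` of its match, which is within `2 * r ≤ 8 * δ` of the
      -- representative.
      obtain ⟨g, hg⟩ := hnet _ h2.1 (x u) (hx u hu).1 (by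
        rw [dist_comm] at h1
        linarith [dist_triangle_left (pt P (S (f (e u)))) (pt P (x u)) (pt P (e u)),
          dist_comm (pt P (e u)) (pt P (x u))])
      exact ⟨g, fun _ => hg⟩
    · exact ⟨0, fun h => absurd h hu⟩
  choose g hg using hg
  refine ⟨M.complexity, fun u => f (e u), g, hMpos, hM, fun a b hab => hf _ _ (he hab) (hlt b),
    fun u hu => ⟨(hfd _ (hlt u)).1, (hg u hu).1⟩, fun c hc => ?_⟩
  rw [cost_le_iff]
  -- The traversals of the optimal curve are kept. Moving each of its vertices by at most `η ≤ δ`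
  -- raises their costs to at most `2 * δ`.
  refine ⟨by linarith, fun i => (discreteFrechet_le_iff.1 (hd i)).mono fun u j hu _ hw => ?_⟩
  have hu' : u < M.complexity := by omega
  have h1 := (hg u hu').2
  rw [← (hx u hu').2, ← hc u hu'] at h1
  linarith [dist_triangle (pt P (c u)) (M.nth u) ((P i).nth j)]

end Stream

/-! ### Packing -/

/-- In `ℝ^d`, a ball of radius `90 r` contains boundedly many points at mutual distance more
than `r`. -/
theorem exists_packing_bound (d : ℕ) : ∃ γ : ℕ, ∀ (c : EuclideanSpace ℝ (Fin d)) (r : ℝ)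
    (x : ℕ → EuclideanSpace ℝ (Fin d)) (s : ℕ), 0 ≤ r → (∀ g < s, dist c (x g) ≤ 90 * r) →
    (∀ g < s, ∀ g' < g, r < dist (x g') (x g)) → s ≤ γ := by
  obtain ⟨t, -, ht, hcover⟩ :=
    (isCompact_closedBall (0 : EuclideanSpace ℝ (Fin d)) 90).finite_cover_balls (show (0 : ℝ) < 1 / 2 by norm_num)
  -- The summand `1` takes care of `r = 0`, where rescaling is impossible but all the points
  -- coincide with `c`.
  refine ⟨t.ncard + 1, fun c r x s hr hx hsep => ?_⟩
  rcases hr.eq_or_lt with rfl | hr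
  · by_contra hs
    have h1 := hsep 1 (by omega) 0 (by omega)
    have h2 := hx 0 (by omega)
    have h3 := hx 1 (by omega)
    linarith [dist_triangle_left (x 0) (x 1) c]
  · have hex : ∀ g, ∃ y, g < s → y ∈ t ∧ dist (r⁻¹ • (x g - c)) y < 1 / 2 := by
      intro g
      by_cases hg : g < s
      · have hmem : r⁻¹ • (x g - c) ∈ Metric.closedBall (0 : EuclideanSpace ℝ (Fin d)) 90 := by
          rw [mem_closedBall_zero_iff, norm_smul, ← dist_eq_norm, dist_comm, Real.norm_eq_abs,
            abs_of_pos (inv_pos.2 hr), inv_mul_le_iff₀ hr, mul_comm]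
          exact hx g hg
        obtain ⟨y, hy, hd⟩ := Set.mem_iUnion₂.1 (hcover hmem)
        exact ⟨y, fun _ => ⟨hy, hd⟩⟩
      · exact ⟨0, fun h => absurd h hg⟩
    choose y hy using hex
    -- After rescaling by `r⁻¹` the points are more than `1` apart, so no ball of radius `1 / 2`
    -- contains two of them.
    have hinj : ∀ g < s, ∀ g' < g, y g' ≠ y g := by
      intro g hg g' hg' he
      have h1 := (hy g hg).2
      have h2 := (hy g' (by omega)).2
      rw [he] at h2
      have h3 := dist_triangle_right (r⁻¹ • (x g' - c)) (r⁻¹ • (x g - c)) (y g)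
      have h4 : dist (r⁻¹ • (x g' - c)) (r⁻¹ • (x g - c)) = r⁻¹ * dist (x g') (x g) := by
        rw [dist_smul₀, dist_sub_right, Real.norm_eq_abs, abs_of_pos (inv_pos.2 hr)]
      rw [h4] at h3
      have h5 : 1 < r⁻¹ * dist (x g') (x g) := by
        rw [lt_inv_mul_iff₀ hr, mul_one]
        exact hsep g hg g' hg'
      linarith
    have hcard : (Finset.range s).card ≤ ht.toFinset.card := by
      refine Finset.card_le_card_of_injOn y (fun g hg => ?_) ?_
      · exact ht.mem_toFinset.2 (hy g (Finset.mem_range.1 hg)).1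
      · intro a ha b hb hab
        rw [Finset.mem_coe, Finset.mem_range] at ha hb
        rcases lt_trichotomy a b with h | h | h
        exacts [absurd hab (hinj b hb a h), h, absurd hab.symm (hinj a ha b h)]
    rw [Finset.card_range, ← Set.ncard_eq_toFinset_card t ht] at hcard
    omega

/-! ### Candidates encoded by words -/

section Decode

/-- The state of the decoder: the current representative, and the candidate decoded so far. -/
structure Decoder where
  cur : ℕ
  cnt : ℕ
  out : ℕ → ℕ

variable (sz A : ℕ → ℕ) (N l : ℕ)

/-- Reading a digit `g`: if the current representative has a net point with number `g`, this point
is appended to the candidate, otherwise the decoder moves on to the next representative. -/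
def Decoder.step (σ : Decoder) (g : ℕ) : Decoder :=
  if g < sz σ.cur then
    if σ.cnt < l then ⟨σ.cur, σ.cnt + 1, Function.update σ.out σ.cnt (A (σ.cur * N + g))⟩ else σ
  else ⟨σ.cur + 1, σ.cnt, σ.out⟩

/-- The decoder after reading the `t` lowest digits of `w` to the base `B`. -/
def Decoder.run (B w : ℕ) (o : ℕ → ℕ) : ℕ → Decoder
  | 0 => ⟨0, 0, o⟩
  | t + 1 => (Decoder.run B w o t).step sz A N l (w / B ^ t % B)

/-- The search runs through all words, so even those encoding nothing intended must decode to legal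
vertex numbers and to at most `l` of them. -/
theorem Decoder.run_valid {M : ℕ} (hA : ∀ c, ∀ g < sz c, A (c * N + g) < M) (B w : ℕ) (o : ℕ → ℕ)
    (t : ℕ) : (run sz A N l B w o t).cnt ≤ l ∧
      ∀ u < (run sz A N l B w o t).cnt, (run sz A N l B w o t).out u < M := by
  induction t with
  | zero => simp [run]
  | succ t ih =>
    rw [run, step]
    split_ifs with h1 h2
    · refine ⟨h2, fun u hu => ?_⟩
      rcases eq_or_ne u (run sz A N l B w o t).cnt with rfl | hne
      · simpa using hA _ _ h1
      · simp only at hu ⊢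
        rw [Function.update_of_ne hne]
        exact ih.2 u (by omega)
    · exact ih
    · exact ih

theorem exists_digits (B : ℕ) (D : ℕ → ℕ) (hD : ∀ t, D t < B) (T : ℕ) :
    ∃ w < B ^ T, ∀ t < T, w / B ^ t % B = D t := by
  induction T generalizing D with
  | zero => exact ⟨0, by simp, by simp⟩
  | succ T ih =>
    obtain ⟨w, hw, hd⟩ := ih (fun t => D (t + 1)) fun t => hD _
    have hB : 0 < B := (Nat.zero_le _).trans_lt (hD 0)
    refine ⟨D 0 + B * w, ?_, fun t ht => ?_⟩
    · have h1 : B * (w + 1) ≤ B * B ^ T := Nat.mul_le_mul_left B hw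
      rw [pow_succ, mul_comm _ B]
      have := hD 0
      nlinarith
    · cases t with
      | zero => simp [Nat.mod_eq_of_lt (hD 0)]
      | succ t =>
        rw [pow_succ, mul_comm _ B, ← Nat.div_div_eq_div_mul, Nat.add_mul_div_left _ _ hB,
          Nat.div_eq_of_lt (hD 0), zero_add]
        exact hd t (by omega)

/-- No net has more than `G` points, so the digit `G` always moves on. It serves both to get to the
desired representative and to pad words. -/
theorem foldl_replicate_step {G : ℕ} (hG : ∀ c, sz c ≤ G) (σ : Decoder) (m : ℕ) :
    (List.replicate m G).foldl (Decoder.step sz A N l) σ = ⟨σ.cur + m, σ.cnt, σ.out⟩ := by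
  induction m generalizing σ with
  | zero => rfl
  | succ m ih =>
    rw [List.replicate_succ, List.foldl_cons, ih, Decoder.step, if_neg (by simpa using hG _)]
    simp only [Decoder.mk.injEq, and_true]
    omega

/-- Every monotone sequence of net points is decoded from some word. -/
theorem exists_word {G k a : ℕ} (hG : ∀ c, sz c ≤ G) {f g : ℕ → ℕ} (ha : a ≤ l) (hk : k ≤ l)
    (hf : Monotone f) (hfg : ∀ u < a, f u < k ∧ g u < sz (f u)) (o : ℕ → ℕ) :
    ∃ w < (G + 1) ^ (2 * l), (Decoder.run sz A N l (G + 1) w o (2 * l)).cnt = a ∧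
      ∀ u < a, (Decoder.run sz A N l (G + 1) w o (2 * l)).out u = A (f u * N + g u) := by
  -- The word for the first `b` points has one digit for each point and one for each move, and there
  -- are at most `k ≤ l` moves. This is where the length `2 * l` comes from.
  have key : ∀ b ≤ a, ∃ (L : List ℕ) (τ : Decoder), (∀ D ∈ L, D < G + 1) ∧
      L.foldl (Decoder.step sz A N l) ⟨0, 0, o⟩ = τ ∧ L.length = τ.cur + b ∧
      τ.cur ≤ k ∧ (∀ u, b ≤ u → u < a → τ.cur ≤ f u) ∧ τ.cnt = b ∧
      ∀ u < b, τ.out u = A (f u * N + g u) := by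
    intro b
    induction b with
    | zero =>
      exact fun _ =>
        ⟨[], ⟨0, 0, o⟩, by simp, rfl, rfl, Nat.zero_le _, by simp, rfl, by simp⟩
    | succ b ih =>
      intro hb
      obtain ⟨L, τ, hL, hτ, hlen, hck, hcf, hcnt, hout⟩ := ih (by omega)
      have hcb := hcf b le_rfl hb
      have hfb := hfg b hb
      refine ⟨L ++ List.replicate (f b - τ.cur) G ++ [g b],
        ⟨f b, b + 1, Function.update τ.out b (A (f b * N + g b))⟩, ?_, ?_, ?_, ?_, ?_, rfl, ?_⟩
      · intro D hD
        simp only [List.mem_append, List.mem_replicate, List.mem_singleton] at hD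
        rcases hD with (hD | hD) | hD
        · exact hL D hD
        · omega
        · have := hG (f b)
          omega
      · rw [List.foldl_append, List.foldl_append, hτ, foldl_replicate_step sz A N l hG,
          show τ.cur + (f b - τ.cur) = f b by omega]
        simp [Decoder.step, hfb.2, hcnt, show b < l by omega]
      · simp only [List.length_append, hlen, List.length_replicate, List.length_singleton]
        omega
      · exact hfb.1.le
      · exact fun u hu _ => hf (by omega)
      · intro u hu
        rcases eq_or_ne u b with rfl | hub
        · simp
        · simp only
          rw [Function.update_of_ne hub]
          exact hout u (by omega)
  obtain ⟨L, τ, hL, hτ, hlen, hck, -, hcnt, hout⟩ := key a le_rfl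
  set L' := L ++ List.replicate (2 * l - L.length) G with hL'
  have hlen' : L'.length = 2 * l := by
    simp only [hL', List.length_append, List.length_replicate]
    omega
  have hmem : ∀ D ∈ L', D < G + 1 := by
    intro D hD
    rw [hL', List.mem_append, List.mem_replicate] at hD
    rcases hD with hD | hD
    · exact hL _ hD
    · omega
  have hfold : L'.foldl (Decoder.step sz A N l) ⟨0, 0, o⟩ =
      ⟨τ.cur + (2 * l - L.length), τ.cnt, τ.out⟩ := by
    rw [hL', List.foldl_append, hτ, foldl_replicate_step sz A N l hG]
  obtain ⟨w, hw, hd⟩ := exists_digits (G + 1) (fun t => L'.getD t G) (fun t => by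
    rcases lt_or_ge t L'.length with h | h
    · rw [List.getD_eq_getElem _ _ h]
      exact hmem _ (List.getElem_mem h)
    · rw [List.getD_eq_default _ _ h]
      omega) (2 * l)
  have hrun : ∀ t ≤ 2 * l, Decoder.run sz A N l (G + 1) w o t =
      (L'.take t).foldl (Decoder.step sz A N l) ⟨0, 0, o⟩ := by
    intro t
    induction t with
    | zero => intro _; simp [Decoder.run]
    | succ t ih =>
      intro ht
      have htl : t < L'.length := by omega
      rw [Decoder.run, ih (by omega), hd t (by omega), List.take_succ_eq_append_getElem htl,
        List.foldl_append, List.getD_eq_getElem _ _ htl]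
      rfl
  have hfin := hrun (2 * l) le_rfl
  rw [List.take_of_length_le hlen'.le, hfold] at hfin
  exact ⟨w, hw, by rw [hfin]; exact hcnt, by rw [hfin]; exact hout⟩

end Decode

/-! ### Reasoning about programs -/

section Framework

theorem Store.natVar_setNat (s : Store) (x v y : ℕ) :
    (s.setNat x v).natVar y = if y = x then v else s.natVar y := Function.update_apply ..

theorem Store.realVar_setNat (s : Store) (x v : ℕ) : (s.setNat x v).realVar = s.realVar := rfl

theorem Store.natArr_setNat (s : Store) (x v : ℕ) : (s.setNat x v).natArr = s.natArr := rfl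

theorem Store.realArr_setNat (s : Store) (x v : ℕ) : (s.setNat x v).realArr = s.realArr := rfl

theorem Store.natVar_setReal (s : Store) (x : ℕ) (v : ℝ) : (s.setReal x v).natVar = s.natVar := rfl

theorem Store.realVar_setReal (s : Store) (x : ℕ) (v : ℝ) (y : ℕ) :
    (s.setReal x v).realVar y = if y = x then v else s.realVar y := Function.update_apply ..

theorem Store.natArr_setReal (s : Store) (x : ℕ) (v : ℝ) : (s.setReal x v).natArr = s.natArr := rfl

theorem Store.realArr_setReal (s : Store) (x : ℕ) (v : ℝ) :
    (s.setReal x v).realArr = s.realArr := rfl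

theorem Store.natVar_setNatArr (s : Store) (a i v : ℕ) :
    (s.setNatArr a i v).natVar = s.natVar := rfl

theorem Store.realVar_setNatArr (s : Store) (a i v : ℕ) :
    (s.setNatArr a i v).realVar = s.realVar := rfl

theorem Store.natArr_setNatArr (s : Store) (a i v b : ℕ) :
    (s.setNatArr a i v).natArr b =
      if b = a then Function.update (s.natArr a) i v else s.natArr b := Function.update_apply ..

theorem Store.realArr_setNatArr (s : Store) (a i v : ℕ) :
    (s.setNatArr a i v).realArr = s.realArr := rfl

theorem Store.natVar_setRealArr (s : Store) (a i : ℕ) (v : ℝ) :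
    (s.setRealArr a i v).natVar = s.natVar := rfl

theorem Store.realVar_setRealArr (s : Store) (a i : ℕ) (v : ℝ) :
    (s.setRealArr a i v).realVar = s.realVar := rfl

theorem Store.natArr_setRealArr (s : Store) (a i : ℕ) (v : ℝ) :
    (s.setRealArr a i v).natArr = s.natArr := rfl

theorem Store.realArr_setRealArr (s : Store) (a i : ℕ) (v : ℝ) (b : ℕ) :
    (s.setRealArr a i v).realArr b =
      if b = a then Function.update (s.realArr a) i v else s.realArr b := Function.update_apply ..

attribute [simp] Store.natVar_setNat Store.realVar_setNat Store.natArr_setNat Store.realArr_setNat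
  Store.natVar_setReal Store.realVar_setReal Store.natArr_setReal Store.realArr_setReal
  Store.natVar_setNatArr Store.realVar_setNatArr Store.natArr_setNatArr Store.realArr_setNatArr
  Store.natVar_setRealArr Store.realVar_setRealArr Store.natArr_setRealArr
  Store.realArr_setRealArr Instr.apply

/-- Started in `s`, the program `p` halts after at most `T` steps in a store satisfying `Q`. -/
def Runs (p : Prog) (s : Store) (T : ℕ) (Q : Store → Prop) : Prop :=
  ∃ s' t, Exec p s s' t ∧ t ≤ T ∧ Q s'

/-- The natural-number variables written by an instruction. -/
def Instr.nw : Instr → List ℕ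
  | natConst x _ | natAdd x _ _ | natSub x _ _ | natMul x _ _ | natLoad x _ _ => [x]
  | _ => []

/-- The real variables written by an instruction. -/
def Instr.rw : Instr → List ℕ
  | realOfNat x _ | realAdd x _ _ | realSub x _ _ | realMul x _ _ | realDiv x _ _ | realSqrt x _
  | realLoad x _ _ => [x]
  | _ => []

/-- The natural-number arrays written by an instruction. -/
def Instr.naw : Instr → List ℕ
  | natStore a _ _ => [a]
  | _ => []

/-- The real arrays written by an instruction. -/
def Instr.raw : Instr → List ℕ
  | realStore a _ _ => [a]
  | _ => []

/-- Collecting data from the instructions of a program. -/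
def Prog.collect (f : Instr → List ℕ) : Prog → List ℕ
  | .skip => []
  | .instr i => f i
  | .seq p q => p.collect f ++ q.collect f
  | .cond _ p q => p.collect f ++ q.collect f
  | .loop _ p => p.collect f

/-- `s'` agrees with `s` outside the variables and arrays written by `p`. -/
structure Frame (p : Prog) (s s' : Store) : Prop where
  nv : ∀ x, x ∉ p.collect Instr.nw → s'.natVar x = s.natVar x
  rv : ∀ x, x ∉ p.collect Instr.rw → s'.realVar x = s.realVar x
  na : ∀ x, x ∉ p.collect Instr.naw → s'.natArr x = s.natArr x
  ra : ∀ x, x ∉ p.collect Instr.raw → s'.realArr x = s.realArr x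

theorem Frame.refl (p : Prog) (s : Store) : Frame p s s :=
  ⟨fun _ _ => rfl, fun _ _ => rfl, fun _ _ => rfl, fun _ _ => rfl⟩

theorem Frame.trans {p : Prog} {s₁ s₂ s₃ : Store} (h : Frame p s₁ s₂) (h' : Frame p s₂ s₃) :
    Frame p s₁ s₃ :=
  ⟨fun x hx => (h'.nv x hx).trans (h.nv x hx), fun x hx => (h'.rv x hx).trans (h.rv x hx),
    fun x hx => (h'.na x hx).trans (h.na x hx), fun x hx => (h'.ra x hx).trans (h.ra x hx)⟩

theorem Frame.of_subset {p q : Prog} {s s' : Store} (h : Frame p s s')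
    (hpq : ∀ f, p.collect f ⊆ q.collect f) : Frame q s s' :=
  ⟨fun x hx => h.nv x fun hm => hx (hpq _ hm), fun x hx => h.rv x fun hm => hx (hpq _ hm),
    fun x hx => h.na x fun hm => hx (hpq _ hm), fun x hx => h.ra x fun hm => hx (hpq _ hm)⟩

theorem Frame.instr (i : Instr) (s : Store) : Frame (.instr i) s (i.apply s) := by
  constructor <;> intro x hx <;>
    cases i <;> simp_all [Prog.collect, Instr.nw, Instr.rw, Instr.naw, Instr.raw]

/-- Preservation is read off the text of the program. For a concrete program, the question whether a
variable is untouched is thus settled by `decide`. -/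
theorem Exec.frame {p : Prog} {s s' : Store} {t : ℕ} (h : Exec p s s' t) : Frame p s s' := by
  induction h with
  | skip s => exact .refl _ _
  | instr i s => exact .instr i s
  | seq _ _ ih₁ ih₂ =>
    exact (ih₁.of_subset fun f => List.subset_append_left _ _).trans
      (ih₂.of_subset fun f => List.subset_append_right _ _)
  | condTrue _ _ ih => exact ih.of_subset fun f => List.subset_append_left _ _
  | condFalse _ _ ih => exact ih.of_subset fun f => List.subset_append_right _ _
  | loopTrue _ _ _ ih₁ ih₂ =>
    exact (ih₁.of_subset (q := .loop _ _) fun f => List.Subset.refl _).trans ih₂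
  | loopFalse _ => exact .refl _ _

variable {p q : Prog} {s : Store} {T T₁ T₂ : ℕ} {Q Q₁ : Store → Prop} {b : Test}

theorem Runs.weaken (h : Runs p s T₁ Q₁) (hT : T₁ ≤ T) (hQ : ∀ s', Q₁ s' → Frame p s s' → Q s') :
    Runs p s T Q := by
  obtain ⟨s', t, he, ht, hq⟩ := h
  exact ⟨s', t, he, ht.trans hT, hQ s' hq he.frame⟩

theorem Runs.of_le (h : Runs p s T₁ Q) (hT : T₁ ≤ T) : Runs p s T Q :=
  h.weaken hT fun _ h _ => h

theorem Runs.skip (h : Q s) : Runs .skip s 1 Q := ⟨s, 1, .skip s, le_rfl, h⟩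

theorem Runs.instr {i : Instr} (h : Q (i.apply s)) : Runs (.instr i) s 1 Q :=
  ⟨_, 1, .instr i s, le_rfl, h⟩

/-- The second part also receives the frame of the first, so intermediate conditions need mention
only what has changed. -/
theorem Runs.seq (h₁ : Runs p s T₁ Q₁) (h₂ : ∀ s', Q₁ s' → Frame p s s' → Runs q s' T₂ Q) :
    Runs (.seq p q) s (T₁ + T₂) Q := by
  obtain ⟨s', t, he, ht, hq⟩ := h₁
  obtain ⟨s'', t', he', ht', hq'⟩ := h₂ s' hq he.frame
  exact ⟨s'', t + t', .seq he he', by omega, hq'⟩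

theorem Runs.cond (h₁ : b.Holds s → Runs p s T₁ Q) (h₂ : ¬ b.Holds s → Runs q s T₂ Q) :
    Runs (.cond b p q) s (max T₁ T₂ + 1) Q := by
  by_cases hb : b.Holds s
  · obtain ⟨s', t, he, ht, hq⟩ := h₁ hb
    exact ⟨s', t + 1, .condTrue hb he, by omega, hq⟩
  · obtain ⟨s', t, he, ht, hq⟩ := h₂ hb
    exact ⟨s', t + 1, .condFalse hb he, by omega, hq⟩

/-- A sequence of instructions. -/
def block : List Instr → Prog
  | [] => .skip
  | i :: is => .seq (.instr i) (block is)

/-- The effect of a sequence of instructions. -/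
def applyAll : List Instr → Store → Store
  | [], s => s
  | i :: is, s => applyAll is (i.apply s)

theorem Runs.block {is : List Instr} (h : Q (applyAll is s)) :
    Runs (block is) s (is.length + 1) Q := by
  induction is generalizing s with
  | nil => exact .skip h
  | cons i is ih =>
    exact (Runs.seq (Runs.instr (Q := fun s' => s' = i.apply s) rfl) fun s' hs' _ =>
      ih (hs' ▸ h)).of_le (by simp only [List.length_cons]; omega)

/-- The loop `for x = k, …, b - 1 do p`, where the variable `4` has the value `1`. -/
def forLoop (k x b : ℕ) (p : Prog) : Prog :=
  .seq (.instr (.natConst x k)) (.loop (.natLt x b) (.seq p (.instr (.natAdd x x 4))))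

/-- The variables that the body of a loop must not write. -/
def LoopVars (x b : ℕ) (p : Prog) : Prop :=
  x ∉ p.collect Instr.nw ∧ b ∉ p.collect Instr.nw ∧ 4 ∉ p.collect Instr.nw ∧ b ≠ x ∧ 4 ≠ x

instance (x b : ℕ) (p : Prog) : Decidable (LoopVars x b p) := by
  unfold LoopVars
  infer_instance

/-- The invariant rule. An iteration costs `T` for the body, one step for the increment and one for
the test; the final `2` pays for the initialization and the failing test. Iterations are counted as
if the loop started at `0`. -/
theorem Runs.forLoop {k x b N : ℕ} (I : ℕ → Store → Prop) (hv : LoopVars x b p)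
    (h4 : s.natVar 4 = 1) (hb : s.natVar b = N) (hk : k ≤ N) (h0 : I k (s.setNat x k))
    (hstep : ∀ i s', k ≤ i → i < N → s'.natVar x = i → I i s' →
      Frame (forLoop k x b p) s s' → Runs p s' T fun s'' => I (i + 1) (s''.setNat x (i + 1))) :
    Runs (forLoop k x b p) s (N * (T + 2) + 2) fun s' => I N s' ∧ s'.natVar x = N := by
  obtain ⟨hx, hbp, h4p, hbx, h4x⟩ := hv
  set L : Prog := .loop (.natLt x b) (.seq p (.instr (.natAdd x x 4))) with hL
  have key : ∀ (m i : ℕ) (s' : Store), i + m = N → k ≤ i → s'.natVar x = i → I i s' →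
      Frame (MiddleCurve.forLoop k x b p) s s' →
      Runs L s' (m * (T + 2) + 1) fun s' => I N s' ∧ s'.natVar x = N := by
    intro m
    induction m with
    | zero =>
      intro i s' him _ hxi hI hf
      refine ⟨s', 1, .loopFalse ?_, by omega, ?_⟩
      · have : s'.natVar b = N := by
          rw [hf.nv b (by simp [MiddleCurve.forLoop, Prog.collect, Instr.nw, hbp, hbx]), hb]
        simp only [Test.Holds, hxi, this]
        omega
      · obtain rfl : i = N := by omega
        exact ⟨hI, hxi⟩
    | succ m ih =>
      intro i s' him hki hxi hI hf
      have hb' : s'.natVar b = N := by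
        rw [hf.nv b (by simp [MiddleCurve.forLoop, Prog.collect, Instr.nw, hbp, hbx]), hb]
      have h4' : s'.natVar 4 = 1 := by
        rw [hf.nv 4 (by simp [MiddleCurve.forLoop, Prog.collect, Instr.nw, h4p, h4x]), h4]
      obtain ⟨s₁, t₁, he₁, ht₁, hI₁⟩ := hstep i s' hki (by omega) hxi hI hf
      have hf₁ := he₁.frame
      have hs₂ : (Instr.natAdd x x 4).apply s₁ = s₁.setNat x (i + 1) := by
        simp only [Instr.apply, hf₁.nv x hx, hf₁.nv 4 h4p, hxi, h4']
      have he₂ : Exec (.instr (.natAdd x x 4)) s₁ (s₁.setNat x (i + 1)) 1 := by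
        rw [← hs₂]
        exact .instr _ _
      have hf₂ : Frame (MiddleCurve.forLoop k x b p) s (s₁.setNat x (i + 1)) :=
        hf.trans ((Exec.seq he₁ he₂).frame.of_subset fun f => by
          simp [MiddleCurve.forLoop, Prog.collect])
      obtain ⟨s₃, t₃, he₃, ht₃, hI₃⟩ := ih (i + 1) _ (by omega) (by omega) (by simp) hI₁ hf₂
      refine ⟨s₃, t₁ + 1 + t₃ + 1, .loopTrue ?_ (.seq he₁ he₂) he₃, ?_, hI₃⟩
      · simp only [Test.Holds, hxi, hb']
        omega
      · rw [Nat.succ_mul]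
        omega
  have hf : Frame (MiddleCurve.forLoop k x b p) s (s.setNat x k) :=
    (Frame.instr (.natConst x k) s).of_subset fun f => by simp [MiddleCurve.forLoop, Prog.collect]
  obtain ⟨s', t, he, ht, hI⟩ := key (N - k) k _ (by omega) le_rfl (by simp) h0 hf
  refine ⟨s', 1 + t, .seq (.instr _ _) he, ?_, hI⟩
  have := Nat.mul_le_mul_right (T + 2) (Nat.sub_le N k)
  omega

end Framework

/-! ### Distances and costs on the machine -/

section Eval

variable {d n : ℕ} (P : Fin n → Curve d) (l : ℕ)

/-- The variables `0, …, 5` hold `d`, `n`, `l`, `0`, `1` and the number of input vertices, the real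
variable `1` is zero, and the input arrays are intact. -/
structure Env (s : Store) : Prop where
  dim : s.natVar 0 = d
  num : s.natVar 1 = n
  len : s.natVar 2 = l
  zero : s.natVar 3 = 0
  one : s.natVar 4 = 1
  tot : s.natVar 5 = total P
  rzero : s.realVar 1 = 0
  size : s.natArr 0 = size P
  coord : ∀ x < total P, ∀ k : Fin d, s.realArr 0 (x * d + k) = pt P x k

/-- The program does not write what `Env` describes. -/
def KeepsEnv (p : Prog) : Prop :=
  (∀ x < 6, x ∉ p.collect Instr.nw) ∧ 1 ∉ p.collect Instr.rw ∧ 0 ∉ p.collect Instr.naw ∧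
    0 ∉ p.collect Instr.raw

instance (p : Prog) : Decidable (KeepsEnv p) := by
  unfold KeepsEnv
  infer_instance

variable {P l} {s s' : Store}

theorem Env.frame {p : Prog} (h : Env P l s) (hf : Frame p s s') (hp : KeepsEnv p) :
    Env P l s' := by
  obtain ⟨h1, h2, h3, h4⟩ := hp
  exact ⟨by rw [hf.nv 0 (h1 0 (by omega)), h.dim], by rw [hf.nv 1 (h1 1 (by omega)), h.num],
    by rw [hf.nv 2 (h1 2 (by omega)), h.len], by rw [hf.nv 3 (h1 3 (by omega)), h.zero],
    by rw [hf.nv 4 (h1 4 (by omega)), h.one], by rw [hf.nv 5 (h1 5 (by omega)), h.tot],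
    by rw [hf.rv 1 h2, h.rzero], by rw [hf.na 0 h3, h.size], by rw [hf.ra 0 h4]; exact h.coord⟩

/-- Computes in the real variable `2` the distance of the input vertices whose numbers are in the
variables `6` and `7`. -/
def distProg : Prog :=
  .seq (block [.natMul 9 6 0, .natMul 10 7 0, .realOfNat 2 3]) <|
  .seq (forLoop 0 8 0 (block [.natAdd 11 9 8, .realLoad 3 0 11, .natAdd 11 10 8, .realLoad 4 0 11,
    .realSub 3 3 4, .realMul 3 3 3, .realAdd 2 2 3])) <|
  block [.realSqrt 2 2]

theorem runs_distProg (hE : Env P l s) {x y : ℕ} (hx : s.natVar 6 = x) (hy : s.natVar 7 = y)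
    (hxN : x < total P) (hyN : y < total P) :
    Runs distProg s (10 * d + 8) fun s' => s'.realVar 2 = dist (pt P x) (pt P y) := by
  let g : ℕ → ℝ := fun k => if h : k < d then (pt P x ⟨k, h⟩ - pt P y ⟨k, h⟩) ^ 2 else 0
  refine ((Runs.block (Q := fun s' => s'.natVar 9 = x * d ∧ s'.natVar 10 = y * d ∧
    s'.realVar 2 = 0) ?_).seq (T₂ := 10 * d + 4) fun s₁ h₁ hf₁ => ?_).of_le
      (by simp only [List.length]; omega)
  · simp [applyAll, hx, hy, hE.dim, hE.zero]
  have hE₁ := hE.frame hf₁ (by decide)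
  refine ((Runs.forLoop (T := 8) (N := d) (fun i s' => s'.realVar 2 = ∑ k ∈ Finset.range i, g k)
    (by decide) hE₁.one hE₁.dim (Nat.zero_le _) (by simp [h₁]) ?_).seq (T₂ := 2)
      fun s₂ h₂ hf₂ => ?_).of_le (by omega)
  · intro i s' _ hi hxi hI hf
    have hE' := hE₁.frame hf (by decide)
    refine Runs.block ?_
    have h9 : s'.natVar 9 = x * d := by rw [hf.nv 9 (by decide), h₁.1]
    have h10 : s'.natVar 10 = y * d := by rw [hf.nv 10 (by decide), h₁.2.1]
    have hcx := hE'.coord x hxN ⟨i, hi⟩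
    have hcy := hE'.coord y hyN ⟨i, hi⟩
    simp only at hcx hcy
    rw [Finset.sum_range_succ, ← hI]
    simp [applyAll, h9, h10, hxi, hcx, hcy, g, hi, sq]
  · refine Runs.block ?_
    simp only [applyAll, Instr.apply, Store.realVar_setReal, if_true, h₂.1]
    rw [EuclideanSpace.dist_eq, Finset.sum_range]
    simp [g, Real.dist_eq, sq_abs]

/-- Enters the cell for the candidate vertex with number `u` (variable `17`) and the curve vertex
with number `j` (variable `16`) into the dynamic programming table (real array `2`, rows of length
`natVar 12`). Their distance is in the real variable `2`. -/
def cellProg : Prog :=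
  .seq (block [.natMul 18 16 12, .natAdd 18 18 17]) <|
  .seq (.cond (.natLt 3 17)
    (.cond (.natLt 3 16)
      (.seq (block [.natSub 19 18 4, .realLoad 6 2 19, .natSub 19 18 12, .realLoad 7 2 19]) <|
        .seq (.cond (.realLt 7 6) (block [.realAdd 6 7 1]) .skip) <|
        .seq (block [.natSub 19 19 4, .realLoad 7 2 19]) <|
        .cond (.realLt 7 6) (block [.realAdd 6 7 1]) .skip)
      (block [.natSub 19 18 4, .realLoad 6 2 19]))
    (.cond (.natLt 3 16) (block [.natSub 19 18 12, .realLoad 6 2 19])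
      (block [.realAdd 6 2 1]))) <|
  .seq (.cond (.realLt 6 2) (block [.realAdd 6 2 1]) .skip) <|
  block [.realStore 2 18 6]

theorem runs_min {x y z : ℕ} {p q : ℝ} (hp : s.realVar x = p) (hq : s.realVar y = q)
    (hz : s.realVar z = 0) :
    Runs (.cond (.realLt y x) (block [.realAdd x y z]) .skip) s 3
      fun s' => s'.realVar x = min p q := by
  refine (Runs.cond (fun hb => Runs.block ?_) fun hb => Runs.skip ?_).of_le (by simp)
  · simp only [Test.Holds, hp, hq] at hb
    simp [applyAll, hz, hq, hb.le]
  · simp only [Test.Holds, hp, hq, not_lt] at hb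
    simp [hp, hb]

theorem runs_max {x y z : ℕ} {p q : ℝ} (hp : s.realVar x = p) (hq : s.realVar y = q)
    (hz : s.realVar z = 0) :
    Runs (.cond (.realLt x y) (block [.realAdd x y z]) .skip) s 3
      fun s' => s'.realVar x = max p q := by
  refine (Runs.cond (fun hb => Runs.block ?_) fun hb => Runs.skip ?_).of_le (by simp)
  · simp only [Test.Holds, hp, hq] at hb
    simp [applyAll, hz, hq, hb.le]
  · simp only [Test.Holds, hp, hq, not_lt] at hb
    simp [hp, hb]

/-- Cell `(u, j)` has address `j * a + u`, so its three predecessors lie `1`, `a` and `a + 1` places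
earlier. All of them are among the entries already filled; the border cells are treated apart. -/
theorem runs_cellProg (hE : Env P l s) {a u j : ℕ} {w : ℕ → ℕ → ℝ} (ha : s.natVar 12 = a)
    (hu : s.natVar 17 = u) (hj : s.natVar 16 = j) (hua : u < a) (hw : s.realVar 2 = w u j)
    (hT : ∀ e < j * a + u, s.realArr 2 e = bottleneck w (e % a) (e / a)) :
    Runs cellProg s 28 fun s' => ∀ e < j * a + (u + 1),
      s'.realArr 2 e = bottleneck w (e % a) (e / a) := by
  have hcell : ∀ u' j', u' < a → (j' * a + u') % a = u' ∧ (j' * a + u') / a = j' := by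
    intro u' j' hu'
    rw [mul_comm, Nat.mul_add_mod, Nat.mod_eq_of_lt hu', Nat.mul_add_div (by omega),
      Nat.div_eq_of_lt hu']
    simp
  have hread : ∀ u' j', u' < a → j' * a + u' < j * a + u →
      s.realArr 2 (j' * a + u') = bottleneck w u' j' := by
    intro u' j' hu' hlt
    rw [hT _ hlt, (hcell u' j' hu').1, (hcell u' j' hu').2]
  refine ((Runs.block (Q := fun s' => s'.natVar 18 = j * a + u) ?_).seq (T₂ := 25)
    fun s₁ h₁ hf₁ => ?_).of_le (by simp)
  · simp [applyAll, hu, hj, ha]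
  have hE₁ := hE.frame hf₁ (by decide)
  have hu₁ : s₁.natVar 17 = u := by rw [hf₁.nv 17 (by decide), hu]
  have hj₁ : s₁.natVar 16 = j := by rw [hf₁.nv 16 (by decide), hj]
  have ha₁ : s₁.natVar 12 = a := by rw [hf₁.nv 12 (by decide), ha]
  have hw₁ : s₁.realVar 2 = w u j := by rw [hf₁.rv 2 (by decide), hw]
  have hT₁ : s₁.realArr 2 = s.realArr 2 := hf₁.ra 2 (by decide)
  refine (Runs.seq (T₁ := 20) (T₂ := 5)
    (Q₁ := fun s' => max (s'.realVar 6) (w u j) = bottleneck w u j) ?_ fun s₂ h₂ hf₂ => ?_).of_le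
    (by omega)
  · refine (Runs.cond (T₁ := 18) (T₂ := 4) (fun hb => ?_) fun hb => ?_).of_le (by omega)
    · simp only [Test.Holds, hu₁, hE₁.zero] at hb
      obtain ⟨u, rfl⟩ : ∃ v, u = v + 1 := ⟨u - 1, by omega⟩
      refine (Runs.cond (T₁ := 17) (T₂ := 4) (fun hb' => ?_) fun hb' => ?_).of_le (by omega)
      · simp only [Test.Holds, hj₁, hE₁.zero] at hb'
        obtain ⟨j, rfl⟩ : ∃ v, j = v + 1 := ⟨j - 1, by omega⟩
        have e1 : (j + 1) * a + (u + 1) - 1 = (j + 1) * a + u := by omega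
        have e2 : (j + 1) * a + (u + 1) - a = j * a + (u + 1) := by
          rw [Nat.succ_mul]
          omega
        have e3 : j * a + (u + 1) - 1 = j * a + u := by omega
        have r1 := hread u (j + 1) (by omega) (by omega)
        have r2 := hread (u + 1) j hua (by rw [Nat.succ_mul]; omega)
        have r3 := hread u j (by omega) (by rw [Nat.succ_mul]; omega)
        refine ((Runs.block (Q := fun s' => s'.realVar 6 = bottleneck w u (j + 1) ∧
          s'.realVar 7 = bottleneck w (u + 1) j ∧ s'.natVar 19 = j * a + (u + 1)) ?_).seq
          (T₂ := 9) fun s₂ h₂ hf₂ => ?_).of_le (by simp)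
        · simp [applyAll, h₁, hE₁.one, ha₁, e1, e2, hT₁, r1, r2]
        have hE₂ := hE₁.frame hf₂ (by decide)
        refine ((runs_min h₂.1 h₂.2.1 hE₂.rzero).seq (T₂ := 6)
          fun s₃ h₃ hf₃ => ?_).of_le (by omega)
        have hE₃ := hE₂.frame hf₃ (by decide)
        refine ((Runs.block (Q := fun s' => s'.realVar 7 = bottleneck w u j) ?_).seq
          (T₂ := 3) fun s₄ h₄ hf₄ => ?_).of_le (by simp)
        · simp [applyAll, hf₃.nv 19 (by decide), h₂.2.2, hE₃.one, e3, hf₃.ra 2 (by decide),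
            hf₂.ra 2 (by decide), hT₁, r3]
        have hE₄ := hE₃.frame hf₄ (by decide)
        refine (runs_min (by rw [hf₄.rv 6 (by decide), h₃]) h₄ hE₄.rzero).weaken
          le_rfl fun s₅ h₅ _ => ?_
        rw [h₅, bottleneck]
      · simp only [Test.Holds, hj₁, hE₁.zero] at hb'
        obtain rfl : j = 0 := by omega
        have r1 := hread u 0 (by omega) (by omega)
        rw [zero_mul, zero_add] at h₁ r1
        refine (Runs.block ?_).of_le (by simp)
        simp [applyAll, h₁, hE₁.one, hT₁, r1, bottleneck]
    · simp only [Test.Holds, hu₁, hE₁.zero] at hb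
      obtain rfl : u = 0 := by omega
      refine (Runs.cond (T₁ := 3) (T₂ := 2) (fun hb' => ?_) fun hb' => ?_).of_le (by omega)
      · simp only [Test.Holds, hj₁, hE₁.zero] at hb'
        obtain ⟨j, rfl⟩ : ∃ v, j = v + 1 := ⟨j - 1, by omega⟩
        have e2 : (j + 1) * a + 0 - a = j * a + 0 := by
          rw [Nat.succ_mul]
          omega
        have r2 := hread 0 j hua (by rw [Nat.succ_mul]; omega)
        refine (Runs.block ?_).of_le (by simp)
        simp only [applyAll, Instr.apply, Store.natVar_setNat, Store.realVar_setReal, if_true,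
          Store.realArr_setNat, h₁, ha₁, e2, hT₁, r2]
        rw [bottleneck]
      · simp only [Test.Holds, hj₁, hE₁.zero] at hb'
        obtain rfl : j = 0 := by omega
        refine (Runs.block ?_).of_le (by simp)
        simp [applyAll, hw₁, hE₁.rzero, bottleneck]
  have hE₂ := hE₁.frame hf₂ (by decide)
  refine ((runs_max rfl (by rw [hf₂.rv 2 (by decide), hw₁]) hE₂.rzero).seq (T₂ := 2)
    fun s₃ h₃ hf₃ => ?_).of_le (by omega)
  refine Runs.block ?_
  have h18 : s₃.natVar 18 = j * a + u := by
    rw [hf₃.nv 18 (by decide), hf₂.nv 18 (by decide), h₁]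
  have hT₃ : s₃.realArr 2 = s.realArr 2 := by
    rw [hf₃.ra 2 (by decide), hf₂.ra 2 (by decide), hT₁]
  intro e he
  simp only [applyAll, Instr.apply, Store.realArr_setRealArr, if_true, h18, h₃, hT₃, h₂]
  rcases eq_or_ne e (j * a + u) with rfl | hne
  · rw [Function.update_self, (hcell u j hua).1, (hcell u j hua).2]
  · rw [Function.update_of_ne hne]
    exact hT e (by omega)

/-- Computes in the real variable `5` the cost of the candidate in array `2`, whose complexity is in
the variable `12`. -/
def costProg : Prog :=
  .seq (block [.realOfNat 5 3, .natAdd 13 3 3]) <|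
  forLoop 0 14 1 <|
    .seq (block [.natLoad 15 0 14]) <|
    .seq (forLoop 0 16 15 <| forLoop 0 17 12 <|
      .seq (block [.natLoad 6 2 17, .natAdd 7 13 16]) <|
      .seq distProg cellProg) <|
    .seq (block [.natMul 18 15 12, .natSub 18 18 4, .realLoad 7 2 18]) <|
    .seq (.cond (.realLt 5 7) (block [.realAdd 5 7 1]) .skip) <|
    block [.natAdd 13 13 15]

/-- A bound for the running time of `costProg`. -/
def costTime (d n m l : ℕ) : ℕ := n * (m * (l * (10 * d + 41) + 4) + 15) + 5

/-- One dynamic programming table per input curve, reusing the same array. The variable `13` carries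
the number of the first vertex of the current curve, and the last entry of the table is its distance
to the candidate. -/
theorem runs_costProg (hE : Env P l s) {m a : ℕ} {c : ℕ → ℕ} (hm : ∀ i < n, size P i ≤ m)
    (hpos : ∀ i < n, 0 < size P i) (ha : s.natVar 12 = a) (ha0 : 0 < a) (hal : a ≤ l)
    (hc : s.natArr 2 = c) (hcN : ∀ u < a, c u < total P) :
    Runs costProg s (costTime d n m l) fun s' => s'.realVar 5 = cost P c a := by
  refine ((Runs.block (Q := fun s' => s'.realVar 5 = 0 ∧ s'.natVar 13 = 0) ?_).seq
    (T₂ := n * (m * (l * (10 * d + 41) + 4) + 15) + 2) fun s₁ h₁ hf₁ => ?_).of_le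
      (by simp only [List.length, costTime]; omega)
  · simp [applyAll, hE.zero]
  have hE₁ := hE.frame hf₁ (by decide)
  have ha₁ : s₁.natVar 12 = a := by rw [hf₁.nv 12 (by decide), ha]
  have hc₁ : s₁.natArr 2 = c := by rw [hf₁.na 2 (by decide), hc]
  refine (Runs.forLoop (N := n) (T := m * (l * (10 * d + 41) + 4) + 13)
    (fun i s' => s'.natVar 13 = start P i ∧ s'.realVar 5 = costUpto P c a i) (by decide)
    hE₁.one hE₁.num (Nat.zero_le _) (by simp [h₁, start_zero, costUpto]) ?_).weaken le_rfl
    fun s' h' _ => h'.1.2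
  rintro i s₂ - hi h14 ⟨h13, h5⟩ hf₂
  have hE₂ := hE₁.frame hf₂ (by decide)
  have ha₂ : s₂.natVar 12 = a := by rw [hf₂.nv 12 (by decide), ha₁]
  have hc₂ : s₂.natArr 2 = c := by rw [hf₂.na 2 (by decide), hc₁]
  set w : ℕ → ℕ → ℝ := fun u j => dist (pt P (c u)) (pt P (start P i + j)) with hw
  have hmi := hm i hi
  have hposi := hpos i hi
  refine ((Runs.block (Q := fun s' => s'.natVar 15 = size P i) ?_).seq
    (T₂ := m * (l * (10 * d + 41) + 4) + 11) fun s₃ h₃ hf₃ => ?_).of_le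
      (by simp only [List.length]; omega)
  · simp [applyAll, h14, hE₂.size]
  have hE₃ := hE₂.frame hf₃ (by decide)
  have ha₃ : s₃.natVar 12 = a := by rw [hf₃.nv 12 (by decide), ha₂]
  have hc₃ : s₃.natArr 2 = c := by rw [hf₃.na 2 (by decide), hc₂]
  have h13₃ : s₃.natVar 13 = start P i := by rw [hf₃.nv 13 (by decide), h13]
  refine (Runs.seq (T₁ := m * (l * (10 * d + 41) + 4) + 2) (T₂ := 9)
    (Q₁ := fun s' => ∀ e < size P i * a, s'.realArr 2 e = bottleneck w (e % a) (e / a)) ?_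
    fun s₄ h₄ hf₄ => ?_).of_le (by omega)
  · refine (Runs.forLoop (N := size P i) (T := l * (10 * d + 41) + 2)
      (fun j s' => ∀ e < j * a, s'.realArr 2 e = bottleneck w (e % a) (e / a)) (by decide)
      hE₃.one h₃ (Nat.zero_le _) (by simp) ?_).weaken ?_ fun s' h' _ => h'.1
    · intro j s₄ _ hj h16 hI hf₄
      have hE₄ := hE₃.frame hf₄ (by decide)
      have ha₄ : s₄.natVar 12 = a := by rw [hf₄.nv 12 (by decide), ha₃]
      have hc₄ : s₄.natArr 2 = c := by rw [hf₄.na 2 (by decide), hc₃]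
      have h13₄ : s₄.natVar 13 = start P i := by rw [hf₄.nv 13 (by decide), h13₃]
      refine (Runs.forLoop (N := a) (T := 10 * d + 39)
        (fun u s' => ∀ e < j * a + u, s'.realArr 2 e = bottleneck w (e % a) (e / a)) (by decide)
        hE₄.one ha₄ (Nat.zero_le _) (by simpa using hI) ?_).weaken ?_ fun s' h' _ => ?_
      · intro u s₅ _ hu h17 hI' hf₅
        have hE₅ := hE₄.frame hf₅ (by decide)
        refine ((Runs.block (Q := fun s' => s'.natVar 6 = c u ∧ s'.natVar 7 = start P i + j)
          ?_).seq (T₂ := 10 * d + 36) fun s₆ h₆ hf₆ => ?_).of_le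
            (by simp only [List.length]; omega)
        · simp [applyAll, h17, hf₅.na 2 (by decide), hc₄, hf₅.nv 13 (by decide), h13₄,
            hf₅.nv 16 (by decide), h16]
        have hE₆ := hE₅.frame hf₆ (by decide)
        refine ((runs_distProg hE₆ h₆.1 h₆.2 (hcN u hu) (start_add_lt P hi hj)).seq (T₂ := 28)
          fun s₇ h₇ hf₇ => ?_).of_le (by omega)
        have hE₇ := hE₆.frame hf₇ (by decide)
        refine (runs_cellProg hE₇ (w := w) (a := a) (u := u) (j := j) ?_ ?_ ?_ hu h₇ ?_).weaken
          le_rfl fun s₈ h₈ _ => ?_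
        · rw [hf₇.nv 12 (by decide), hf₆.nv 12 (by decide), hf₅.nv 12 (by decide), ha₄]
        · rw [hf₇.nv 17 (by decide), hf₆.nv 17 (by decide), h17]
        · rw [hf₇.nv 16 (by decide), hf₆.nv 16 (by decide), hf₅.nv 16 (by decide), h16]
        · rw [hf₇.ra 2 (by decide), hf₆.ra 2 (by decide)]
          exact hI'
        · simpa using h₈
      · exact Nat.add_le_add_right (Nat.mul_le_mul_right _ hal) _
      · rw [Nat.succ_mul]
        simpa using h'.1
    · exact Nat.add_le_add_right (Nat.mul_le_mul_right _ hmi) _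
  · have hE₄ := hE₃.frame hf₄ (by decide)
    have h15 : s₄.natVar 15 = size P i := by rw [hf₄.nv 15 (by decide), h₃]
    have hlast : size P i * a - 1 = (size P i - 1) * a + (a - 1) := by
      obtain ⟨k, hk⟩ : ∃ k, size P i = k + 1 := ⟨size P i - 1, by omega⟩
      rw [hk, Nat.succ_mul]
      simp only [Nat.succ_sub_one]
      omega
    have hlt : size P i * a - 1 < size P i * a := Nat.sub_lt (Nat.mul_pos hposi ha0) Nat.one_pos
    have hval : s₄.realArr 2 (size P i * a - 1) = pairCost P c a i := by
      rw [h₄ _ hlt, hlast, mul_comm, Nat.mul_add_mod, Nat.mod_eq_of_lt (by omega),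
        Nat.mul_add_div ha0, Nat.div_eq_of_lt (by omega), add_zero]
      rfl
    refine ((Runs.block (Q := fun s' => s'.realVar 7 = pairCost P c a i) ?_).seq (T₂ := 5)
      fun s₅ h₅ hf₅ => ?_).of_le (by simp)
    · simp [applyAll, h15, hf₄.nv 12 (by decide), ha₃, hE₄.one, hval]
    have hE₅ := hE₄.frame hf₅ (by decide)
    refine ((runs_max (p := costUpto P c a i) ?_ h₅ hE₅.rzero).seq (T₂ := 2)
      fun s₆ h₆ hf₆ => ?_).of_le (by omega)
    · rw [hf₅.rv 5 (by decide), hf₄.rv 5 (by decide), hf₃.rv 5 (by decide), h5]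
    refine Runs.block ?_
    have e13 : s₆.natVar 13 = start P i := by
      rw [hf₆.nv 13 (by decide), hf₅.nv 13 (by decide), hf₄.nv 13 (by decide), h13₃]
    have e15 : s₆.natVar 15 = size P i := by
      rw [hf₆.nv 15 (by decide), hf₅.nv 15 (by decide), h15]
    simp [applyAll, e13, e15, start_succ P hi, h₆, costUpto]

end Eval

/-! ### Initialization and clustering on the machine -/

section StreamProg

variable {d n : ℕ} {P : Fin n → Curve d} {l : ℕ} {s s' : Store}

/-- Sets up the constant one and counts the input vertices. -/
def initProg : Prog :=
  .seq (block [.natConst 4 1]) <| forLoop 0 14 1 <| block [.natLoad 15 0 14, .natAdd 5 5 15]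

theorem runs_initProg (P : Fin n → Curve d) (l : ℕ) (ε : ℝ) :
    Runs initProg (initialStore P l ε) (n * 5 + 4) (Env P l) := by
  have hdim : (initialStore P l ε).natVar 0 = d := rfl
  have hnum : (initialStore P l ε).natVar 1 = n := rfl
  have hlen : (initialStore P l ε).natVar 2 = l := rfl
  have hzero : (initialStore P l ε).natVar 3 = 0 := rfl
  have htot : (initialStore P l ε).natVar 5 = 0 := rfl
  have hrz : (initialStore P l ε).realVar 1 = 0 := rfl
  have hsize : (initialStore P l ε).natArr 0 = size P := rfl
  have hcoord : ∀ x < total P, ∀ k : Fin d,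
      (initialStore P l ε).realArr 0 (x * d + k) = pt P x k := fun x hx k => getD_coords P hx k
  generalize initialStore P l ε = s at *
  refine ((Runs.block (Q := fun s' => s'.natVar 4 = 1) ?_).seq (T₂ := n * 5 + 2)
    fun s₁ h₁ hf₁ => ?_).of_le (by simp only [List.length]; omega)
  · simp [applyAll]
  have hnum₁ : s₁.natVar 1 = n := by rw [hf₁.nv 1 (by decide), hnum]
  refine (Runs.forLoop (N := n) (T := 3) (fun i s' => s'.natVar 5 = start P i) (by decide)
    h₁ hnum₁ (Nat.zero_le _) ?_ ?_).weaken le_rfl fun s' h' hf' => ?_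
  · simp [hf₁.nv 5 (by decide), htot, start_zero]
  · rintro i s₂ - hi h14 h5 hf₂
    refine Runs.block ?_
    simp [applyAll, h5, h14, start_succ P hi, hf₂.na 0 (by decide), hf₁.na 0 (by decide), hsize]
  · exact ⟨by rw [hf'.nv 0 (by decide), hf₁.nv 0 (by decide), hdim],
      by rw [hf'.nv 1 (by decide), hnum₁],
      by rw [hf'.nv 2 (by decide), hf₁.nv 2 (by decide), hlen],
      by rw [hf'.nv 3 (by decide), hf₁.nv 3 (by decide), hzero],
      by rw [hf'.nv 4 (by decide), h₁], h'.1,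
      by rw [hf'.rv 1 (by decide), hf₁.rv 1 (by decide), hrz],
      by rw [hf'.na 0 (by decide), hf₁.na 0 (by decide), hsize],
      by rw [hf'.ra 0 (by decide), hf₁.ra 0 (by decide)]; exact hcoord⟩

/-- Appends the vertex in variable `7` to the representatives in array `2` if its distance to the
last one exceeds the real variable `9`. -/
def pushProg : Prog :=
  .seq (block [.natSub 27 12 4, .natLoad 6 2 27]) <|
  .seq distProg <|
  .cond (.realLt 9 2) (block [.natStore 2 12 7, .natAdd 12 12 4]) .skip

theorem runs_pushProg (hE : Env P l s) {k y : ℕ} {S : ℕ → ℕ} {r : ℝ} (hk : s.natVar 12 = k)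
    (hS : s.natArr 2 = S) (hy : s.natVar 7 = y) (hr : s.realVar 9 = r)
    (hSN : S (k - 1) < total P) (hyN : y < total P) :
    Runs pushProg s (10 * d + 15) fun s' =>
      (r < dist (pt P (S (k - 1))) (pt P y) ∧ s'.natVar 12 = k + 1 ∧
        s'.natArr 2 = Function.update S k y) ∨
      (dist (pt P (S (k - 1))) (pt P y) ≤ r ∧ s'.natVar 12 = k ∧ s'.natArr 2 = S) := by
  refine ((Runs.block (Q := fun s' => s'.natVar 6 = S (k - 1)) ?_).seq (T₂ := 10 * d + 12)
    fun s₁ h₁ hf₁ => ?_).of_le (by simp only [List.length]; omega)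
  · simp [applyAll, hk, hE.one, hS]
  have hE₁ := hE.frame hf₁ (by decide)
  refine ((runs_distProg hE₁ h₁ (by rw [hf₁.nv 7 (by decide), hy]) hSN hyN).seq (T₂ := 4)
    fun s₂ h₂ hf₂ => ?_).of_le (by omega)
  have hE₂ := hE₁.frame hf₂ (by decide)
  have hk₂ : s₂.natVar 12 = k := by rw [hf₂.nv 12 (by decide), hf₁.nv 12 (by decide), hk]
  have hS₂ : s₂.natArr 2 = S := by rw [hf₂.na 2 (by decide), hf₁.na 2 (by decide), hS]
  have hy₂ : s₂.natVar 7 = y := by rw [hf₂.nv 7 (by decide), hf₁.nv 7 (by decide), hy]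
  have hr₂ : s₂.realVar 9 = r := by rw [hf₂.rv 9 (by decide), hf₁.rv 9 (by decide), hr]
  refine (Runs.cond (fun hb => Runs.block ?_) fun hb => Runs.skip ?_).of_le (by simp)
  · simp only [Test.Holds, hr₂, h₂] at hb
    refine .inl ⟨hb, ?_⟩
    simp [applyAll, hk₂, hE₂.one, hS₂, hy₂]
  · simp only [Test.Holds, hr₂, h₂, not_lt] at hb
    exact .inr ⟨hb, hk₂, hS₂⟩

/-- Stores in the real variable `10` the least distance of consecutive representatives. -/
def minGapProg : Prog :=
  .seq (block [.natLoad 6 2 3, .natLoad 7 2 4]) <|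
  .seq distProg <|
  .seq (block [.realAdd 10 2 1]) <|
  forLoop 0 26 2 <|
    .seq (block [.natAdd 27 26 4, .natLoad 6 2 26, .natLoad 7 2 27]) <|
    .seq distProg <|
    .cond (.realLt 2 10) (block [.realAdd 10 2 1]) .skip

theorem runs_minGapProg (hE : Env P l s) (hl : 1 ≤ l) {S : ℕ → ℕ} (hS : s.natArr 2 = S)
    (hSN : ∀ u ≤ l, S u < total P) :
    Runs minGapProg s (l * (10 * d + 17) + 10 * d + 15) fun s' =>
      (∀ u < l, s'.realVar 10 ≤ dist (pt P (S u)) (pt P (S (u + 1)))) ∧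
      ∃ u < l, s'.realVar 10 = dist (pt P (S u)) (pt P (S (u + 1))) := by
  refine ((Runs.block (Q := fun s' => s'.natVar 6 = S 0 ∧ s'.natVar 7 = S 1) ?_).seq
    (T₂ := l * (10 * d + 17) + 10 * d + 12) fun s₁ h₁ hf₁ => ?_).of_le
      (by simp only [List.length]; omega)
  · simp [applyAll, hE.zero, hE.one, hS]
  have hE₁ := hE.frame hf₁ (by decide)
  refine ((runs_distProg hE₁ h₁.1 h₁.2 (hSN 0 (by omega)) (hSN 1 hl)).seq
    (T₂ := l * (10 * d + 17) + 4) fun s₂ h₂ hf₂ => ?_).of_le (by omega)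
  have hE₂ := hE₁.frame hf₂ (by decide)
  refine ((Runs.block (Q := fun s' => s'.realVar 10 = dist (pt P (S 0)) (pt P (S 1))) ?_).seq
    (T₂ := l * (10 * d + 17) + 2) fun s₃ h₃ hf₃ => ?_).of_le
      (by simp only [List.length]; omega)
  · simp [applyAll, h₂, hE₂.rzero]
  have hE₃ := hE₂.frame hf₃ (by decide)
  have hS₃ : s₃.natArr 2 = S := by
    rw [hf₃.na 2 (by decide), hf₂.na 2 (by decide), hf₁.na 2 (by decide), hS]
  refine (Runs.forLoop (N := l) (T := 10 * d + 15)
    (fun i s' => (∀ u < i, s'.realVar 10 ≤ dist (pt P (S u)) (pt P (S (u + 1)))) ∧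
      ∃ u < l, s'.realVar 10 = dist (pt P (S u)) (pt P (S (u + 1))))
    (by decide) hE₃.one hE₃.len (Nat.zero_le _) ?_ ?_).weaken le_rfl fun s' h' hf' => h'.1
  · refine ⟨by simp, 0, hl, ?_⟩
    simpa using h₃
  · rintro i s₄ - hi h26 ⟨hle, v, hv, hveq⟩ hf₄
    have hE₄ := hE₃.frame hf₄ (by decide)
    have hS₄ : s₄.natArr 2 = S := by rw [hf₄.na 2 (by decide), hS₃]
    refine ((Runs.block (Q := fun s' => s'.natVar 6 = S i ∧ s'.natVar 7 = S (i + 1)) ?_).seq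
      (T₂ := 10 * d + 11) fun s₅ h₅ hf₅ => ?_).of_le (by simp only [List.length]; omega)
    · simp [applyAll, h26, hE₄.one, hS₄]
    have hE₅ := hE₄.frame hf₅ (by decide)
    refine ((runs_distProg hE₅ h₅.1 h₅.2 (hSN i hi.le) (hSN (i + 1) hi)).seq
      (T₂ := 3) fun s₆ h₆ hf₆ => ?_).of_le (by omega)
    have hE₆ := hE₅.frame hf₆ (by decide)
    refine (runs_min rfl h₆ hE₆.rzero).weaken le_rfl fun s₇ h₇ _ => ?_
    rw [hf₆.rv 10 (by decide), hf₅.rv 10 (by decide)] at h₇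
    simp only [Store.realVar_setNat, h₇]
    refine ⟨fun u hu => ?_, ?_⟩
    · rcases Nat.lt_succ_iff_lt_or_eq.1 hu with hu | rfl
      · exact (min_le_left _ _).trans (hle u hu)
      · exact min_le_right _ _
    · rcases min_choice (s₄.realVar 10) (dist (pt P (S i)) (pt P (S (i + 1)))) with h | h
      · exact ⟨v, hv, by rw [h, hveq]⟩
      · exact ⟨i, hi, h⟩

/-- Thins out the representatives, with the separation in the real variable `9`. -/
def thinProg : Prog :=
  .seq (block [.natAdd 25 12 3, .natConst 12 1]) <|
  forLoop 1 26 25 <| .seq (block [.natLoad 7 2 26]) pushProg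

/-- Each point is compared with the last one kept only: a dropped point is within `r` of it, and a
kept one is more than `r` away. -/
theorem runs_thinProg (hE : Env P l s) {K : ℕ} {S : ℕ → ℕ} {r : ℝ} (hS : s.natArr 2 = S)
    (hK : s.natVar 12 = K) (hK1 : 1 ≤ K) (hr : s.realVar 9 = r) (hr0 : 0 ≤ r)
    (hSN : ∀ u < K, S u < total P) :
    Runs thinProg s (K * (10 * d + 19) + 5) fun s' =>
      Clusters (pt P) S K (s'.natVar 12) (s'.natArr 2) r ∧
        Separated (pt P) (s'.natArr 2) (s'.natVar 12) r := by
  refine ((Runs.block (Q := fun s' => s'.natVar 25 = K ∧ s'.natVar 12 = 1) ?_).seq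
    (T₂ := K * (10 * d + 19) + 2) fun s₁ h₁ hf₁ => ?_).of_le
      (by simp only [List.length]; omega)
  · simp [applyAll, hK, hE.zero]
  have hE₁ := hE.frame hf₁ (by decide)
  have hS₁ : s₁.natArr 2 = S := by rw [hf₁.na 2 (by decide), hS]
  refine (Runs.forLoop (N := K) (T := 10 * d + 17)
    (fun i s' => Clusters (pt P) S i (s'.natVar 12) (s'.natArr 2) r ∧
      Separated (pt P) (s'.natArr 2) (s'.natVar 12) r ∧
      (∀ v, i ≤ v → s'.natArr 2 v = S v) ∧ ∀ v < s'.natVar 12, s'.natArr 2 v < total P)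
    (by decide) hE₁.one h₁.1 hK1 ?_ ?_).weaken le_rfl fun s' h' hf' => ⟨h'.1.1, h'.1.2.1⟩
  · simp only [Store.natVar_setNat, Store.natArr_setNat, h₁.2, hS₁]
    refine ⟨.single rfl hr0, fun u hu => ?_, fun _ _ => trivial, fun v hv => hSN v ?_⟩
    · simp at hu
    · simp at hv
      omega
  · rintro i s₂ h1i hi h26 ⟨hc, hsep, htail, hN⟩ hf₂
    have hE₂ := hE₁.frame hf₂ (by decide)
    -- The thinning is done in place. Never more points are kept than were read, so writing does not
    -- touch the unread part of the array.
    have hki := hc.card_le.1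
    have hkpos := hc.pos h1i
    refine ((Runs.block (Q := fun s' => s'.natVar 7 = S i) ?_).seq
      (T₂ := 10 * d + 15) fun s₃ h₃ hf₃ => ?_).of_le (by simp only [List.length]; omega)
    · simp [applyAll, h26, htail i le_rfl]
    have hE₃ := hE₂.frame hf₃ (by decide)
    refine (runs_pushProg hE₃ (k := s₂.natVar 12) (S := s₂.natArr 2) (r := r)
      (hf₃.nv 12 (by decide)) (hf₃.na 2 (by decide)) h₃ ?_ (hN _ (by omega)) (hSN i hi)).weaken
      le_rfl fun s₄ h₄ _ => ?_
    · rw [hf₃.rv 9 (by decide), hf₂.rv 9 (by decide), hf₁.rv 9 (by decide), hr]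
    · rcases h₄ with ⟨hd, hk₄, hS₄⟩ | ⟨hd, hk₄, hS₄⟩
      · simp only [Store.natVar_setNat, Store.natArr_setNat, hk₄, hS₄]
        refine ⟨hc.push hr0, hsep.push _ fun _ => hd, fun v hv => ?_, fun v hv => ?_⟩
        · rw [Function.update_of_ne (by omega), htail v (by omega)]
        · rcases eq_or_ne v (s₂.natVar 12) with rfl | hne
          · simpa using hSN i hi
          · rw [Function.update_of_ne hne]
            simp at hv
            exact hN v (by omega)
      · simp only [Store.natVar_setNat, Store.natArr_setNat, hk₄, hS₄]
        refine ⟨hc.join hkpos hd, hsep, fun v hv => htail v (by omega), fun v hv => hN v ?_⟩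
        simpa using hv

/-- Clusters the vertices of the first input curve. The representatives are stored in array `2`,
their number in the variable `12`. -/
def streamProg : Prog :=
  .seq (block [.natConst 12 1, .natStore 2 3 3, .natLoad 24 0 3, .realAdd 9 1 1]) <|
  forLoop 1 23 24 <|
    .seq (block [.natAdd 7 23 3]) <|
    .seq pushProg <|
    .cond (.natLt 2 12)
      (.seq minGapProg <| .seq (block [.realAdd 9 10 10]) thinProg) .skip

/-- A bound for the running time of `streamProg`. -/
def streamTime (d m l : ℕ) : ℕ :=
  m * (l * (10 * d + 17) + (l + 1) * (10 * d + 19) + 20 * d + 42) + 7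

/-- Each vertex causes one comparison and at most one round of thinning over `l + 1`
representatives, so the time per vertex is linear in `l`. -/
theorem runs_streamProg (hE : Env P l s) (hn : 0 < n) (hl : 1 ≤ l) {m : ℕ}
    (hm : size P 0 ≤ m) (hpos : 0 < size P 0) :
    Runs streamProg s (streamTime d m l) fun s' =>
      ∃ r, StreamInv P l (size P 0) (s'.natVar 12) (s'.natArr 2) r := by
  have htotal : ∀ j < size P 0, j < total P := by
    intro j hj
    have := start_add_lt P hn hj
    rwa [start_zero, zero_add] at this
  set T := l * (10 * d + 17) + (l + 1) * (10 * d + 19) + 20 * d + 40 with hT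
  refine ((Runs.block (Q := fun s' => s'.natVar 12 = 1 ∧ s'.natArr 2 0 = 0 ∧
    s'.natVar 24 = size P 0 ∧ s'.realVar 9 = 0) ?_).seq
    (T₂ := m * (l * (10 * d + 17) + (l + 1) * (10 * d + 19) + 20 * d + 42) + 2)
    fun s₁ h₁ hf₁ => ?_).of_le (by simp only [List.length, streamTime]; omega)
  · simp [applyAll, hE.zero, hE.size, hE.rzero]
  have hE₁ := hE.frame hf₁ (by decide)
  refine (Runs.forLoop (N := size P 0) (T := T)
    (fun j s' => StreamInv P l j (s'.natVar 12) (s'.natArr 2) (s'.realVar 9))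
    (by decide) hE₁.one h₁.2.2.1 hpos ?_ ?_).weaken ?_ fun s' h' hf' => ⟨_, h'.1⟩
  · simp only [Store.natVar_setNat, Store.natArr_setNat, Store.realVar_setNat, h₁.1, h₁.2.2.2]
    exact streamInv_one hn hl h₁.2.1
  · rintro j s₂ h1j hj h23 hI hf₂
    have hE₂ := hE₁.frame hf₂ (by decide)
    have hkpos := hI.clusters.pos h1j
    have hSN : ∀ u < s₂.natVar 12, s₂.natArr 2 u < total P := fun u hu =>
      (hI.clusters.lt hu).trans (htotal j hj)
    refine ((Runs.block (Q := fun s' => s'.natVar 7 = j) ?_).seq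
      (T₂ := T - 2) fun s₃ h₃ hf₃ => ?_).of_le (by simp only [List.length]; omega)
    · simp [applyAll, h23, hE₂.zero]
    have hE₃ := hE₂.frame hf₃ (by decide)
    have hr₃ : s₃.realVar 9 = s₂.realVar 9 := hf₃.rv 9 (by decide)
    refine ((runs_pushProg hE₃ (k := s₂.natVar 12) (S := s₂.natArr 2)
      (hf₃.nv 12 (by decide)) (hf₃.na 2 (by decide)) h₃ hr₃ (hSN _ (by omega))
      (htotal j hj)).seq (T₂ := T - 2 - (10 * d + 15)) fun s₄ h₄ hf₄ => ?_).of_le (by omega)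
    have hE₄ := hE₃.frame hf₄ (by decide)
    have hr₄ : s₄.realVar 9 = s₂.realVar 9 := by rw [hf₄.rv 9 (by decide), hr₃]
    refine (Runs.cond (T₁ := T - 2 - (10 * d + 15) - 1) (T₂ := 1) (fun hb => ?_)
      fun hb => Runs.skip ?_).of_le (by omega)
    · simp only [Test.Holds, hE₄.len] at hb
      have hkl := hI.card_le
      rcases h₄ with ⟨hd, hk₄, hS₄⟩ | ⟨hd, hk₄, hS₄⟩
      -- Only an appended representative can make the number exceed `l`, and then it was exactly `l`
      -- before.
      swap
      · omega
      have hk₂ : s₂.natVar 12 = l := by omega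
      rw [hk₂] at hI hd hS₄ hk₄ hSN
      have hSN' : ∀ u ≤ l, Function.update (s₂.natArr 2) l j u < total P := by
        intro u hu
        rcases eq_or_ne u l with rfl | hne
        · simpa using htotal j hj
        · rw [Function.update_of_ne hne]
          exact hSN u (by omega)
      refine ((runs_minGapProg hE₄ hl hS₄ hSN').seq
        (T₂ := (l + 1) * (10 * d + 19) + 7) fun s₅ h₅ hf₅ => ?_).of_le (by omega)
      have hE₅ := hE₄.frame hf₅ (by decide)
      refine ((Runs.block (Q := fun s' => s'.realVar 9 = 2 * s₅.realVar 10) ?_).seq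
        (T₂ := (l + 1) * (10 * d + 19) + 5) fun s₆ h₆ hf₆ => ?_).of_le
          (by simp only [List.length]; omega)
      · simp [applyAll, two_mul]
      have hE₆ := hE₅.frame hf₆ (by decide)
      have hnn : 0 ≤ s₅.realVar 10 := by
        obtain ⟨u, -, hu⟩ := h₅.2
        rw [hu]
        exact dist_nonneg
      refine (runs_thinProg hE₆ (K := l + 1) (S := Function.update (s₂.natArr 2) l j)
        ?_ ?_ (by omega) h₆ (by linarith) fun u hu => hSN' u (by omega)).weaken le_rfl
        fun s₇ h₇ hf₇ => ?_
      · rw [hf₆.na 2 (by decide), hf₅.na 2 (by decide), hS₄]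
      · rw [hf₆.nv 12 (by decide), hf₅.nv 12 (by decide), hk₄]
      · have := hI.overflow hn hj hd h₅.1 h₅.2 h₇.1 h₇.2
        simpa [hf₇.rv 9 (by decide), h₆] using this
    · simp only [Test.Holds, hE₄.len] at hb
      simp only [Store.natVar_setNat, Store.natArr_setNat, Store.realVar_setNat, hr₄]
      rcases h₄ with ⟨hd, hk₄, hS₄⟩ | ⟨hd, hk₄, hS₄⟩
      · rw [hk₄, hS₄]
        exact hI.push (by omega) hd
      · rw [hk₄, hS₄]
        exact hI.join h1j hd
  · exact Nat.add_le_add_right (Nat.mul_le_mul_right _ hm) _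

/-! ### Recording the best candidate -/

/-- Saves the candidate in array `2` and its cost as the best solution found so far. -/
def saveProg : Prog :=
  .seq (block [.realAdd 8 5 1, .natAdd 20 12 3]) <|
  forLoop 0 21 12 <| block [.natLoad 22 2 21, .natStore 5 21 22]

theorem runs_saveProg (hE : Env P l s) {a : ℕ} (ha : s.natVar 12 = a) :
    Runs saveProg s (a * 5 + 5) fun s' => s'.realVar 8 = s.realVar 5 ∧ s'.natVar 20 = a ∧
      ∀ u < a, s'.natArr 5 u = s.natArr 2 u := by
  refine ((Runs.block (Q := fun s' => s'.realVar 8 = s.realVar 5 ∧ s'.natVar 20 = a) ?_).seq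
    (T₂ := a * 5 + 2) fun s₁ h₁ hf₁ => ?_).of_le
      (by simp only [List.length]; omega)
  · simp [applyAll, hE.zero, hE.rzero, ha]
  have hE₁ := hE.frame hf₁ (by decide)
  refine (Runs.forLoop (N := a) (T := 3) (fun i s' => ∀ u < i, s'.natArr 5 u = s.natArr 2 u)
    (by decide) hE₁.one (by rw [hf₁.nv 12 (by decide), ha]) (Nat.zero_le _) (by simp) ?_).weaken
    le_rfl fun s' h' hf' => ⟨by rw [hf'.rv 8 (by decide), h₁.1],
      by rw [hf'.nv 20 (by decide), h₁.2], h'.1⟩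
  rintro i s₂ - hi h21 hI hf₂
  refine Runs.block fun u hu => ?_
  simp only [applyAll, Instr.apply, Store.natArr_setNat, Store.natArr_setNatArr, if_true,
    Store.natVar_setNat, h21, hf₂.na 2 (by decide), hf₁.na 2 (by decide)]
  rcases Nat.lt_succ_iff_lt_or_eq.1 hu with hu | rfl
  · simpa [Function.update_of_ne hu.ne, h21] using hI u hu
  · simp

end StreamProg

/-! ### Nets on the machine -/

section NetProg

variable {d n : ℕ} {P : Fin n → Curve d} {l : ℕ} {s s' : Store}

/-- The entries `b, …, b + z - 1` of the array `A` are vertices within `ρ` of the vertex `c`, more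
than `η` apart, such that each of the first `x` input vertices within `ρ` of the vertex `c` is
within `η` of one of them. -/
structure IsNet (P : Fin n → Curve d) (ρ η : ℝ) (c x : ℕ) (A : ℕ → ℕ) (b z : ℕ) : Prop where
  lt : ∀ g < z, A (b + g) < total P
  near : ∀ g < z, dist (pt P c) (pt P (A (b + g))) ≤ ρ
  sep : ∀ g < z, ∀ g' < g, η < dist (pt P (A (b + g'))) (pt P (A (b + g)))
  cover : ∀ y < x, dist (pt P c) (pt P y) ≤ ρ → ∃ g < z, dist (pt P (A (b + g))) (pt P y) ≤ η
  card_le : z ≤ x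

variable {ρ η : ℝ} {c x b z : ℕ} {A A' : ℕ → ℕ}

theorem isNet_zero : IsNet P ρ η c 0 A b 0 := by
  constructor <;> simp

theorem IsNet.congr (h : IsNet P ρ η c x A b z) (hA : ∀ g < z, A' (b + g) = A (b + g)) :
    IsNet P ρ η c x A' b z where
  lt g hg := by rw [hA g hg]; exact h.lt g hg
  near g hg := by rw [hA g hg]; exact h.near g hg
  sep g hg g' hg' := by rw [hA g hg, hA g' (by omega)]; exact h.sep g hg g' hg'
  cover y hy hd := by
    obtain ⟨g, hg, hgd⟩ := h.cover y hy hd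
    exact ⟨g, hg, by rwa [hA g hg]⟩
  card_le := h.card_le

theorem IsNet.skip (h : IsNet P ρ η c x A b z)
    (hx : dist (pt P c) (pt P x) ≤ ρ → ∃ g < z, dist (pt P (A (b + g))) (pt P x) ≤ η) :
    IsNet P ρ η c (x + 1) A b z where
  lt := h.lt
  near := h.near
  sep := h.sep
  cover y hy hd := by
    rcases Nat.lt_succ_iff_lt_or_eq.1 hy with hy | rfl
    exacts [h.cover y hy hd, hx hd]
  card_le := h.card_le.trans (Nat.le_succ _)

theorem IsNet.push (h : IsNet P ρ η c x A b z) (hη : 0 ≤ η) (hxN : x < total P)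
    (hx : dist (pt P c) (pt P x) ≤ ρ) (hsep : ∀ g < z, η < dist (pt P (A (b + g))) (pt P x)) :
    IsNet P ρ η c (x + 1) (Function.update A (b + z) x) b (z + 1) := by
  have hold : ∀ g < z, Function.update A (b + z) x (b + g) = A (b + g) := fun g hg =>
    Function.update_of_ne (by omega) _ _
  have hnew : Function.update A (b + z) x (b + z) = x := Function.update_self ..
  have h' := h.congr hold
  constructor
  · intro g hg
    rcases Nat.lt_succ_iff_lt_or_eq.1 hg with hg | rfl
    · exact h'.lt g hg
    · rwa [hnew]
  · intro g hg
    rcases Nat.lt_succ_iff_lt_or_eq.1 hg with hg | rfl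
    · exact h'.near g hg
    · rwa [hnew]
  · intro g hg g' hg'
    rcases Nat.lt_succ_iff_lt_or_eq.1 hg with hg | rfl
    · exact h'.sep g hg g' hg'
    · rw [hnew, hold g' hg']
      exact hsep g' hg'
  · intro y hy hd
    rcases Nat.lt_succ_iff_lt_or_eq.1 hy with hy | rfl
    · obtain ⟨g, hg, hgd⟩ := h'.cover y hy hd
      exact ⟨g, by omega, hgd⟩
    · exact ⟨z, Nat.lt_succ_self z, by rwa [hnew, dist_self]⟩
  · exact Nat.succ_le_succ h.card_le

/-- Decides whether the vertex in variable `7` is within the real variable `11` of a net point of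
the representative in variable `29`, which has `natVar 31` net points. -/
def coveredProg : Prog :=
  .seq (block [.natConst 33 0]) <|
  forLoop 0 32 31 <|
    .seq (block [.natMul 34 29 5, .natAdd 34 34 32, .natLoad 6 3 34]) <|
    .seq distProg <|
    .cond (.realLt 11 2) .skip (block [.natConst 33 1])

theorem runs_coveredProg (hE : Env P l s) {y : ℕ} (h7 : s.natVar 7 = y) (hy : y < total P)
    (h29 : s.natVar 29 = c) (h31 : s.natVar 31 = z) (h3 : s.natArr 3 = A) (h11 : s.realVar 11 = η)
    (hA : ∀ g < z, A (c * total P + g) < total P) :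
    Runs coveredProg s (z * (10 * d + 17) + 4) fun s' =>
      (s'.natVar 33 = 0 ∧ ∀ g < z, η < dist (pt P (A (c * total P + g))) (pt P y)) ∨
      (s'.natVar 33 = 1 ∧ ∃ g < z, dist (pt P (A (c * total P + g))) (pt P y) ≤ η) := by
  refine ((Runs.block (Q := fun s' => s'.natVar 33 = 0) ?_).seq
    (T₂ := z * (10 * d + 17) + 2) fun s₁ h₁ hf₁ => ?_).of_le
      (by simp only [List.length]; omega)
  · simp [applyAll]
  have hE₁ := hE.frame hf₁ (by decide)
  refine (Runs.forLoop (N := z) (T := 10 * d + 15) (fun i s' =>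
      (s'.natVar 33 = 0 ∧ ∀ g < i, η < dist (pt P (A (c * total P + g))) (pt P y)) ∨
      (s'.natVar 33 = 1 ∧ ∃ g < z, dist (pt P (A (c * total P + g))) (pt P y) ≤ η))
    (by decide) hE₁.one (by rw [hf₁.nv 31 (by decide), h31]) (Nat.zero_le _) (by simp [h₁])
    ?_).weaken le_rfl fun s' h' _ => h'.1
  rintro i s₂ - hi h32 hI hf₂
  have hE₂ := hE₁.frame hf₂ (by decide)
  refine ((Runs.block (Q := fun s' => s'.natVar 6 = A (c * total P + i)) ?_).seq
    (T₂ := 10 * d + 11) fun s₃ h₃ hf₃ => ?_).of_le (by simp only [List.length]; omega)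
  · simp [applyAll, h32, hE₂.tot, hf₂.nv 29 (by decide), hf₁.nv 29 (by decide), h29,
      hf₂.na 3 (by decide), hf₁.na 3 (by decide), h3]
  have hE₃ := hE₂.frame hf₃ (by decide)
  refine ((runs_distProg hE₃ h₃ ?_ (hA i hi) hy).seq (T₂ := 3) fun s₄ h₄ hf₄ => ?_).of_le
    (by omega)
  · rw [hf₃.nv 7 (by decide), hf₂.nv 7 (by decide), hf₁.nv 7 (by decide), h7]
  have h11' : s₄.realVar 11 = η := by
    rw [hf₄.rv 11 (by decide), hf₃.rv 11 (by decide), hf₂.rv 11 (by decide),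
      hf₁.rv 11 (by decide), h11]
  have h33 : s₄.natVar 33 = s₂.natVar 33 := by
    rw [hf₄.nv 33 (by decide), hf₃.nv 33 (by decide)]
  refine (Runs.cond (fun hb => Runs.skip ?_) fun hb => Runs.block ?_).of_le (by simp)
  · simp only [Test.Holds, h11', h₄] at hb
    simp only [Store.natVar_setNat, h33]
    rcases hI with ⟨h0, hI⟩ | hI
    · refine .inl ⟨h0, fun g hg => ?_⟩
      rcases Nat.lt_succ_iff_lt_or_eq.1 hg with hg | rfl
      exacts [hI g hg, hb]
    · exact .inr hI
  · simp only [Test.Holds, h11', h₄, not_lt] at hb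
    exact .inr ⟨by simp [applyAll], i, hi, hb⟩

/-- Considers the vertex in variable `30` for the net of the representative in variable `29`. -/
def visitProg : Prog :=
  .seq (block [.natLoad 6 2 29, .natAdd 7 30 3]) <|
  .seq distProg <|
  .cond (.realLt 12 2) .skip <|
    .seq coveredProg <|
    .cond (.natLt 33 4)
      (block [.natMul 34 29 5, .natAdd 34 34 31, .natStore 3 34 7, .natAdd 31 31 4]) .skip

/-- The greedy choice: a vertex within `ρ` of the representative joins the net exactly when no net
point is within `η`. This keeps the net separated and covering at once. -/
theorem runs_visitProg (hE : Env P l s) (hη : 0 ≤ η) (hx : s.natVar 30 = x) (hxN : x < total P)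
    (h29 : s.natVar 29 = c) (h11 : s.realVar 11 = η) (h12 : s.realVar 12 = ρ)
    (hcN : s.natArr 2 c < total P)
    (hI : IsNet P ρ η (s.natArr 2 c) x (s.natArr 3) (c * total P) (s.natVar 31)) :
    Runs visitProg s (s.natVar 31 * (10 * d + 17) + 10 * d + 22) fun s' =>
      IsNet P ρ η (s.natArr 2 c) (x + 1) (s'.natArr 3) (c * total P) (s'.natVar 31) ∧
      ∀ e < c * total P, s'.natArr 3 e = s.natArr 3 e := by
  refine ((Runs.block (Q := fun s' => s'.natVar 6 = s.natArr 2 c ∧ s'.natVar 7 = x) ?_).seq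
    (T₂ := s.natVar 31 * (10 * d + 17) + 10 * d + 19) fun s₁ h₁ hf₁ => ?_).of_le
      (by simp only [List.length]; omega)
  · simp [applyAll, hx, h29, hE.zero]
  have hE₁ := hE.frame hf₁ (by decide)
  refine ((runs_distProg hE₁ h₁.1 h₁.2 hcN hxN).seq
    (T₂ := s.natVar 31 * (10 * d + 17) + 11) fun s₂ h₂ hf₂ => ?_).of_le (by omega)
  have hE₂ := hE₁.frame hf₂ (by decide)
  have n7 : s₂.natVar 7 = x := by rw [hf₂.nv 7 (by decide), h₁.2]
  have n29 : s₂.natVar 29 = c := by rw [hf₂.nv 29 (by decide), hf₁.nv 29 (by decide), h29]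
  have n31 : s₂.natVar 31 = s.natVar 31 := by rw [hf₂.nv 31 (by decide), hf₁.nv 31 (by decide)]
  have a3 : s₂.natArr 3 = s.natArr 3 := by rw [hf₂.na 3 (by decide), hf₁.na 3 (by decide)]
  have r11 : s₂.realVar 11 = η := by rw [hf₂.rv 11 (by decide), hf₁.rv 11 (by decide), h11]
  have r12 : s₂.realVar 12 = ρ := by rw [hf₂.rv 12 (by decide), hf₁.rv 12 (by decide), h12]
  refine (Runs.cond (T₁ := 1) (T₂ := s.natVar 31 * (10 * d + 17) + 10) (fun hb => Runs.skip ?_)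
    fun hb => ?_).of_le (by omega)
  · simp only [Test.Holds, r12, h₂] at hb
    rw [a3, n31]
    exact ⟨hI.skip fun hd => absurd hd (not_le.2 hb), fun _ _ => rfl⟩
  · simp only [Test.Holds, r12, h₂, not_lt] at hb
    refine ((runs_coveredProg hE₂ n7 hxN n29 n31 a3 r11 hI.lt).seq (T₂ := 6)
      fun s₃ h₃ hf₃ => ?_).of_le (by omega)
    have hE₃ := hE₂.frame hf₃ (by decide)
    have m31 : s₃.natVar 31 = s.natVar 31 := by rw [hf₃.nv 31 (by decide), n31]
    have m3 : s₃.natArr 3 = s.natArr 3 := by rw [hf₃.na 3 (by decide), a3]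
    refine (Runs.cond (fun hb' => Runs.block ?_) fun hb' => Runs.skip ?_).of_le (by simp)
    · simp only [Test.Holds, hE₃.one] at hb'
      rcases h₃ with ⟨-, h₃⟩ | ⟨h₃, -⟩
      · simp only [applyAll, Instr.apply, Store.natVar_setNat, Store.natArr_setNat,
          Store.natArr_setNatArr, Store.natVar_setNatArr]
        simp only [hf₃.nv 29 (by decide), n29, hE₃.tot, m31, m3, hf₃.nv 7 (by decide), n7,
          hE₃.one, reduceIte, Nat.reduceEqDiff]
        exact ⟨hI.push hη hxN hb h₃, fun e he => Function.update_of_ne (by omega) _ _⟩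
      · omega
    · simp only [Test.Holds, hE₃.one] at hb'
      rcases h₃ with ⟨h₃, -⟩ | ⟨-, h₃⟩
      · omega
      · rw [m31, m3]
        exact ⟨hI.skip fun _ => h₃, fun _ _ => rfl⟩

theorem runs_natMax {x y z : ℕ} (hz : s.natVar z = 0) :
    Runs (.cond (.natLt x y) (block [.natAdd x y z]) .skip) s 3
      fun s' => s'.natVar x = max (s.natVar x) (s.natVar y) := by
  refine (Runs.cond (fun hb => Runs.block ?_) fun hb => Runs.skip ?_).of_le (by simp)
  · simp only [Test.Holds] at hb
    simp [applyAll, hz, hb.le]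
  · simp only [Test.Holds, not_lt] at hb
    simp [hb]

/-- Computes for each of the `natVar 12` representatives in array `2` a net of the input vertices
near to it. The nets are stored in array `3`, with rows of length `natVar 5`, their sizes in array
`4`, and the largest size in the variable `35`. -/
def netProg : Prog :=
  .seq (block [.natConst 35 0]) <|
  forLoop 0 29 12 <|
    .seq (block [.natConst 31 0]) <|
    .seq (forLoop 0 30 5 visitProg) <|
    .seq (block [.natStore 4 29 31]) <|
    .cond (.natLt 35 31) (block [.natAdd 35 31 3]) .skip

/-- A bound for the running time of `netProg`. -/
def netTime (d γ N l : ℕ) : ℕ := l * (N * (γ * (10 * d + 17) + 10 * d + 24) + 11) + 4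

theorem runs_netProg (hE : Env P l s) (hη : 0 ≤ η) {k γ : ℕ} {S : ℕ → ℕ}
    (h11 : s.realVar 11 = η) (h12 : s.realVar 12 = ρ) (hk : s.natVar 12 = k) (hkl : k ≤ l)
    (hS : s.natArr 2 = S) (hSN : ∀ c < k, S c < total P) (h4 : ∀ c, s.natArr 4 c = 0)
    (hγ : ∀ c x A b z, IsNet P ρ η c x A b z → z ≤ γ) :
    Runs netProg s (netTime d γ (total P) l) fun s' =>
      s'.natVar 35 ≤ γ ∧ (∀ c, s'.natArr 4 c ≤ s'.natVar 35) ∧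
      (∀ c, k ≤ c → s'.natArr 4 c = 0) ∧
      ∀ c < k, IsNet P ρ η (S c) (total P) (s'.natArr 3) (c * total P) (s'.natArr 4 c) := by
  set T := γ * (10 * d + 17) + 10 * d + 22 with hT
  refine ((Runs.block (Q := fun s' => s'.natVar 35 = 0) ?_).seq
    (T₂ := l * (total P * (T + 2) + 9 + 2) + 2) fun s₁ h₁ hf₁ => ?_).of_le ?_
  · simp [applyAll]
  swap
  · have : total P * (T + 2) + 9 + 2 =
      total P * (γ * (10 * d + 17) + 10 * d + 24) + 11 := rfl
    rw [this]
    simp only [List.length, netTime]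
    omega
  have hE₁ := hE.frame hf₁ (by decide)
  refine (Runs.forLoop (N := k) (T := total P * (T + 2) + 9) (fun c s' =>
      s'.natVar 35 ≤ γ ∧ (∀ c', s'.natArr 4 c' ≤ s'.natVar 35) ∧
      (∀ c', c ≤ c' → s'.natArr 4 c' = 0) ∧
      ∀ c' < c, IsNet P ρ η (S c') (total P) (s'.natArr 3) (c' * total P) (s'.natArr 4 c'))
    (by decide) hE₁.one (by rw [hf₁.nv 12 (by decide), hk]) (Nat.zero_le _) ?_ ?_).weaken ?_
    fun s' h' _ => h'.1
  · simp [h₁, hf₁.na 4 (by decide), h4]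
  · rintro c s₂ - hc h29 ⟨hI1, hI2, hI3, hI4⟩ hf₂
    have hE₂ := hE₁.frame hf₂ (by decide)
    refine ((Runs.block (Q := fun s' => s'.natVar 31 = 0) ?_).seq
      (T₂ := total P * (T + 2) + 7) fun s₃ h₃ hf₃ => ?_).of_le
        (by simp only [List.length]; omega)
    · simp [applyAll]
    have hE₃ := hE₂.frame hf₃ (by decide)
    have hS₃ : s₃.natArr 2 = S := by
      rw [hf₃.na 2 (by decide), hf₂.na 2 (by decide), hf₁.na 2 (by decide), hS]
    have h29₃ : s₃.natVar 29 = c := by rw [hf₃.nv 29 (by decide), h29]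
    refine ((Runs.forLoop (N := total P) (T := T) (fun x s' =>
      IsNet P ρ η (S c) x (s'.natArr 3) (c * total P) (s'.natVar 31) ∧
      ∀ e < c * total P, s'.natArr 3 e = s₃.natArr 3 e)
      (by decide) hE₃.one hE₃.tot (Nat.zero_le _) ?_ ?_).seq (T₂ := 5)
      fun s₄ h₄ hf₄ => ?_).of_le (by omega)
    · simp [h₃, isNet_zero]
    · rintro x s₄ - hx h30 ⟨hN, hrow⟩ hf₄
      have hE₄ := hE₃.frame hf₄ (by decide)
      have hS₄ : s₄.natArr 2 = S := by rw [hf₄.na 2 (by decide), hS₃]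
      -- The unfinished net is already separated, so the packing bound applies at every stage and
      -- limits the cost of each scan.
      have hz := hγ _ _ _ _ _ hN
      refine (runs_visitProg (c := c) (η := η) (ρ := ρ) hE₄ hη h30 hx ?_ ?_ ?_ ?_ ?_).weaken ?_
        fun s₅ h₅ _ => ?_
      · rw [hf₄.nv 29 (by decide), h29₃]
      · rw [hf₄.rv 11 (by decide), hf₃.rv 11 (by decide), hf₂.rv 11 (by decide),
          hf₁.rv 11 (by decide), h11]
      · rw [hf₄.rv 12 (by decide), hf₃.rv 12 (by decide), hf₂.rv 12 (by decide),
          hf₁.rv 12 (by decide), h12]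
      · rw [hS₄]
        exact hSN c hc
      · rwa [hS₄]
      · have := Nat.mul_le_mul_right (10 * d + 17) hz
        omega
      · rw [hS₄] at h₅
        refine ⟨by simpa using h₅.1, fun e he => ?_⟩
        rw [Store.natArr_setNat, h₅.2 e he, hrow e he]
    · have hE₄ := hE₃.frame hf₄ (by decide)
      obtain ⟨⟨hN, hrow⟩, -⟩ := h₄
      have hz := hγ _ _ _ _ _ hN
      have a4 : s₄.natArr 4 = s₂.natArr 4 := by rw [hf₄.na 4 (by decide), hf₃.na 4 (by decide)]
      have n35 : s₄.natVar 35 = s₂.natVar 35 := by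
        rw [hf₄.nv 35 (by decide), hf₃.nv 35 (by decide)]
      refine ((Runs.block (Q := fun s' =>
        s'.natArr 4 = Function.update (s₂.natArr 4) c (s₄.natVar 31)) ?_).seq
        (T₂ := 3) fun s₅ h₅ hf₅ => ?_).of_le (by simp)
      · simp [applyAll, hf₄.nv 29 (by decide), h29₃, a4]
      have hE₅ := hE₄.frame hf₅ (by decide)
      have m31 : s₅.natVar 31 = s₄.natVar 31 := hf₅.nv 31 (by decide)
      have m35 : s₅.natVar 35 = s₂.natVar 35 := by rw [hf₅.nv 35 (by decide), n35]
      have m3 : s₅.natArr 3 = s₄.natArr 3 := hf₅.na 3 (by decide)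
      refine (runs_natMax hE₅.zero).weaken le_rfl
        fun s₆ h₆ hf₆ => ?_
      rw [m35, m31] at h₆
      simp only [Store.natVar_setNat, Store.natArr_setNat, reduceIte, Nat.reduceEqDiff, h₆,
        hf₆.na 4 (by decide), h₅, hf₆.na 3 (by decide), m3]
      refine ⟨max_le hI1 hz, fun c' => ?_, fun c' hc' => ?_, fun c' hc' => ?_⟩
      · rcases eq_or_ne c' c with rfl | hne
        · simp
        · rw [Function.update_of_ne hne]
          exact (hI2 c').trans (le_max_left _ _)
      · rw [Function.update_of_ne (by omega)]
        exact hI3 c' (by omega)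
      · rcases eq_or_ne c' c with rfl | hne
        · rw [Function.update_self]
          exact hN
        · rw [Function.update_of_ne hne]
          have h6 := hI4 c' (by omega)
          refine h6.congr fun g hg => ?_
          -- A net has at most as many points as there are input vertices, so it fits into its row
          -- and later rows do not overwrite it.
          have h7 : (c' + 1) * total P ≤ c * total P := Nat.mul_le_mul_right _ (by omega)
          rw [Nat.succ_mul] at h7
          have h8 := h6.card_le
          rw [hrow _ (by omega), hf₃.na 3 (by decide)]
  · exact Nat.add_le_add_right (Nat.mul_le_mul_right _ hkl) _

end NetProg

/-! ### Enumeration of the candidates on the machine -/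

section EnumProg

variable {d n : ℕ} {P : Fin n → Curve d} {l : ℕ} {s s' : Store}

/-- The candidate array still contains remnants of earlier words. They do not affect the decoded
part, which permits stating the search with the zero array. -/
theorem Decoder.run_congr (sz A : ℕ → ℕ) (N l B w : ℕ) (o o' : ℕ → ℕ) (t : ℕ) :
    (run sz A N l B w o t).cur = (run sz A N l B w o' t).cur ∧
    (run sz A N l B w o t).cnt = (run sz A N l B w o' t).cnt ∧
    ∀ u < (run sz A N l B w o t).cnt,
      (run sz A N l B w o t).out u = (run sz A N l B w o' t).out u := by
  induction t with
  | zero => simp [run]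
  | succ t ih =>
    obtain ⟨h1, h2, h3⟩ := ih
    rw [run, run, step, step, ← h1, ← h2]
    split_ifs
    · refine ⟨rfl, rfl, fun u hu => ?_⟩
      rcases eq_or_ne u (run sz A N l B w o t).cnt with rfl | hne
      · simp
      · simp only at hu ⊢
        rw [Function.update_of_ne hne, Function.update_of_ne hne]
        exact h3 u (by omega)
    · exact ⟨h1, h2, h3⟩
    · exact ⟨rfl, rfl, h3⟩

/-- Division with remainder of the variable `42` by the variable `36`, whose predecessor is in
the variable `35`. The quotient is added to the variable `39`. -/
def divProg : Prog := .loop (.natLt 35 42) (block [.natSub 42 42 36, .natAdd 39 39 4])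

/-- Integer division is not an instruction and is done by repeated subtraction, in time linear in
the dividend. This merely squares the number of words in the final bound. -/
theorem runs_divProg {G : ℕ} (v : ℕ) : ∀ (s : Store) (q : ℕ), s.natVar 4 = 1 → s.natVar 35 = G →
    s.natVar 36 = G + 1 → s.natVar 42 = v → s.natVar 39 = q →
    Runs divProg s (4 * v + 1) fun s' =>
      s'.natVar 42 = v % (G + 1) ∧ s'.natVar 39 = q + v / (G + 1) := by
  induction v using Nat.strong_induction_on with
  | _ v ih =>
    intro s q h4 h35 h36 h42 h39
    by_cases hv : G < v
    · obtain ⟨s₁, t₁, he₁, ht₁, ⟨a1, a2, a3, a4, a5⟩⟩ : Runs (block [.natSub 42 42 36,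
          .natAdd 39 39 4]) s 3 fun s' => s'.natVar 4 = 1 ∧ s'.natVar 35 = G ∧
          s'.natVar 36 = G + 1 ∧ s'.natVar 42 = v - (G + 1) ∧ s'.natVar 39 = q + 1 := by
        refine Runs.block ?_
        simp [applyAll, h4, h35, h36, h42, h39]
      obtain ⟨s₂, t₂, he₂, ht₂, hq⟩ := ih (v - (G + 1)) (by omega) s₁ (q + 1) a1 a2 a3 a4 a5
      refine ⟨s₂, t₁ + t₂ + 1, .loopTrue ?_ he₁ he₂, by omega, ?_, ?_⟩
      · simpa [Test.Holds, h35, h42] using hv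
      · rw [hq.1, ← Nat.mod_eq_sub_mod (by omega)]
      · rw [hq.2, Nat.div_eq_sub_div (a := v) (by omega) (by omega)]
        omega
    · refine ⟨s, 1, .loopFalse ?_, by omega, ?_, ?_⟩
      · simpa [Test.Holds, h35, h42] using hv
      · rw [h42, Nat.mod_eq_of_lt (by omega)]
      · rw [h39, Nat.div_eq_of_lt (by omega), add_zero]

/-- Decodes the word in variable `38` to a candidate in array `2`. -/
def decodeProg : Prog :=
  .seq (block [.natAdd 39 38 3, .natConst 40 0, .natConst 12 0]) <|
  forLoop 0 41 43 <|
    .seq (block [.natAdd 42 39 3, .natConst 39 0]) <|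
    .seq divProg <|
    .seq (block [.natLoad 44 4 40]) <|
    .cond (.natLt 42 44)
      (.cond (.natLt 12 2) (block [.natMul 45 40 5, .natAdd 45 45 42, .natLoad 45 3 45,
        .natStore 2 12 45, .natAdd 12 12 4]) .skip)
      (block [.natAdd 40 40 4])

theorem runs_decodeProg (hE : Env P l s) {G w : ℕ} (h35 : s.natVar 35 = G)
    (h36 : s.natVar 36 = G + 1) (h43 : s.natVar 43 = 2 * l) (h38 : s.natVar 38 = w) :
    Runs decodeProg s (2 * l * (4 * w + 17) + 6) fun s' =>
      s'.natVar 12 =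
        (Decoder.run (s.natArr 4) (s.natArr 3) (total P) l (G + 1) w (s.natArr 2) (2 * l)).cnt ∧
      s'.natArr 2 =
        (Decoder.run (s.natArr 4) (s.natArr 3) (total P) l (G + 1) w (s.natArr 2) (2 * l)).out := by
  set σ := Decoder.run (s.natArr 4) (s.natArr 3) (total P) l (G + 1) w (s.natArr 2) with hσ
  refine ((Runs.block (Q := fun s' => s'.natVar 39 = w ∧ s'.natVar 40 = 0 ∧ s'.natVar 12 = 0)
    ?_).seq (T₂ := 2 * l * (4 * w + 17) + 2) fun s₁ h₁ hf₁ => ?_).of_le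
      (by simp only [List.length]; omega)
  · simp [applyAll, h38, hE.zero]
  have hE₁ := hE.frame hf₁ (by decide)
  refine (Runs.forLoop (N := 2 * l) (T := 4 * w + 15) (fun t s' =>
      s'.natVar 39 = w / (G + 1) ^ t ∧ s'.natVar 40 = (σ t).cur ∧ s'.natVar 12 = (σ t).cnt ∧
      s'.natArr 2 = (σ t).out)
    (by decide) hE₁.one (by rw [hf₁.nv 43 (by decide), h43]) (Nat.zero_le _) ?_ ?_).weaken le_rfl
    fun s' h' _ => ⟨h'.1.2.2.1, h'.1.2.2.2⟩
  · simp [h₁, hf₁.na 2 (by decide), hσ, Decoder.run]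
  · rintro t s₂ - ht h41 ⟨h39, h40, h12, h2⟩ hf₂
    have hE₂ := hE₁.frame hf₂ (by decide)
    have hle : w / (G + 1) ^ t ≤ w := Nat.div_le_self _ _
    refine ((Runs.block (Q := fun s' => s'.natVar 42 = w / (G + 1) ^ t ∧ s'.natVar 39 = 0)
      ?_).seq (T₂ := 4 * w + 12) fun s₃ h₃ hf₃ => ?_).of_le
        (by simp only [List.length]; omega)
    · simp [applyAll, h39, hE₂.zero]
    have hE₃ := hE₂.frame hf₃ (by decide)
    refine ((runs_divProg (G := G) _ s₃ 0 hE₃.one ?_ ?_ h₃.1 h₃.2).seq (T₂ := 11)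
      fun s₄ h₄ hf₄ => ?_).of_le (by omega)
    · rw [hf₃.nv 35 (by decide), hf₂.nv 35 (by decide), hf₁.nv 35 (by decide), h35]
    · rw [hf₃.nv 36 (by decide), hf₂.nv 36 (by decide), hf₁.nv 36 (by decide), h36]
    have hE₄ := hE₃.frame hf₄ (by decide)
    have e40 : s₄.natVar 40 = (σ t).cur := by
      rw [hf₄.nv 40 (by decide), hf₃.nv 40 (by decide), h40]
    refine ((Runs.block (Q := fun s' => s'.natVar 44 = s.natArr 4 (σ t).cur) ?_).seq (T₂ := 9)
      fun s₅ h₅ hf₅ => ?_).of_le (by simp)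
    · simp [applyAll, e40, hf₄.na 4 (by decide), hf₃.na 4 (by decide), hf₂.na 4 (by decide),
        hf₁.na 4 (by decide)]
    have hE₅ := hE₄.frame hf₅ (by decide)
    have g40 : s₅.natVar 40 = (σ t).cur := by rw [hf₅.nv 40 (by decide), e40]
    have g12 : s₅.natVar 12 = (σ t).cnt := by
      rw [hf₅.nv 12 (by decide), hf₄.nv 12 (by decide), hf₃.nv 12 (by decide), h12]
    have g42 : s₅.natVar 42 = w / (G + 1) ^ t % (G + 1) := by rw [hf₅.nv 42 (by decide), h₄.1]
    have g39 : s₅.natVar 39 = w / (G + 1) ^ (t + 1) := by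
      rw [hf₅.nv 39 (by decide), h₄.2, zero_add, pow_succ, Nat.div_div_eq_div_mul]
    have g2 : s₅.natArr 2 = (σ t).out := by
      rw [hf₅.na 2 (by decide), hf₄.na 2 (by decide), hf₃.na 2 (by decide), h2]
    have g3 : s₅.natArr 3 = s.natArr 3 := by
      rw [hf₅.na 3 (by decide), hf₄.na 3 (by decide), hf₃.na 3 (by decide), hf₂.na 3 (by decide),
        hf₁.na 3 (by decide)]
    have hstep : σ (t + 1) = (σ t).step (s.natArr 4) (s.natArr 3) (total P) l
      (w / (G + 1) ^ t % (G + 1)) := rfl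
    refine (Runs.cond (T₁ := 7) (T₂ := 2) (fun hb => ?_) fun hb => Runs.block ?_).of_le (by omega)
    · simp only [Test.Holds, g42, h₅] at hb
      refine (Runs.cond (fun hb' => Runs.block ?_) fun hb' => Runs.skip ?_).of_le (by simp)
      · simp only [Test.Holds, g12, hE₅.len] at hb'
        rw [hstep, Decoder.step, if_pos hb, if_pos hb']
        simp [applyAll, g39, g40, g12, g2, g3, g42, hE₅.tot, hE₅.one]
      · simp only [Test.Holds, g12, hE₅.len] at hb'
        rw [hstep, Decoder.step, if_pos hb, if_neg hb']
        simp [g39, g40, g12, g2]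
    · simp only [Test.Holds, g42, h₅] at hb
      rw [hstep, Decoder.step, if_neg hb]
      simp [applyAll, g39, g40, g12, g2, hE₅.one]

/-- Array `5` holds a candidate, of complexity `natVar 20` and cost `realVar 8`. -/
structure Best (P : Fin n → Curve d) (l : ℕ) (s : Store) : Prop where
  pos : 0 < s.natVar 20
  le : s.natVar 20 ≤ l
  lt : ∀ u < s.natVar 20, s.natArr 5 u < total P
  cost_eq : s.realVar 8 = cost P (s.natArr 5) (s.natVar 20)

theorem Best.congr (h : Best P l s) (h20 : s'.natVar 20 = s.natVar 20)
    (h5 : s'.natArr 5 = s.natArr 5) (h8 : s'.realVar 8 = s.realVar 8) : Best P l s' :=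
  ⟨by rw [h20]; exact h.pos, by rw [h20]; exact h.le, by rw [h20, h5]; exact h.lt,
    by rw [h20, h5, h8]; exact h.cost_eq⟩

theorem runs_saveProg_best (hE : Env P l s) {a : ℕ} {c : ℕ → ℕ} (ha : s.natVar 12 = a)
    (ha0 : 0 < a) (hal : a ≤ l) (hc : s.natArr 2 = c) (hcN : ∀ u < a, c u < total P)
    (h5 : s.realVar 5 = cost P c a) :
    Runs saveProg s (l * 5 + 5) fun s' => Best P l s' ∧ s'.realVar 8 = cost P c a := by
  refine (runs_saveProg hE ha).weaken (by omega) fun s₁ ⟨h8, h20, harr⟩ _ => ?_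
  rw [hc] at harr
  refine ⟨⟨by omega, by omega, ?_, ?_⟩, by rw [h8, h5]⟩
  · rw [h20]
    intro u hu
    rw [harr u hu]
    exact hcN u hu
  · rw [h8, h5, h20]
    exact cost_congr P ha0 fun u hu => (harr u hu).symm

/-- Evaluates the candidate encoded by the word in variable `38`. -/
def tryProg : Prog :=
  .seq decodeProg <|
  .cond (.natLt 3 12) (.seq costProg (.cond (.realLt 5 8) saveProg .skip)) .skip

/-- A bound for the running time of `tryProg`. -/
def tryTime (d n m l w : ℕ) : ℕ := 2 * l * (4 * w + 17) + costTime d n m l + l * 5 + 13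

/-- A word may decode to no vertex at all. It is then passed over, hence the condition `0 < a`. -/
theorem runs_tryProg (hE : Env P l s) {m G w : ℕ} {sz A : ℕ → ℕ} (hm : ∀ i < n, size P i ≤ m)
    (hpos : ∀ i < n, 0 < size P i) (h35 : s.natVar 35 = G) (h36 : s.natVar 36 = G + 1)
    (h43 : s.natVar 43 = 2 * l) (h38 : s.natVar 38 = w) (h4 : s.natArr 4 = sz)
    (h3 : s.natArr 3 = A) (hA : ∀ c, ∀ g < sz c, A (c * total P + g) < total P)
    (hB : Best P l s) {a : ℕ} {c : ℕ → ℕ}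
    (ha : (Decoder.run sz A (total P) l (G + 1) w (fun _ => 0) (2 * l)).cnt = a)
    (hc : (Decoder.run sz A (total P) l (G + 1) w (fun _ => 0) (2 * l)).out = c) :
    Runs tryProg s (tryTime d n m l w) fun s' =>
      Best P l s' ∧ s'.realVar 8 ≤ s.realVar 8 ∧ (0 < a → s'.realVar 8 ≤ cost P c a) := by
  refine ((runs_decodeProg hE h35 h36 h43 h38).seq (T₂ := costTime d n m l + l * 5 + 7)
    fun s₁ h₁ hf₁ => ?_).of_le (by unfold tryTime; omega)
  rw [h4, h3] at h₁
  have hval := Decoder.run_valid sz A (total P) l hA (G + 1) w (s.natArr 2) (2 * l)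
  have hcg := Decoder.run_congr sz A (total P) l (G + 1) w (s.natArr 2) (fun _ => 0) (2 * l)
  generalize Decoder.run sz A (total P) l (G + 1) w (s.natArr 2) (2 * l) = σ at h₁ hval hcg
  rw [ha, hc] at hcg
  have hσa := hcg.2.1
  rw [hσa] at h₁ hval hcg
  have hE₁ := hE.frame hf₁ (by decide)
  have hB₁ : Best P l s₁ := hB.congr (hf₁.nv 20 (by decide)) (hf₁.na 5 (by decide))
    (hf₁.rv 8 (by decide))
  have h8₁ : s₁.realVar 8 = s.realVar 8 := hf₁.rv 8 (by decide)
  refine (Runs.cond (T₁ := costTime d n m l + l * 5 + 6) (T₂ := 1) (fun hb => ?_)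
    fun hb => Runs.skip ?_).of_le (by omega)
  · simp only [Test.Holds, h₁.1, hE₁.zero] at hb
    have hcost : cost P σ.out a = cost P c a := cost_congr P hb hcg.2.2
    refine ((runs_costProg hE₁ hm hpos h₁.1 hb hval.1 h₁.2 hval.2).seq (T₂ := l * 5 + 6)
      fun s₂ h₂ hf₂ => ?_).of_le (by omega)
    have hE₂ := hE₁.frame hf₂ (by decide)
    have h8₂ : s₂.realVar 8 = s.realVar 8 := by rw [hf₂.rv 8 (by decide), h8₁]
    refine (Runs.cond (T₁ := l * 5 + 5) (T₂ := 1) (fun hb' => ?_)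
      fun hb' => Runs.skip ?_).of_le (by omega)
    · simp only [Test.Holds, h₂, h8₂] at hb'
      refine (runs_saveProg_best hE₂ (by rw [hf₂.nv 12 (by decide), h₁.1]) hb hval.1
        (by rw [hf₂.na 2 (by decide), h₁.2]) hval.2 h₂).weaken le_rfl fun s₃ h₃ _ => ?_
      refine ⟨h₃.1, ?_, fun _ => ?_⟩
      · rw [h₃.2]
        exact hb'.le
      · rw [h₃.2, hcost]
    · simp only [Test.Holds, h₂, h8₂, not_lt] at hb'
      refine ⟨hB₁.congr (hf₂.nv 20 (by decide)) (hf₂.na 5 (by decide)) (hf₂.rv 8 (by decide)),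
        h8₂.le, fun _ => ?_⟩
      rw [h8₂, ← hcost]
      exact hb'
  · simp only [Test.Holds, h₁.1, hE₁.zero] at hb
    exact ⟨hB₁, h8₁.le, fun h => absurd h hb⟩

/-- Tries all words of length `2 l` over the digits `0, …, natVar 35`. -/
def searchProg : Prog :=
  .seq (block [.natAdd 36 35 4, .natAdd 43 2 2, .natConst 37 1]) <|
  .seq (forLoop 0 41 43 (block [.natMul 37 37 36])) <|
  forLoop 0 38 37 tryProg

/-- A bound for the running time of `searchProg`, if there are `W` words. -/
def searchTime (d n m l W : ℕ) : ℕ := W * (tryTime d n m l W + 2) + 8 * l + 8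

theorem runs_searchProg (hE : Env P l s) {m G : ℕ} {sz A : ℕ → ℕ} (hm : ∀ i < n, size P i ≤ m)
    (hpos : ∀ i < n, 0 < size P i) (h35 : s.natVar 35 = G) (h4 : s.natArr 4 = sz)
    (h3 : s.natArr 3 = A) (hA : ∀ c, ∀ g < sz c, A (c * total P + g) < total P)
    (hB : Best P l s) :
    Runs searchProg s (searchTime d n m l ((G + 1) ^ (2 * l))) fun s' =>
      Best P l s' ∧ s'.realVar 8 ≤ s.realVar 8 ∧ ∀ w < (G + 1) ^ (2 * l), ∀ a c,
        (Decoder.run sz A (total P) l (G + 1) w (fun _ => 0) (2 * l)).cnt = a →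
        (Decoder.run sz A (total P) l (G + 1) w (fun _ => 0) (2 * l)).out = c →
        0 < a → s'.realVar 8 ≤ cost P c a := by
  set W := (G + 1) ^ (2 * l) with hW
  refine ((Runs.block (Q := fun s' => s'.natVar 36 = G + 1 ∧ s'.natVar 43 = 2 * l ∧
    s'.natVar 37 = 1) ?_).seq (T₂ := W * (tryTime d n m l W + 2) + 8 * l + 4)
    fun s₁ h₁ hf₁ => ?_).of_le (by simp only [List.length, searchTime]; omega)
  · simp [applyAll, h35, hE.one, hE.len, two_mul]
  have hE₁ := hE.frame hf₁ (by decide)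
  refine ((Runs.forLoop (N := 2 * l) (T := 2) (fun t s' => s'.natVar 37 = (G + 1) ^ t) (by decide)
    hE₁.one h₁.2.1 (Nat.zero_le _) (by simp [h₁.2.2]) ?_).seq
    (T₂ := W * (tryTime d n m l W + 2) + 2) fun s₂ h₂ hf₂ => ?_).of_le (by omega)
  · rintro t s₂ - ht h41 hI hf₂
    refine Runs.block ?_
    simp [applyAll, hI, hf₂.nv 36 (by decide), h₁.1, pow_succ]
  have hE₂ := hE₁.frame hf₂ (by decide)
  have h8₂ : s₂.realVar 8 = s.realVar 8 := by rw [hf₂.rv 8 (by decide), hf₁.rv 8 (by decide)]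
  refine (Runs.forLoop (N := W) (T := tryTime d n m l W) (fun i s' =>
    Best P l s' ∧ s'.realVar 8 ≤ s.realVar 8 ∧ ∀ w < i, ∀ a c,
        (Decoder.run sz A (total P) l (G + 1) w (fun _ => 0) (2 * l)).cnt = a →
        (Decoder.run sz A (total P) l (G + 1) w (fun _ => 0) (2 * l)).out = c →
        0 < a → s'.realVar 8 ≤ cost P c a) (by decide) hE₂.one h₂.1 (Nat.zero_le _) ?_ ?_).weaken
    le_rfl fun s' h' _ => h'.1
  · refine ⟨hB.congr ?_ ?_ ?_, h8₂.le, by simp⟩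
    · simp [hf₂.nv 20 (by decide), hf₁.nv 20 (by decide)]
    · simp [hf₂.na 5 (by decide), hf₁.na 5 (by decide)]
    · simp [h8₂]
  · rintro w s₃ - hw h38 ⟨hI1, hI2, hI3⟩ hf₃
    have hE₃ := hE₂.frame hf₃ (by decide)
    refine (runs_tryProg hE₃ (G := G) (w := w) hm hpos ?_ ?_ ?_ h38 ?_ ?_ hA hI1 rfl rfl).weaken
      ?_ fun s₄ h₄ _ => ⟨h₄.1.congr (by simp) rfl rfl, h₄.2.1.trans hI2, fun w' hw' a c ha hc h0 => ?_⟩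
    · rw [hf₃.nv 35 (by decide), hf₂.nv 35 (by decide), hf₁.nv 35 (by decide), h35]
    · rw [hf₃.nv 36 (by decide), hf₂.nv 36 (by decide), h₁.1]
    · rw [hf₃.nv 43 (by decide), hf₂.nv 43 (by decide), h₁.2.1]
    · rw [hf₃.na 4 (by decide), hf₂.na 4 (by decide), hf₁.na 4 (by decide), h4]
    · rw [hf₃.na 3 (by decide), hf₂.na 3 (by decide), hf₁.na 3 (by decide), h3]
    · have : 2 * l * (4 * w + 17) ≤ 2 * l * (4 * W + 17) := Nat.mul_le_mul_left _ (by omega)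
      unfold tryTime
      omega
    · rcases Nat.lt_succ_iff_lt_or_eq.1 hw' with hw' | rfl
      · exact h₄.2.1.trans (hI3 w' hw' a c ha hc h0)
      · subst ha hc
        exact h₄.2.2 h0

/-- Writes out the best solution. -/
def outputProg : Prog :=
  .seq (forLoop 0 46 20 <|
    .seq (block [.natLoad 45 5 46, .natMul 45 45 0, .natMul 44 46 0]) <|
    forLoop 0 47 0 (block [.natAdd 48 45 47, .realLoad 13 0 48, .natAdd 48 44 47,
      .realStore 1 48 13])) <|
  block [.natAdd 0 20 3]

/-- The complexity is written last, because variable `0` holds the dimension needed for addressing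
until then. -/
theorem runs_outputProg (hE : Env P l s) (hB : Best P l s) :
    Runs outputProg s (l * (d * 7 + 8) + 4) fun s' =>
      Outputs s' (indexedCurve P (s.natArr 5) (s.natVar 20) hB.pos) := by
  refine ((Runs.forLoop (N := s.natVar 20) (T := d * 7 + 6) (fun u s' =>
    ∀ (u' : ℕ) (k : Fin d), u' * d + k < u * d →
      s'.realArr 1 (u' * d + k) = pt P (s.natArr 5 u') k) (by decide) hE.one rfl (Nat.zero_le _)
    (by simp) ?_).seq (T₂ := 2) fun s₁ h₁ hf₁ => Runs.block ?_).of_le ?_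
  · rintro u s₁ - hu h46 hI hf₁
    have hE₁ := hE.frame hf₁ (by decide)
    have h5 : s₁.natArr 5 = s.natArr 5 := hf₁.na 5 (by decide)
    refine ((Runs.block (Q := fun s' => s'.natVar 45 = s.natArr 5 u * d ∧ s'.natVar 44 = u * d)
      ?_).seq (T₂ := d * 7 + 2) fun s₂ h₂ hf₂ => ?_).of_le (by simp only [List.length]; omega)
    · simp [applyAll, h46, h5, hE₁.dim]
    have hE₂ := hE₁.frame hf₂ (by decide)
    refine (Runs.forLoop (N := d) (T := 5) (fun i s' =>
      ∀ (u' : ℕ) (k : Fin d), u' * d + k < u * d + i →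
        s'.realArr 1 (u' * d + k) = pt P (s.natArr 5 u') k) (by decide) hE₂.one hE₂.dim
      (Nat.zero_le _) ?_ ?_).weaken le_rfl fun s' h' _ u' k huk => ?_
    · intro u' k huk
      simp only [Store.realArr_setNat, hf₂.ra 1 (by decide)]
      exact hI u' k huk
    · rintro i s₃ - hi h47 hI' hf₃
      have hE₃ := hE₂.frame hf₃ (by decide)
      refine Runs.block fun u' k huk => ?_
      have h45 : s₃.natVar 45 = s.natArr 5 u * d := by rw [hf₃.nv 45 (by decide), h₂.1]
      have h44 : s₃.natVar 44 = u * d := by rw [hf₃.nv 44 (by decide), h₂.2]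
      have hcoord := hE₃.coord _ (hB.lt u hu) ⟨i, hi⟩
      simp only at hcoord
      simp only [applyAll, Instr.apply, Store.natVar_setNat, Store.realArr_setNat,
        Store.realArr_setReal, Store.realArr_setRealArr, Store.natVar_setReal,
        Store.realVar_setNat, Store.realVar_setReal, h45, h44, h47, reduceIte, Nat.reduceEqDiff,
        hcoord]
      -- Division with remainder by `d` recovers vertex and coordinate from the address, so only the
      -- intended entry is overwritten.
      rcases eq_or_ne (u' * d + k) (u * d + i) with he | hne
      · have hd : 0 < d := by omega
        have hu' : u' = u := by
          have := congrArg (· / d) he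
          simpa [mul_comm _ d, Nat.mul_add_div hd, Nat.div_eq_of_lt hi,
            Nat.div_eq_of_lt k.2] using this
        subst hu'
        have hk : k = ⟨i, hi⟩ := Fin.ext (by simpa using he)
        rw [he, Function.update_self, hk]
      · rw [Function.update_of_ne hne]
        exact hI' u' k (by omega)
    · have := h'.1 u' k (by rw [Nat.succ_mul] at huk; exact huk)
      simpa using this
  · have hE₁' : s₁.natVar 20 = s.natVar 20 := hf₁.nv 20 (by decide)
    have hE₁'' : s₁.natVar 3 = 0 := by rw [hf₁.nv 3 (by decide), hE.zero]
    refine ⟨by simp [applyAll, hE₁', hE₁'', indexedCurve], fun j k => ?_⟩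
    have hlt : (j : ℕ) * d + k < s.natVar 20 * d := by
      have h1 : ((j : ℕ) + 1) * d ≤ s.natVar 20 * d := Nat.mul_le_mul_right _ j.2
      rw [Nat.succ_mul] at h1
      have := k.2
      omega
    exact h₁.1 j k hlt
  · have := Nat.mul_le_mul_right (d * 7 + 8) hB.le
    have e : s.natVar 20 * (d * 7 + 6 + 2) = s.natVar 20 * (d * 7 + 8) := rfl
    omega

end EnumProg

/-! ### The algorithm -/

section Main

variable {d n : ℕ} {P : Fin n → Curve d} {l : ℕ} {s s' : Store}

/-- Computes an initial solution and its cost. -/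
def initialSolutionProg : Prog := .seq streamProg <| .seq costProg saveProg

/-- A bound for the running time of `initialSolutionProg`. -/
def initialSolutionTime (d n m l : ℕ) : ℕ := streamTime d m l + costTime d n m l + l * 5 + 5

theorem runs_initialSolutionProg (hE : Env P l s) (hn : 0 < n) (hl : 1 ≤ l) {m : ℕ}
    (hm : ∀ i < n, size P i ≤ m) (hpos : ∀ i < n, 0 < size P i) :
    Runs initialSolutionProg s (initialSolutionTime d n m l) fun s' =>
      Best P l s' ∧ s'.realVar 8 = cost P (s'.natArr 2) (s'.natVar 12) ∧
        ∃ r, StreamInv P l (size P 0) (s'.natVar 12) (s'.natArr 2) r := by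
  refine ((runs_streamProg hE hn hl (hm 0 hn) (hpos 0 hn)).seq
    (T₂ := costTime d n m l + (l * 5 + 5)) fun s₁ ⟨r, hr⟩ hf₁ => ?_).of_le
      (by unfold initialSolutionTime; omega)
  have hE₁ := hE.frame hf₁ (by decide)
  have hk := hr.clusters.pos (hpos 0 hn)
  have hSN : ∀ u < s₁.natVar 12, s₁.natArr 2 u < total P := fun u hu => by
    have := start_add_lt P hn (hr.clusters.lt hu)
    rwa [start_zero, zero_add] at this
  refine (runs_costProg hE₁ hm hpos rfl hk hr.card_le rfl hSN).seq fun s₂ h₂ hf₂ => ?_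
  have hE₂ := hE₁.frame hf₂ (by decide)
  refine (runs_saveProg_best hE₂ (hf₂.nv 12 (by decide)) hk hr.card_le (hf₂.na 2 (by decide)) hSN
    h₂).weaken le_rfl fun s₃ h₃ hf₃ => ?_
  rw [hf₃.nv 12 (by decide), hf₃.na 2 (by decide), hf₂.nv 12 (by decide), hf₂.na 2 (by decide)]
  exact ⟨h₃.1, h₃.2, r, hr⟩

/-- Sets the radii of the nets to `1 / 10` of the cost of the initial solution, and the radii of
the neighborhoods of the representatives to `90` times as much. -/
def radiiProg : Prog :=
  block [.natConst 34 10, .realOfNat 13 34, .realDiv 11 8 13, .natConst 34 90, .realOfNat 13 34,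
    .realMul 12 13 11]

theorem runs_radiiProg : Runs radiiProg s 7 fun s' =>
    s'.realVar 11 = s.realVar 8 / 10 ∧ s'.realVar 12 = 90 * (s.realVar 8 / 10) := by
  refine Runs.block ?_
  simp [applyAll]

/-- The algorithm. -/
def mainProg : Prog :=
  .seq initProg <| .seq initialSolutionProg <| .seq radiiProg <| .seq netProg <|
    .seq searchProg outputProg

/-- A bound for the running time of `mainProg`, for nets of at most `γ` points. -/
def mainTime (d γ n m l : ℕ) : ℕ :=
  n * 5 + 4 + (initialSolutionTime d n m l + (7 + (netTime d γ (n * m) l +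
    (searchTime d n m l ((γ + 1) ^ (2 * l)) + (l * (d * 7 + 8) + 4)))))

theorem total_le {m : ℕ} (hm : ∀ i < n, size P i ≤ m) : total P ≤ n * m := by
  have key : ∀ i ≤ n, start P i ≤ i * m := by
    intro i
    induction i with
    | zero => simp [start_zero]
    | succ i ih =>
      intro hi
      rw [start_succ P hi, Nat.succ_mul]
      exact add_le_add (ih (by omega)) (hm i hi)
  exact key n le_rfl

theorem searchTime_mono {m W W' : ℕ} (h : W ≤ W') :
    searchTime d n m l W ≤ searchTime d n m l W' := by
  unfold searchTime tryTime
  gcongr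

theorem runs_mainProg (P : Fin n → Curve d) (l : ℕ) (ε : ℝ) (hn : 0 < n) (hl : 1 ≤ l) {m γ : ℕ}
    (hm : ∀ i < n, size P i ≤ m)
    (hγ : ∀ (c : EuclideanSpace ℝ (Fin d)) (r : ℝ) (x : ℕ → EuclideanSpace ℝ (Fin d)) (s : ℕ),
      0 ≤ r → (∀ g < s, dist c (x g) ≤ 90 * r) →
      (∀ g < s, ∀ g' < g, r < dist (x g') (x g)) → s ≤ γ) :
    Runs mainProg (initialStore P l ε) (mainTime d γ n m l) fun s' =>
      ∃ (c : ℕ → ℕ) (a : ℕ) (ha : 0 < a), a ≤ l ∧ (∀ u < a, c u < total P) ∧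
        (∀ δ, Feasible P l δ → cost P c a ≤ 2 * δ) ∧ Outputs s' (indexedCurve P c a ha) := by
  have hpos : ∀ i < n, 0 < size P i := fun i hi => by
    rw [show i = ((⟨i, hi⟩ : Fin n) : ℕ) from rfl, size_coe]
    exact (P ⟨i, hi⟩).complexity_pos
  have h4 : ∀ c, (initialStore P l ε).natArr 4 c = 0 := fun c => by simp [initialStore]
  unfold mainProg mainTime
  refine (runs_initProg P l ε).seq fun s₁ hE₁ hf₁ => ?_
  refine (runs_initialSolutionProg hE₁ hn hl hm hpos).seq fun s₂ ⟨hB₂, h8₂, r, hr⟩ hf₂ => ?_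
  have hE₂ := hE₁.frame hf₂ (by decide)
  refine runs_radiiProg.seq fun s₃ ⟨h11, h12⟩ hf₃ => ?_
  have hE₃ := hE₂.frame hf₃ (by decide)
  have hk : 0 < s₂.natVar 12 := hr.clusters.pos (hpos 0 hn)
  have hSN : ∀ u < s₂.natVar 12, s₂.natArr 2 u < total P := fun u hu => by
    have := start_add_lt P hn (hr.clusters.lt hu)
    rwa [start_zero, zero_add] at this
  generalize hk₂ : s₂.natVar 12 = k at *
  generalize hS₂ : s₂.natArr 2 = S at *
  generalize hD : s₂.realVar 8 = D at *
  have hD0 : 0 ≤ D := h8₂ ▸ cost_nonneg P _ _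
  have hη : 0 ≤ D / 10 := by positivity
  refine ((runs_netProg hE₃ (γ := γ) hη h11 h12 (by rw [hf₃.nv 12 (by decide), hk₂]) hr.card_le
    (by rw [hf₃.na 2 (by decide), hS₂]) hSN ?_ ?_).of_le ?_).seq
    fun s₄ ⟨hG, hsz, hsz0, hnet⟩ hf₄ => ?_
  · intro c
    rw [hf₃.na 4 (by decide), hf₂.na 4 (by decide), hf₁.na 4 (by decide), h4]
  · exact fun c x A b z h => hγ _ _ (fun g => pt P (A (b + g))) z hη h.near h.sep
  · unfold netTime
    gcongr
    exact total_le hm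
  have hE₄ := hE₃.frame hf₄ (by decide)
  have hB₄ : Best P l s₄ := hB₂.congr
    (by rw [hf₄.nv 20 (by decide), hf₃.nv 20 (by decide)])
    (by rw [hf₄.na 5 (by decide), hf₃.na 5 (by decide)])
    (by rw [hf₄.rv 8 (by decide), hf₃.rv 8 (by decide)])
  have h8₄ : s₄.realVar 8 = D := by rw [hf₄.rv 8 (by decide), hf₃.rv 8 (by decide), hD]
  have hA : ∀ c, ∀ g < s₄.natArr 4 c, s₄.natArr 3 (c * total P + g) < total P := by
    intro c g hg
    rcases lt_or_ge c k with hc | hc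
    · exact (hnet c hc).lt g hg
    · rw [hsz0 c hc] at hg
      omega
  refine ((runs_searchProg hE₄ hm hpos rfl rfl rfl hA hB₄).of_le (searchTime_mono
    (Nat.pow_le_pow_left (Nat.succ_le_succ hG) _))).seq fun s₅ ⟨hB₅, hle, hall⟩ hf₅ => ?_
  have hE₅ := hE₄.frame hf₅ (by decide)
  refine (runs_outputProg hE₅ hB₅).weaken le_rfl fun s₆ hout _ =>
    ⟨_, _, hB₅.pos, hB₅.le, hB₅.lt, fun δ hδ => ?_, hout⟩
  rw [← hB₅.cost_eq]
  rw [h8₄] at hle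
  -- The search only improves on `D`, which settles the first case. In the second, `D > 2 * δ` makes
  -- the radius `9 * D` at least `9 * δ`, while `D ≤ 10 * δ` makes the net width `D / 10` at most
  -- `δ`.
  rcases le_or_gt D (2 * δ) with h | h
  · exact hle.trans h
  · have hDδ : D ≤ 10 * δ := h8₂ ▸ hr.cost_le hn hδ
    have hδ0 := hδ.nonneg P hn
    obtain ⟨a, f, g, ha, hal, hf, hfg, hcost⟩ := hr.exists_net_sequence hn hδ
      (fun c hc => (hnet c hc).cover) (by linarith) (by linarith)
    obtain ⟨w, hw, hcnt, hrun⟩ := exists_word (s₄.natArr 4) (s₄.natArr 3) (total P) l hsz hal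
      hr.card_le hf hfg fun _ => 0
    exact (hall w hw a _ hcnt rfl ha).trans (hcost _ hrun)

/-! ### Estimates of the running time -/

theorem costTime_le {m : ℕ} (hn : 0 < n) (hm : 0 < m) (hl : 0 < l) :
    costTime d n m l ≤ (10 * d + 65) * (l * m * n) := by
  have h1 : n * m ≤ l * m * n := by nlinarith [Nat.mul_le_mul_right (m * n) hl]
  have h2 : n ≤ n * m := Nat.le_mul_of_pos_right _ hm
  have e : costTime d n m l = (10 * d + 41) * (l * m * n) + 4 * (n * m) + 15 * n + 5 := by
    unfold costTime
    ring
  have e' : (10 * d + 65) * (l * m * n) = (10 * d + 41) * (l * m * n) + 24 * (l * m * n) := by ring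
  omega

theorem streamTime_le {m : ℕ} (hn : 0 < n) (hm : 0 < m) (hl : 0 < l) :
    streamTime d m l ≤ (50 * d + 104) * (l * m * n) := by
  have h1 : l * m ≤ l * m * n := Nat.le_mul_of_pos_right _ hn
  have h2 : m ≤ l * m := Nat.le_mul_of_pos_left _ hl
  calc streamTime d m l = (20 * d + 36) * (l * m) + (30 * d + 61) * m + 7 := by
        unfold streamTime
        ring
    _ ≤ (20 * d + 36) * (l * m * n) + (30 * d + 61) * (l * m * n) + 7 * (l * m * n) := by
        gcongr <;> omega
    _ = (50 * d + 104) * (l * m * n) := by ring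

theorem netTime_le (γ : ℕ) {m : ℕ} (hn : 0 < n) (hm : 0 < m) (hl : 0 < l) :
    netTime d γ (n * m) l ≤ (γ * (10 * d + 17) + 10 * d + 39) * (l * m * n) := by
  have h1 : l * m ≤ l * m * n := Nat.le_mul_of_pos_right _ hn
  have h2 : l ≤ l * m := Nat.le_mul_of_pos_right _ hm
  calc netTime d γ (n * m) l
      = (γ * (10 * d + 17) + 10 * d + 24) * (l * m * n) + 11 * l + 4 := by
        unfold netTime
        ring
    _ ≤ (γ * (10 * d + 17) + 10 * d + 24) * (l * m * n) + 11 * (l * m * n) +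
        4 * (l * m * n) := by gcongr <;> omega
    _ = (γ * (10 * d + 17) + 10 * d + 39) * (l * m * n) := by ring

/-- One factor `W` counts the words; the other bounds the value of a word, hence the time of the
divisions that decode it. -/
theorem searchTime_le {m W : ℕ} (hn : 0 < n) (hm : 0 < m) (hl : 0 < l) (hW : 0 < W) :
    searchTime d n m l W ≤ (10 * d + 143) * (W * W * (l * m * n)) := by
  have h1 : l * m ≤ l * m * n := Nat.le_mul_of_pos_right _ hn
  have h2 : l ≤ l * m := Nat.le_mul_of_pos_right _ hm
  have h3 : W ≤ W * W := Nat.le_mul_of_pos_right _ hW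
  calc searchTime d n m l W
      = 8 * (W * W * l) + W * (39 * l + 15 + costTime d n m l) + 8 * l + 8 := by
        unfold searchTime tryTime
        ring
    _ ≤ 8 * (W * W * (l * m * n)) + W * W * (39 * (l * m * n) + 15 * (l * m * n) +
          (10 * d + 65) * (l * m * n)) + 8 * (W * W * (l * m * n)) +
          8 * (W * W * (l * m * n)) := by
        have h4 : l * m * n ≤ W * W * (l * m * n) := Nat.le_mul_of_pos_left _ (by positivity)
        have h5 := costTime_le (d := d) hn hm hl
        gcongr <;> omega
    _ = (10 * d + 143) * (W * W * (l * m * n)) := by ring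

/-- The running time is at most `l m n` times a single exponential in `l`. -/
theorem mainTime_le (d γ : ℕ) : ∃ C : ℕ, ∀ n m l : ℕ, 0 < n → 0 < m → 0 < l →
    mainTime d γ n m l ≤ C * (((γ + 1) ^ 4) ^ l * (l * m * n)) := by
  refine ⟨(50 * d + 104) + (10 * d + 65) + (γ * (10 * d + 17) + 10 * d + 39) + (10 * d + 143) +
    (7 * d + 12) + 26, fun n m l hn hm hl => ?_⟩
  have hW : 0 < (γ + 1) ^ (2 * l) := by positivity
  have hWW : (γ + 1) ^ (2 * l) * (γ + 1) ^ (2 * l) = ((γ + 1) ^ 4) ^ l := by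
    rw [← pow_add, ← pow_mul]
    congr 1
    omega
  have h1 := searchTime_le (d := d) hn hm hl hW
  rw [hWW] at h1
  have h2 : l * m * n ≤ ((γ + 1) ^ 4) ^ l * (l * m * n) :=
    Nat.le_mul_of_pos_left _ (by positivity)
  have h3 : n ≤ l * m * n := Nat.le_mul_of_pos_left _ (by positivity)
  have h4 : l ≤ l * m * n := by
    rw [mul_assoc]
    exact Nat.le_mul_of_pos_right _ (by positivity)
  have h5 := (streamTime_le (d := d) hn hm hl).trans (Nat.mul_le_mul_left _ h2)
  have h6 := (costTime_le (d := d) hn hm hl).trans (Nat.mul_le_mul_left _ h2)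
  have h7 := (netTime_le (d := d) γ hn hm hl).trans (Nat.mul_le_mul_left _ h2)
  have h8 : l * (d * 7 + 8) + 4 ≤ (7 * d + 12) * (((γ + 1) ^ 4) ^ l * (l * m * n)) := by
    calc l * (d * 7 + 8) + 4 ≤ (l * m * n) * (d * 7 + 8) + 4 * (l * m * n) := by
          gcongr
          omega
      _ = (7 * d + 12) * (l * m * n) := by ring
      _ ≤ _ := Nat.mul_le_mul_left _ h2
  generalize ((γ + 1) ^ 4) ^ l * (l * m * n) = Y at *
  simp only [add_mul, mainTime, initialSolutionTime] at *
  omega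

/-- Either `l` has reached the base, and `l ^ l` dominates, or the exponent is below `A`, and the
constant `A ^ A` does. This trades a base depending on the dimension for a constant factor. -/
theorem pow_le_pow_self (A l : ℕ) (hA : 0 < A) : A ^ l ≤ A ^ A * l ^ l := by
  rcases le_or_gt A l with h | h
  · calc A ^ l ≤ l ^ l := Nat.pow_le_pow_left h l
      _ ≤ A ^ A * l ^ l := Nat.le_mul_of_pos_left _ (by positivity)
  · calc A ^ l ≤ A ^ A := Nat.pow_le_pow_right hA h.le
      _ ≤ A ^ A * l ^ l := Nat.le_mul_of_pos_right _ (by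
        rcases Nat.eq_zero_or_pos l with rfl | hl
        · simp
        · positivity)

end Main

end MiddleCurve

end

theorem mainTheorem4 :
    ∃ A : MiddleCurve.Prog, ∀ d : ℕ, ∃ K : ℝ,
      ∀ (ε : ℝ) (n m l : ℕ) (P : Fin n → MiddleCurve.Curve d),
        0 < ε → 1 ≤ n → 1 ≤ l → (∀ i, (P i).complexity ≤ m) →
        ∃ (s : MiddleCurve.Store) (t : ℕ) (M : MiddleCurve.Curve d),
          MiddleCurve.Exec A (MiddleCurve.initialStore P l ε) s t ∧
          MiddleCurve.Outputs s M ∧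
          MiddleCurve.IsApproxMiddleCurve (2 + ε) P l M ∧
          (t : ℝ) ≤ K * ((((4 * Real.sqrt d / ε + 1) ^ d * l) ^ l + Real.log (l + n)) * l * m * n) := by
  refine ⟨MiddleCurve.mainProg, fun d => ?_⟩
  obtain ⟨γ, hγ⟩ := MiddleCurve.exists_packing_bound d
  obtain ⟨C, hC⟩ := MiddleCurve.mainTime_le d γ
  set A := (γ + 1) ^ 4 with hA
  -- Both `C` and `A` come from the packing bound, hence from `d` alone.
  refine ⟨C * (A : ℝ) ^ A, fun ε n m l P hε hn hl hm => ?_⟩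
  have hm' : ∀ i < n, MiddleCurve.size P i ≤ m := fun i hi => by
    rw [show i = ((⟨i, hi⟩ : Fin n) : ℕ) from rfl, MiddleCurve.size_coe]
    exact hm _
  have hm0 : 0 < m := (P ⟨0, hn⟩).complexity_pos.trans_le (hm _)
  obtain ⟨s, t, hexec, ht, c, a, ha, hal, hcN, hcost, hout⟩ :=
    MiddleCurve.runs_mainProg P l ε hn hl hm' hγ
  refine ⟨s, t, _, hexec, hout, MiddleCurve.isApproxMiddleCurve_indexedCurve P hn ha hal hcN
    (by linarith) hcost, ?_⟩
  have h1 : t ≤ C * (A ^ A * l ^ l * (l * m * n)) :=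
    (ht.trans (hC n m l hn hm0 hl)).trans (Nat.mul_le_mul_left _ (Nat.mul_le_mul_right _
      (MiddleCurve.pow_le_pow_self A l (by positivity))))
  have h2 : (t : ℝ) ≤ C * ((A : ℝ) ^ A * (l : ℝ) ^ l * (l * m * n)) := by exact_mod_cast h1
  -- Only `1 ≤ c` is used of the base in the bound: the time is already at most a constant times `l
  -- ^ l * l * m * n`, and the logarithm is just nonnegative.
  have h3 : (1 : ℝ) ≤ (4 * Real.sqrt d / ε + 1) ^ d :=
    one_le_pow₀ (by linarith [show 0 ≤ 4 * Real.sqrt d / ε by positivity])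
  have h4 : (l : ℝ) ^ l ≤ ((4 * Real.sqrt d / ε + 1) ^ d * l) ^ l := by
    gcongr
    exact le_mul_of_one_le_left (by positivity) h3
  have h5 : 0 ≤ Real.log (l + n) := Real.log_nonneg (by
    have : (1 : ℝ) ≤ l := by exact_mod_cast hl
    linarith [show (0 : ℝ) ≤ n by positivity])
  calc (t : ℝ) ≤ C * ((A : ℝ) ^ A * (l : ℝ) ^ l * (l * m * n)) := h2
    _ = C * (A : ℝ) ^ A * ((l : ℝ) ^ l * l * m * n) := by ring
    _ ≤ _ := by
      gcongr
      linarith
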